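/- **Setting.** A ribbon category over $\mathbb C$ is a $\mathbb C$-linear braided monoidal category with duals and a compatible twist $\theta$; it is symmetric if its braiding is a symmetry. Let $\mathcal C$ be a symmetric ribbon category over $\mathbb C$, $X$ an object with a self-duality with pairing $\cap\colon X\otimes X\to\mathbf 1$ and copairing $\cup$, and $\tau\colon X\otimes X\to X$ a multiplication. Write $\mathcal C(n)=\operatorname{Hom}(X^{\otimes n},\mathbf 1)$. Call $(\mathcal C,X,\tau)$ a *trivalent ribbon category* if $\mathcal C(1)=0$; $\mathcal C(0),\mathcal C(2),\mathcal C(3)$ are one-dimensional, spanned respectively by $\mathrm{id}_{\mathbf 1}$, $\cap$ and $\cap\circ(\tau\otimes\mathrm{id})$; every morphism between tensor powers of $X$ is a linear combination of composites of tensor products of identities, crossings, $\cap$, $\cup$ and $\tau$; the circle (the ribbon dimension $\dim X$) is non-zero; and the bigon is a non-zero multiple of $\mathrm{id}_X$. (The pairing $\cap$ is unique up to a non-zero scalar; it is not assumed to be symmetric, nor $\tau$ to be rotationally invariant.) **Diagrams.** Write $\langle\,,\rangle$ for a symmetric pairing on $X$ for which $\tau$ is rotationally invariant, i.e. $\langle\tau(x,y),z\rangle=\langle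 x,\tau(y,z)\rangle$. Let $\Delta\colon X\to X\otimes X$ be $(\mathrm{id}\otimes\tau)(\cup\otimes\mathrm{id})$, and on $X\otimes X$ put $\mathrm{id}$ (two strands), $U=\cup\circ\cap$, $P$ = the symmetry, $I=\Delta\circ\tau$, $H=(\tau\otimes\mathrm{id})(\mathrm{id}\otimes\Delta)$, $K=P\circ H$, $Q=H\circ H$ (the square). Consider the $\mathbb C$-linear symmetric ribbon categories with trivial twist generated by a symmetrically self-dual strand and a rotationally invariant trivalent vertex $\tau$, with circle $=d$, lollipop $\tau\circ\cup=0$, and relations * $\mathit{Sym}(d+1)$: $\tau P=\tau$, $\tau\Delta=(d-1)\,\mathrm{id}$, $\tau H=(d-2)\tau$, $H-I+\mathrm{id}-U=0$; * $G2(d)$: $\tau P=-\tau$, $\tau\Delta=(1-d)\,\mathrm{id}$, $\tau H=(d-4)\tau$, $I+H=2P-\mathrm{id}-U$; * $F4(d)$: $\tau P=\tau$, $\tau\Delta=\frac{d+2}{4}\,\mathrm{id}$, $\tau H=\frac{2-d}{8}\tau$, $I+H+K=\frac12(U+\mathrm{id}+P)$; * $\mathsf{Exc}_{d,b}$ (for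 $d\neq-2$, $b\ne0$): $\tau P=-\tau$, $\tau\Delta=b\,\mathrm{id}$, $\tau H=\frac b2\tau$, $I-H+K=0$, $Q=\frac b6(I+H)+\frac56\,\frac{b^2}{2+d}(U+\mathrm{id}+P)$. For $\mathcal S$ one of these categories, $X$ (with a given self-duality and $\tau$) is an *$\mathcal S$-algebra object* if there is a $\mathbb C$-linear symmetric ribbon functor $\mathcal S\to\mathcal C$ sending the strand to $X$, the cap to the pairing of $X$ and the trivalent vertex to $\tau$. *Sym-*, *$G2$-* and *$F4$-algebra objects* are those for $\mathit{Sym}(d+1)$, $G2(d)$, $F4(d)$ with $d=\dim X$. **Algebras.** Identities in elements are identities of morphisms, one tensor factor for each variable. For a unital algebra object $A$ with a symmetric self-duality, $\operatorname{tr}(x)=\langle x,1\rangle$. A *normalized commutative Frobenius algebra object* is a unital commutative associative algebra object with a trace such that $\operatorname{tr}(xy)$ is the pairing of a symmetric self-duality and $\operatorname{tr}(1)=1$. A *Hurwitz algebra object* is a unital, not necessarily associative, algebra object with a symmetric self-duality such that $\langle1,1\rangle=1$ and $\langle ac,bd\rangle+\langle ad,bc\rangle=2\langle a,b\rangle\langle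 c,d\rangle$. A *cubic Cayley–Hamilton Jordan algebra object* is a unital commutative algebra object with a symmetric self-duality such that $\langle x,yz\rangle=\langle xy,z\rangle$, $\langle1,1\rangle=1$, $$\sum_{(a,b,c)}\bigl((ay)(bc)-a(y(bc))\bigr)=0,$$ $$\sum_{(a,b,c)}\Bigl(a(bc)-3\operatorname{tr}(a)\,bc+\tfrac92\operatorname{tr}(a)\operatorname{tr}(b)\,c-\tfrac32\operatorname{tr}(ab)\,c-\bigl(\tfrac92\operatorname{tr}(a)\operatorname{tr}(b)\operatorname{tr}(c)-\tfrac92\operatorname{tr}(a)\operatorname{tr}(bc)+\operatorname{tr}(a(bc))\bigr)1\Bigr)=0,$$ the sums being over all permutations of the three variables $a,b,c$. Such a structure on $\mathbf 1\oplus X$ *has traceless part $X$* if its unit is the inclusion of $\mathbf 1$, its trace is the projection to $\mathbf 1$, its pairing restricts to that of $X$, and its multiplication on $X$ followed by the projection to $X$ is $\tau$. **Proposition.** Let $(\mathcal C,X,\tau)$ be a symmetric trivalent ribbon category over $\mathbb C$ with $\dim\mathcal C(4)\le5$ and $\dim X=d$. Then there is a self-duality of $X$, obtained from the given one by rescaling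 the pairing by a non-zero scalar, that is symmetric and for which (with the multiplication $\tau$) at least one of the following holds: * $X$ is a $\mathit{Sym}$-algebra object, and $\mathbf 1\oplus X$, in the additive completion of $\mathcal C$, is a normalized commutative Frobenius algebra object with traceless part $X$; * $X$ is a $G2$-algebra object, and $\mathbf 1\oplus X$, in the additive completion of $\mathcal C$, is a Hurwitz algebra object with traceless part $X$; * $X$ is an $F4$-algebra object, and $\mathbf 1\oplus X$, in the additive completion of $\mathcal C$, is a cubic Cayley–Hamilton Jordan algebra object with traceless part $X$; * $\tau$ is a Lie bracket on $X$ (antisymmetric, with $[x,[y,z]]=[[x,y],z]+[y,[x,z]]$), $d\ne-2$, and $X$ satisfies the classical exceptional relations: for some $b\neq0$ it is an $\mathsf{Exc}_{d,b}$-algebra object. -/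

import Mathlib

open CategoryTheory MonoidalCategory

universe v u

/-! ### Ribbon categories and self-dual objects -/

/-- A ribbon structure on a braided monoidal category with duals: a twist `θ`, i.e. a natural
automorphism of the identity functor with `θ_{Y ⊗ Z} = β_{Z,Y} β_{Y,Z} (θ_Y ⊗ θ_Z)` and
`θ_{Y*} = (θ_Y)*`. -/
class RibbonCategory (C : Type u) [Category.{v} C] [MonoidalCategory C] [BraidedCategory C]
    [RightRigidCategory C] where
  twist : ∀ Y : C, Y ≅ Y
  twist_naturality : ∀ {Y Z : C} (f : Y ⟶ Z), f ≫ (twist Z).hom = (twist Y).hom ≫ f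
  twist_tensor : ∀ Y Z : C, (twist (Y ⊗ Z)).hom =
    ((twist Y).hom ⊗ₘ (twist Z).hom) ≫ (β_ Y Z).hom ≫ (β_ Z Y).hom
  twist_dual : ∀ Y : C, (twist (Yᘁ)).hom = ((twist Y).hom)ᘁ

/-- A (not necessarily symmetric) self-duality of `X`, given by its pairing `cap` and its
copairing `cup`. -/
structure SelfDuality {C : Type u} [Category.{v} C] [MonoidalCategory C] (X : C) where
  cap : X ⊗ X ⟶ 𝟙_ C
  cup : 𝟙_ C ⟶ X ⊗ X
  zigzag_left : cup ▷ X ≫ (α_ X X X).hom ≫ X ◁ cap = (λ_ X).hom ≫ (ρ_ X).inv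
  zigzag_right : X ◁ cup ≫ (α_ X X X).inv ≫ cap ▷ X = (ρ_ X).hom ≫ (λ_ X).inv

namespace SelfDuality

variable {C : Type u} [Category.{v} C] [MonoidalCategory C] {X : C}

/-- The self-duality is symmetric (in a category whose twist is trivial on `X`). -/
def IsSymmetric [BraidedCategory C] (s : SelfDuality X) : Prop :=
  (β_ X X).hom ≫ s.cap = s.cap

/-- `s'` is obtained from `s` by rescaling the pairing by a non-zero scalar (the copairing is
then rescaled by the inverse scalar, since it is determined by the pairing). -/
def IsRescalingOf [Preadditive C] [Linear ℂ C] (s' s : SelfDuality X) : Prop :=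
  ∃ c : ℂ, c ≠ 0 ∧ s'.cap = c • s.cap

end SelfDuality

/-! ### Diagrams with trivalent vertices -/

namespace Trivalent

/-- Tensor words in a single generating object, the strand. -/
inductive Word : Type
  | unit : Word
  | strand : Word
  | tensor : Word → Word → Word

/-- Formal `ℂ`-linear combinations of diagrams built from crossings, caps, cups and trivalent
vertices (read as maps `strand ⊗ strand ⟶ strand`). -/
inductive Term : Word → Word → Type
  | ident (a : Word) : Term a a
  | comp {a b c : Word} (f : Term a b) (g : Term b c) : Term a c
  | par {a b a' b' : Word} (f : Term a b) (g : Term a' b') : Term (a.tensor a') (b.tensor b')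
  | assoc (a b c : Word) : Term ((a.tensor b).tensor c) (a.tensor (b.tensor c))
  | assocInv (a b c : Word) : Term (a.tensor (b.tensor c)) ((a.tensor b).tensor c)
  | leftUnit (a : Word) : Term (Word.unit.tensor a) a
  | leftUnitInv (a : Word) : Term a (Word.unit.tensor a)
  | rightUnit (a : Word) : Term (a.tensor Word.unit) a
  | rightUnitInv (a : Word) : Term a (a.tensor Word.unit)
  | cross (a b : Word) : Term (a.tensor b) (b.tensor a)
  | cap : Term (Word.strand.tensor Word.strand) Word.unit
  | cup : Term Word.unit (Word.strand.tensor Word.strand)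
  | vertex : Term (Word.strand.tensor Word.strand) Word.strand
  | zero (a b : Word) : Term a b
  | add {a b : Word} (f g : Term a b) : Term a b
  | smul {a b : Word} (r : ℂ) (f : Term a b) : Term a b

section eval

variable {C : Type u} [Category.{v} C] [MonoidalCategory C]

/-- The tensor power of `X` that a word stands for. -/
def Word.eval (X : C) : Word → C
  | .unit => 𝟙_ C
  | .strand => X
  | .tensor a b => a.eval X ⊗ b.eval X

/-- The morphism that a diagram stands for, once a self-duality and a multiplication on `X` are
given. -/
noncomputable def Term.eval [BraidedCategory C] [Preadditive C] [Linear ℂ C] {X : C} (s : SelfDuality X)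
    (τ : X ⊗ X ⟶ X) : {a b : Word} → Term a b → (a.eval X ⟶ b.eval X)
  | _, _, .ident a => 𝟙 (a.eval X)
  | _, _, .comp f g => f.eval s τ ≫ g.eval s τ
  | _, _, .par f g => f.eval s τ ⊗ₘ g.eval s τ
  | _, _, .assoc a b c => (α_ (a.eval X) (b.eval X) (c.eval X)).hom
  | _, _, .assocInv a b c => (α_ (a.eval X) (b.eval X) (c.eval X)).inv
  | _, _, .leftUnit a => (λ_ (a.eval X)).hom
  | _, _, .leftUnitInv a => (λ_ (a.eval X)).inv
  | _, _, .rightUnit a => (ρ_ (a.eval X)).hom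
  | _, _, .rightUnitInv a => (ρ_ (a.eval X)).inv
  | _, _, .cross a b => (β_ (a.eval X) (b.eval X)).hom
  | _, _, .cap => s.cap
  | _, _, .cup => s.cup
  | _, _, .vertex => τ
  | _, _, .zero _ _ => 0
  | _, _, .add f g => f.eval s τ + g.eval s τ
  | _, _, .smul r f => r • f.eval s τ

end eval

/-! The basic planar and crossed diagrams. -/

namespace Term

local infixr:80 " ⨟ " => Term.comp

/-- Two strands. -/
abbrev two : Word := Word.strand.tensor Word.strand

/-- The vertex turned upside down: one strand below, two strands above. -/
def split : Term Word.strand two :=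
  leftUnitInv _ ⨟ par cup (ident _) ⨟ assoc _ _ _ ⨟ par (ident _) vertex

/-- Two vertical strands. -/
def twoStrand : Term two two := ident _

/-- A cap below a cup. -/
def cupCap : Term two two := cap ⨟ cup

/-- The symmetric crossing of two strands. -/
def symCross : Term two two := cross _ _

/-- The tree with a vertical inner edge. -/
def treeI : Term two two := vertex ⨟ split

/-- The tree with a horizontal inner edge. -/
def treeH : Term two two :=
  par (ident _) split ⨟ assocInv _ _ _ ⨟ par vertex (ident _)

/-- The tree with a horizontal inner edge whose two upper legs are crossed. -/
def treeX : Term two two := treeH ⨟ cross _ _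

/-- The square with four legs. -/
def square : Term two two := treeH ⨟ treeH

/-- `f - g`. -/
def sub {a b : Word} (f g : Term a b) : Term a b := add f (smul (-1) g)

end Term

/-- The data of the skein theories considered here: the values of the circle, of the twisted
vertex (as a multiple of the vertex), of the bigon and of the triangle, and a set of
combinations of diagrams with four legs that are declared to vanish. -/
structure SkeinTheory where
  circle : ℂ
  vertexSign : ℂ
  bigon : ℂ
  triangle : ℂ
  relations : Set (Term Term.two Term.two)

open Term in
/-- The relations of the `ℂ`-linear symmetric monoidal category generated by a symmetrically
self-dual strand and a rotationally invariant trivalent vertex modulo a skein theory `S`. -/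
inductive Rel (S : SkeinTheory) : {a b : Word} → Term a b → Term a b → Prop
  -- congruence
  | refl {a b} (f : Term a b) : Rel S f f
  | symm {a b} {f g : Term a b} : Rel S f g → Rel S g f
  | trans {a b} {f g h : Term a b} : Rel S f g → Rel S g h → Rel S f h
  | comp_congr {a b c} {f f' : Term a b} {g g' : Term b c} :
      Rel S f f' → Rel S g g' → Rel S (comp f g) (comp f' g')
  | tensor_congr {a b a' b'} {f f' : Term a b} {g g' : Term a' b'} :
      Rel S f f' → Rel S g g' → Rel S (par f g) (par f' g')
  | add_congr {a b} {f f' g g' : Term a b} :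
      Rel S f f' → Rel S g g' → Rel S (add f g) (add f' g')
  | smul_congr {a b} (r : ℂ) {f f' : Term a b} : Rel S f f' → Rel S (smul r f) (smul r f')
  -- category
  | id_comp {a b} (f : Term a b) : Rel S (comp (ident a) f) f
  | comp_id {a b} (f : Term a b) : Rel S (comp f (ident b)) f
  | comp_assoc {a b c d} (f : Term a b) (g : Term b c) (h : Term c d) :
      Rel S (comp (comp f g) h) (comp f (comp g h))
  -- linearity
  | add_assoc {a b} (f g h : Term a b) : Rel S (add (add f g) h) (add f (add g h))
  | add_comm {a b} (f g : Term a b) : Rel S (add f g) (add g f)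
  | zero_add {a b} (f : Term a b) : Rel S (add (zero a b) f) f
  | one_smul {a b} (f : Term a b) : Rel S (smul 1 f) f
  | zero_smul {a b} (f : Term a b) : Rel S (smul 0 f) (zero a b)
  | mul_smul {a b} (r r' : ℂ) (f : Term a b) : Rel S (smul (r * r') f) (smul r (smul r' f))
  | add_smul {a b} (r r' : ℂ) (f : Term a b) :
      Rel S (smul (r + r') f) (add (smul r f) (smul r' f))
  | smul_add {a b} (r : ℂ) (f g : Term a b) :
      Rel S (smul r (add f g)) (add (smul r f) (smul r g))
  | add_comp {a b c} (f f' : Term a b) (g : Term b c) :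
      Rel S (comp (add f f') g) (add (comp f g) (comp f' g))
  | comp_add {a b c} (f : Term a b) (g g' : Term b c) :
      Rel S (comp f (add g g')) (add (comp f g) (comp f g'))
  | smul_comp {a b c} (r : ℂ) (f : Term a b) (g : Term b c) :
      Rel S (comp (smul r f) g) (smul r (comp f g))
  | comp_smul {a b c} (r : ℂ) (f : Term a b) (g : Term b c) :
      Rel S (comp f (smul r g)) (smul r (comp f g))
  | add_tensor {a b a' b'} (f f' : Term a b) (g : Term a' b') :
      Rel S (par (add f f') g) (add (par f g) (par f' g))
  | tensor_add {a b a' b'} (f : Term a b) (g g' : Term a' b') :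
      Rel S (par f (add g g')) (add (par f g) (par f g'))
  | smul_tensor {a b a' b'} (r : ℂ) (f : Term a b) (g : Term a' b') :
      Rel S (par (smul r f) g) (smul r (par f g))
  | tensor_smul {a b a' b'} (r : ℂ) (f : Term a b) (g : Term a' b') :
      Rel S (par f (smul r g)) (smul r (par f g))
  -- monoidal category
  | tensor_id (a b : Word) : Rel S (par (ident a) (ident b)) (ident (a.tensor b))
  | tensor_comp {a b c a' b' c'} (f : Term a b) (g : Term b c) (f' : Term a' b')
      (g' : Term b' c') :
      Rel S (comp (par f f') (par g g')) (par (comp f g) (comp f' g'))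
  | assoc_naturality {a b a' b' a'' b''} (f : Term a b) (f' : Term a' b') (f'' : Term a'' b'') :
      Rel S (comp (par (par f f') f'') (assoc b b' b''))
        (comp (assoc a a' a'') (par f (par f' f'')))
  | leftUnit_naturality {a b} (f : Term a b) :
      Rel S (comp (par (ident Word.unit) f) (leftUnit b)) (comp (leftUnit a) f)
  | rightUnit_naturality {a b} (f : Term a b) :
      Rel S (comp (par f (ident Word.unit)) (rightUnit b)) (comp (rightUnit a) f)
  | assoc_hom_inv (a b c : Word) : Rel S (comp (assoc a b c) (assocInv a b c)) (ident _)
  | assoc_inv_hom (a b c : Word) : Rel S (comp (assocInv a b c) (assoc a b c)) (ident _)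
  | leftUnit_hom_inv (a : Word) : Rel S (comp (leftUnit a) (leftUnitInv a)) (ident _)
  | leftUnit_inv_hom (a : Word) : Rel S (comp (leftUnitInv a) (leftUnit a)) (ident _)
  | rightUnit_hom_inv (a : Word) : Rel S (comp (rightUnit a) (rightUnitInv a)) (ident _)
  | rightUnit_inv_hom (a : Word) : Rel S (comp (rightUnitInv a) (rightUnit a)) (ident _)
  | pentagon (a b c d : Word) :
      Rel S (comp (par (assoc a b c) (ident d))
          (comp (assoc a (b.tensor c) d) (par (ident a) (assoc b c d))))
        (comp (assoc (a.tensor b) c d) (assoc a b (c.tensor d)))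
  | triangle (a b : Word) :
      Rel S (comp (assoc a Word.unit b) (par (ident a) (leftUnit b)))
        (par (rightUnit a) (ident b))
  -- symmetry
  | cross_naturality {a b a' b'} (f : Term a b) (g : Term a' b') :
      Rel S (comp (par f g) (cross b b')) (comp (cross a a') (par g f))
  | cross_cross (a b : Word) : Rel S (comp (cross a b) (cross b a)) (ident _)
  | hexagon (a b c : Word) :
      Rel S (comp (assoc a b c) (comp (cross a (b.tensor c)) (assoc b c a)))
        (comp (par (cross a b) (ident c)) (comp (assoc b a c) (par (ident b) (cross a c))))
  -- symmetric self-duality of the strand and rotational invariance of the vertex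
  | zigzag_left : Rel S (comp (par cup (ident _)) (comp (assoc _ _ _) (par (ident _) cap)))
        (comp (leftUnit Word.strand) (rightUnitInv _))
  | zigzag_right : Rel S (comp (par (ident _) cup) (comp (assocInv _ _ _) (par cap (ident _))))
        (comp (rightUnit Word.strand) (leftUnitInv _))
  | cap_symm : Rel S (comp (cross _ _) cap) cap
  | rotation : Rel S (comp (par vertex (ident _)) cap)
        (comp (assoc _ _ _) (comp (par (ident _) vertex) cap))
  -- the skein relations
  | circle : Rel S (comp cup cap) (smul S.circle (ident _))
  | twisted_vertex : Rel S (comp (cross _ _) vertex) (smul S.vertexSign vertex)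
  | lollipop : Rel S (comp cup vertex) (zero _ _)
  | bigon : Rel S (comp split vertex) (smul S.bigon (ident _))
  | trigon : Rel S (comp treeH vertex) (smul S.triangle vertex)
  | fourLegs (f : Term two two) : f ∈ S.relations → Rel S f (zero _ _)

/-- The morphisms `a ⟶ b` of the category presented by `S`: diagrams modulo relations. -/
def DiagramHom (S : SkeinTheory) (a b : Word) : Type := Quot (@Rel S a b)

/-- The symmetric ribbon category presented by the skein theory `S`. Its objects are the tensor
words in the strand (i.e. finite numbers of points, up to the bracketing), the duality is given
by cups and caps, and the twist is trivial. -/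
structure DiagramCategory (S : SkeinTheory) : Type where
  word : Word

namespace DiagramCategory

variable {S : SkeinTheory}

theorem sound {a b : Word} {f g : Term a b} (h : Rel S f g) :
    (Quot.mk _ f : DiagramHom S a b) = Quot.mk _ g := Quot.sound h

instance : Category.{0} (DiagramCategory S) where
  Hom A B := DiagramHom S A.word B.word
  id A := Quot.mk _ (Term.ident A.word)
  comp f g := Quot.map₂ Term.comp (fun f _ _ h => .comp_congr (.refl f) h)
    (fun _ _ g h => .comp_congr h (.refl g)) f g
  id_comp f := by induction f using Quot.ind; exact sound (.id_comp _)
  comp_id f := by induction f using Quot.ind; exact sound (.comp_id _)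
  assoc f g h := by
    induction f using Quot.ind; induction g using Quot.ind; induction h using Quot.ind
    exact sound (.comp_assoc _ _ _)

/-- The morphism represented by a diagram. -/
def ofTerm (S : SkeinTheory) {a b : Word} (f : Term a b) :
    (⟨a⟩ : DiagramCategory S) ⟶ ⟨b⟩ := (Quot.mk _ f : DiagramHom S a b)

/-- The generating object. -/
def strand (S : SkeinTheory) : DiagramCategory S := ⟨Word.strand⟩

instance (A B : DiagramCategory S) : Add (A ⟶ B) where
  add f g := Quot.map₂ Term.add (fun f _ _ h => .add_congr (.refl f) h)
    (fun _ _ g h => .add_congr h (.refl g)) f g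

instance (A B : DiagramCategory S) : Zero (A ⟶ B) where
  zero := Quot.mk _ (Term.zero A.word B.word)

instance (A B : DiagramCategory S) : SMul ℂ (A ⟶ B) where
  smul r f := Quot.map (Term.smul r) (fun _ _ h => .smul_congr r h) f

theorem hom_add_comm {A B : DiagramCategory S} (f g : A ⟶ B) : f + g = g + f := by
  induction f using Quot.ind; induction g using Quot.ind; exact sound (.add_comm _ _)

theorem hom_add_assoc {A B : DiagramCategory S} (f g h : A ⟶ B) :
    f + g + h = f + (g + h) := by
  induction f using Quot.ind; induction g using Quot.ind; induction h using Quot.ind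
  exact sound (.add_assoc _ _ _)

theorem hom_zero_add {A B : DiagramCategory S} (f : A ⟶ B) : 0 + f = f := by
  induction f using Quot.ind; exact sound (.zero_add _)

theorem hom_one_smul {A B : DiagramCategory S} (f : A ⟶ B) : (1 : ℂ) • f = f := by
  induction f using Quot.ind; exact sound (.one_smul _)

theorem hom_zero_smul {A B : DiagramCategory S} (f : A ⟶ B) : (0 : ℂ) • f = 0 := by
  induction f using Quot.ind; exact sound (.zero_smul _)

theorem hom_mul_smul {A B : DiagramCategory S} (r r' : ℂ) (f : A ⟶ B) :
    (r * r') • f = r • r' • f := by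
  induction f using Quot.ind; exact sound (.mul_smul _ _ _)

theorem hom_add_smul {A B : DiagramCategory S} (r r' : ℂ) (f : A ⟶ B) :
    (r + r') • f = r • f + r' • f := by
  induction f using Quot.ind; exact sound (.add_smul _ _ _)

theorem hom_smul_add {A B : DiagramCategory S} (r : ℂ) (f g : A ⟶ B) :
    r • (f + g) = r • f + r • g := by
  induction f using Quot.ind; induction g using Quot.ind; exact sound (.smul_add _ _ _)

theorem hom_neg_add {A B : DiagramCategory S} (f : A ⟶ B) : (-1 : ℂ) • f + f = 0 := by
  rw [← hom_zero_smul f, ← neg_add_cancel (1 : ℂ), hom_add_smul, hom_one_smul]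

instance (A B : DiagramCategory S) : Neg (A ⟶ B) where
  neg f := (-1 : ℂ) • f

instance (A B : DiagramCategory S) : AddCommGroup (A ⟶ B) where
  add_assoc := hom_add_assoc
  zero_add := hom_zero_add
  add_zero f := by rw [hom_add_comm, hom_zero_add]
  nsmul := nsmulRec
  zsmul := zsmulRec
  neg_add_cancel := hom_neg_add
  add_comm := hom_add_comm

instance : Preadditive (DiagramCategory S) where
  add_comp _ _ _ f f' g := by
    induction f using Quot.ind; induction f' using Quot.ind; induction g using Quot.ind
    exact sound (.add_comp _ _ _)
  comp_add _ _ _ f g g' := by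
    induction f using Quot.ind; induction g using Quot.ind; induction g' using Quot.ind
    exact sound (.comp_add _ _ _)

instance (A B : DiagramCategory S) : Module ℂ (A ⟶ B) where
  one_smul := hom_one_smul
  mul_smul := hom_mul_smul
  smul_zero r := by rw [← hom_zero_smul (0 : A ⟶ B), ← hom_mul_smul, mul_zero]
  smul_add := hom_smul_add
  add_smul := hom_add_smul
  zero_smul := hom_zero_smul

instance : Linear ℂ (DiagramCategory S) where
  smul_comp _ _ _ r f g := by
    induction f using Quot.ind; induction g using Quot.ind; exact sound (.smul_comp _ _ _)
  comp_smul _ _ _ f r g := by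
    induction f using Quot.ind; induction g using Quot.ind; exact sound (.comp_smul _ _ _)

instance : MonoidalCategoryStruct (DiagramCategory S) where
  tensorObj A B := ⟨A.word.tensor B.word⟩
  tensorUnit := ⟨Word.unit⟩
  tensorHom f g := Quot.map₂ Term.par (fun f _ _ h => .tensor_congr (.refl f) h)
    (fun _ _ g h => .tensor_congr h (.refl g)) f g
  whiskerLeft A _ _ g := Quot.map (Term.par (Term.ident A.word))
    (fun _ _ h => .tensor_congr (.refl _) h) g
  whiskerRight f B := Quot.map (fun f => Term.par f (Term.ident B.word))
    (fun _ _ h => .tensor_congr h (.refl _)) f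
  associator A B D :=
    { hom := ofTerm S (Term.assoc A.word B.word D.word)
      inv := ofTerm S (Term.assocInv A.word B.word D.word)
      hom_inv_id := sound (.assoc_hom_inv _ _ _)
      inv_hom_id := sound (.assoc_inv_hom _ _ _) }
  leftUnitor A :=
    { hom := ofTerm S (Term.leftUnit A.word)
      inv := ofTerm S (Term.leftUnitInv A.word)
      hom_inv_id := sound (.leftUnit_hom_inv _)
      inv_hom_id := sound (.leftUnit_inv_hom _) }
  rightUnitor A :=
    { hom := ofTerm S (Term.rightUnit A.word)
      inv := ofTerm S (Term.rightUnitInv A.word)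
      hom_inv_id := sound (.rightUnit_hom_inv _)
      inv_hom_id := sound (.rightUnit_inv_hom _) }

instance : MonoidalCategory (DiagramCategory S) := .ofTensorHom
  (id_tensorHom_id := fun _ _ => sound (.tensor_id _ _))
  (id_tensorHom := fun _ _ _ g => by induction g using Quot.ind; rfl)
  (tensorHom_id := fun f _ => by induction f using Quot.ind; rfl)
  (tensorHom_comp_tensorHom := fun f f' g g' => by
    induction f using Quot.ind; induction f' using Quot.ind
    induction g using Quot.ind; induction g' using Quot.ind
    exact sound (.tensor_comp _ _ _ _))
  (associator_naturality := fun f f' f'' => by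
    induction f using Quot.ind; induction f' using Quot.ind; induction f'' using Quot.ind
    exact sound (.assoc_naturality _ _ _))
  (leftUnitor_naturality := fun f => by
    induction f using Quot.ind; exact sound (.leftUnit_naturality _))
  (rightUnitor_naturality := fun f => by
    induction f using Quot.ind; exact sound (.rightUnit_naturality _))
  (pentagon := fun _ _ _ _ => sound (.pentagon _ _ _ _))
  (triangle := fun _ _ => sound (.triangle _ _))

instance : MonoidalPreadditive (DiagramCategory S) where
  whiskerLeft_zero {A B D} := by
    have h : A ◁ ((0 : ℂ) • (0 : B ⟶ D)) = (0 : ℂ) • (A ◁ (0 : B ⟶ D)) :=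
      sound (.tensor_smul _ _ _)
    simpa using h
  zero_whiskerRight {A B D} := by
    have h : ((0 : ℂ) • (0 : B ⟶ D)) ▷ A = (0 : ℂ) • ((0 : B ⟶ D) ▷ A) :=
      sound (.smul_tensor _ _ _)
    simpa using h
  whiskerLeft_add f g := by
    induction f using Quot.ind; induction g using Quot.ind; exact sound (.tensor_add _ _ _)
  add_whiskerRight f g := by
    induction f using Quot.ind; induction g using Quot.ind; exact sound (.add_tensor _ _ _)

instance : MonoidalLinear ℂ (DiagramCategory S) where
  whiskerLeft_smul _ _ _ r f := by
    induction f using Quot.ind; exact sound (.tensor_smul _ _ _)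
  smul_whiskerRight r _ _ f _ := by
    induction f using Quot.ind; exact sound (.smul_tensor _ _ _)

/-- The symmetric crossing as an isomorphism. -/
def crossIso (A B : DiagramCategory S) : A ⊗ B ≅ B ⊗ A where
  hom := ofTerm S (Term.cross A.word B.word)
  inv := ofTerm S (Term.cross B.word A.word)
  hom_inv_id := sound (.cross_cross _ _)
  inv_hom_id := sound (.cross_cross _ _)

theorem hexagon (A B D : DiagramCategory S) :
    (α_ A B D).hom ≫ (crossIso A (B ⊗ D)).hom ≫ (α_ B D A).hom =
      (crossIso A B).hom ▷ D ≫ (α_ B A D).hom ≫ B ◁ (crossIso A D).hom :=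
  sound (.hexagon _ _ _)

instance : SymmetricCategory (DiagramCategory S) where
  braiding := crossIso
  braiding_naturality_right A _ _ f := by
    induction f using Quot.ind; exact sound (.cross_naturality _ _)
  braiding_naturality_left f A := by
    induction f using Quot.ind; exact sound (.cross_naturality _ _)
  hexagon_forward := hexagon
  hexagon_reverse A B D := by
    have h : α_ D A B ≪≫ crossIso D (A ⊗ B) ≪≫ α_ A B D =
        whiskerRightIso (crossIso D A) B ≪≫ α_ A D B ≪≫ whiskerLeftIso A (crossIso D B) :=
      Iso.ext (hexagon D A B)
    have h' := congrArg Iso.inv h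
    simp only [Iso.trans_inv, whiskerRightIso_inv, whiskerLeftIso_inv, Category.assoc] at h'
    exact h'
  symmetry A B := (crossIso A B).hom_inv_id

end DiagramCategory

end Trivalent

/-! ### The additive completion as a symmetric monoidal category -/

namespace AdditiveCompletion

variable {C : Type u} [Category.{v} C] [Preadditive C]

/-- The matrix `f` is supported on the graph of the bijection `e` of index sets, with entries
`φ`. -/
structure IsReindexing {M N : Mat_ C} (f : M ⟶ N) (e : M.ι ≃ N.ι)
    (φ : ∀ i, M.X i ⟶ N.X (e i)) : Prop where
  self : ∀ i, f i (e i) = φ i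
  of_ne : ∀ i j, e i ≠ j → f i j = 0

theorem IsReindexing.comp_apply {M N K : Mat_ C} {f : M ⟶ N} {e : M.ι ≃ N.ι}
    {φ : ∀ i, M.X i ⟶ N.X (e i)} (hf : IsReindexing f e φ) (g : N ⟶ K) (i : M.ι) (k : K.ι) :
    (f ≫ g) i k = φ i ≫ g (e i) k := by
  rw [Mat_.comp_apply, Finset.sum_eq_single (e i), hf.self]
  · intro j _ hj
    rw [hf.of_ne _ _ hj.symm, Limits.zero_comp]
  · simp

theorem IsReindexing.apply_comp {K M N : Mat_ C} {f : M ⟶ N} {e : M.ι ≃ N.ι}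
    {φ : ∀ i, M.X i ⟶ N.X (e i)} (hf : IsReindexing f e φ) (g : K ⟶ M) (k : K.ι) (i : M.ι) :
    (g ≫ f) k (e i) = g k i ≫ φ i := by
  rw [Mat_.comp_apply, Finset.sum_eq_single i, hf.self]
  · intro j _ hj
    rw [hf.of_ne _ _ (fun h => hj (e.injective h)), Limits.comp_zero]
  · simp

theorem IsReindexing.comp {M N K : Mat_ C} {f : M ⟶ N} {e : M.ι ≃ N.ι}
    {φ : ∀ i, M.X i ⟶ N.X (e i)} {g : N ⟶ K} {e' : N.ι ≃ K.ι} {φ' : ∀ i, N.X i ⟶ K.X (e' i)}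
    (hf : IsReindexing f e φ) (hg : IsReindexing g e' φ') :
    IsReindexing (f ≫ g) (e.trans e') (fun i => φ i ≫ φ' (e i)) where
  self i := (hf.comp_apply g i _).trans (congrArg (φ i ≫ ·) (hg.self (e i)))
  of_ne i k h := by rw [hf.comp_apply, hg.of_ne _ _ h, Limits.comp_zero]

theorem IsReindexing.unique {M N : Mat_ C} {f g : M ⟶ N} {e : M.ι ≃ N.ι}
    {φ φ' : ∀ i, M.X i ⟶ N.X (e i)} (hf : IsReindexing f e φ) (hg : IsReindexing g e φ')
    (h : ∀ i, φ i = φ' i) : f = g := by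
  ext i j
  by_cases hij : e i = j
  · subst hij; rw [hf.self, hg.self, h]
  · rw [hf.of_ne i j hij, hg.of_ne i j hij]

theorem IsReindexing.id (M : Mat_ C) : IsReindexing (𝟙 M) (Equiv.refl M.ι) (fun i => 𝟙 (M.X i)) :=
  ⟨fun i => Mat_.id_apply_self M i, fun i j h => Mat_.id_apply_of_ne M i j h⟩

open scoped Classical in
/-- The matrix supported on the graph of `e` with entries `φ`. -/
noncomputable def reindexHom {M N : Mat_ C} (e : M.ι ≃ N.ι) (φ : ∀ i, M.X i ⟶ N.X (e i)) :
    M ⟶ N :=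
  fun i j => if h : e i = j then φ i ≫ eqToHom (congrArg N.X h) else 0

theorem reindexHom_isReindexing {M N : Mat_ C} (e : M.ι ≃ N.ι) (φ : ∀ i, M.X i ⟶ N.X (e i)) :
    IsReindexing (reindexHom e φ) e φ :=
  ⟨fun i => by simp [reindexHom], fun i j h => by simp [reindexHom, h]⟩

/-- The isomorphism of `Mat_ C` given by a bijection of the index sets and isomorphisms of the
corresponding entries. -/
noncomputable def reindex {M N : Mat_ C} (e : M.ι ≃ N.ι) (φ : ∀ i, M.X i ≅ N.X (e i)) :
    M ≅ N where
  hom := reindexHom e (fun i => (φ i).hom)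
  inv := reindexHom e.symm (fun j =>
    eqToHom (congrArg N.X (e.apply_symm_apply j).symm) ≫ (φ (e.symm j)).inv)
  hom_inv_id := by
    ext i i'
    rw [(reindexHom_isReindexing e _).comp_apply]
    by_cases h : i = i'
    · subst h
      simp only [reindexHom, Equiv.symm_apply_apply, dite_true, Mat_.id_apply_self]
      have : ∀ j (hj : j = i) (hj' : N.X (e i) = N.X (e j)) (hj'' : M.X j = M.X i),
          (φ i).hom ≫ (eqToHom hj' ≫ (φ j).inv) ≫ eqToHom hj'' = 𝟙 (M.X i) := by
        rintro j rfl _ _; simp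
      exact this _ (e.symm_apply_apply i) _ _
    · rw [(reindexHom_isReindexing e.symm _).of_ne _ _ (by simpa using h),
        Mat_.id_apply_of_ne _ _ _ h, Limits.comp_zero]
  inv_hom_id := by
    ext j j'
    rw [(reindexHom_isReindexing e.symm _).comp_apply]
    by_cases h : j = j'
    · subst h
      simp only [reindexHom, Equiv.apply_symm_apply, dite_true, Mat_.id_apply_self]
      simp
    · rw [(reindexHom_isReindexing e _).of_ne _ _ (by simpa using h),
        Mat_.id_apply_of_ne _ _ _ h, Limits.comp_zero]

theorem reindex_isReindexing {M N : Mat_ C} (e : M.ι ≃ N.ι) (φ : ∀ i, M.X i ≅ N.X (e i)) :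
    IsReindexing (reindex e φ).hom e (fun i => (φ i).hom) := reindexHom_isReindexing e _

section Linear

variable [Linear ℂ C]

noncomputable instance (M N : Mat_ C) : Module ℂ (M ⟶ N) :=
  inferInstanceAs <| Module ℂ (∀ (i : M.ι) (j : N.ι), M.X i ⟶ N.X j)

theorem smul_apply {M N : Mat_ C} (r : ℂ) (f : M ⟶ N) (i : M.ι) (j : N.ι) :
    (r • f) i j = r • f i j := rfl

noncomputable instance : Linear ℂ (Mat_ C) where
  smul_comp _ _ _ r f g := by
    ext i k
    simp [smul_apply, Finset.smul_sum]
  comp_smul _ _ _ f r g := by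
    ext i k
    simp [smul_apply, Finset.smul_sum]

end Linear

variable [MonoidalCategory C]

noncomputable instance : MonoidalCategoryStruct (Mat_ C) where
  tensorObj M N := ⟨M.ι × N.ι, fun p => M.X p.1 ⊗ N.X p.2⟩
  tensorUnit := ⟨PUnit, fun _ => 𝟙_ C⟩
  tensorHom f g := fun p q => f p.1 q.1 ⊗ₘ g p.2 q.2
  whiskerLeft M _ _ g := fun p q => (𝟙 M : M ⟶ M) p.1 q.1 ⊗ₘ g p.2 q.2
  whiskerRight f N := fun p q => f p.1 q.1 ⊗ₘ (𝟙 N : N ⟶ N) p.2 q.2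
  associator M N K := reindex (Equiv.prodAssoc M.ι N.ι K.ι)
    (fun p => α_ (M.X p.1.1) (N.X p.1.2) (K.X p.2))
  leftUnitor M := reindex (Equiv.punitProd M.ι) (fun p => λ_ (M.X p.2))
  rightUnitor M := reindex (Equiv.prodPUnit M.ι) (fun p => ρ_ (M.X p.1))

theorem tensorHom_apply {M N M' N' : Mat_ C} (f : M ⟶ N) (g : M' ⟶ N') (p : (M ⊗ M').ι)
    (q : (N ⊗ N').ι) : (f ⊗ₘ g) p q = f p.1 q.1 ⊗ₘ g p.2 q.2 := rfl

theorem associator_isReindexing (M N K : Mat_ C) :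
    IsReindexing (α_ M N K).hom (Equiv.prodAssoc M.ι N.ι K.ι)
      (fun p => (α_ (M.X p.1.1) (N.X p.1.2) (K.X p.2)).hom) := reindex_isReindexing _ _

theorem leftUnitor_isReindexing (M : Mat_ C) :
    IsReindexing (λ_ M).hom (Equiv.punitProd M.ι) (fun p => (λ_ (M.X p.2)).hom) :=
  reindex_isReindexing _ _

theorem rightUnitor_isReindexing (M : Mat_ C) :
    IsReindexing (ρ_ M).hom (Equiv.prodPUnit M.ι) (fun p => (ρ_ (M.X p.1)).hom) :=
  reindex_isReindexing _ _

section coherence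

variable {D : Type u} [Category.{v} D] [MonoidalCategory D]

theorem leftUnitor_tensorHom {A B : D} (f : A ⟶ B) :
    (𝟙 (𝟙_ D) ⊗ₘ f) ≫ (λ_ B).hom = (λ_ A).hom ≫ f := by simp

theorem rightUnitor_tensorHom {A B : D} (f : A ⟶ B) :
    (f ⊗ₘ 𝟙 (𝟙_ D)) ≫ (ρ_ B).hom = (ρ_ A).hom ≫ f := by simp

theorem pentagon_tensorHom (A B E F : D) :
    ((α_ A B E).hom ⊗ₘ 𝟙 F) ≫ (α_ A (B ⊗ E) F).hom ≫ (𝟙 A ⊗ₘ (α_ B E F).hom) =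
      (α_ (A ⊗ B) E F).hom ≫ (α_ A B (E ⊗ F)).hom := by simp

theorem triangle_tensorHom (A B : D) :
    (α_ A (𝟙_ D) B).hom ≫ (𝟙 A ⊗ₘ (λ_ B).hom) = (ρ_ A).hom ⊗ₘ 𝟙 B := by simp

theorem hexagon_tensorHom [BraidedCategory D] (A B E : D) :
    (α_ A B E).hom ≫ (β_ A (B ⊗ E)).hom ≫ (α_ B E A).hom =
      ((β_ A B).hom ⊗ₘ 𝟙 E) ≫ (α_ B A E).hom ≫ (𝟙 B ⊗ₘ (β_ A E).hom) := by simp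

end coherence

variable [MonoidalPreadditive C]

theorem IsReindexing.tensor {M N M' N' : Mat_ C} {f : M ⟶ N} {e : M.ι ≃ N.ι}
    {φ : ∀ i, M.X i ⟶ N.X (e i)} {g : M' ⟶ N'} {e' : M'.ι ≃ N'.ι}
    {φ' : ∀ i, M'.X i ⟶ N'.X (e' i)} (hf : IsReindexing f e φ) (hg : IsReindexing g e' φ') :
    IsReindexing (M := M ⊗ M') (N := N ⊗ N') (f ⊗ₘ g) (e.prodCongr e')
      (fun p => φ p.1 ⊗ₘ φ' p.2) where
  self p := congrArg₂ (· ⊗ₘ ·) (hf.self p.1) (hg.self p.2)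
  of_ne p q h := by
    rw [tensorHom_apply]
    by_cases h₁ : e p.1 = q.1
    · have h₂ : e' p.2 ≠ q.2 := fun h₂ => h (Prod.ext h₁ h₂)
      rw [hg.of_ne _ _ h₂, MonoidalPreadditive.tensor_zero]
    · rw [hf.of_ne _ _ h₁, MonoidalPreadditive.zero_tensor]

theorem id_tensor_id (M N : Mat_ C) : 𝟙 M ⊗ₘ 𝟙 N = 𝟙 (M ⊗ N) := by
  ext p q
  rw [tensorHom_apply]
  by_cases h : p = q
  · subst h
    rw [Mat_.id_apply_self, Mat_.id_apply_self, Mat_.id_apply_self]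
    exact id_tensorHom_id _ _
  · rw [Mat_.id_apply_of_ne _ _ _ h]
    by_cases h₁ : p.1 = q.1
    · have h₂ : p.2 ≠ q.2 := fun h₂ => h (Prod.ext h₁ h₂)
      rw [Mat_.id_apply_of_ne _ _ _ h₂, MonoidalPreadditive.tensor_zero]
    · rw [Mat_.id_apply_of_ne _ _ _ h₁, MonoidalPreadditive.zero_tensor]

theorem tensor_comp_tensor {M N K M' N' K' : Mat_ C} (f : M ⟶ N) (f' : M' ⟶ N') (g : N ⟶ K)
    (g' : N' ⟶ K') : (f ⊗ₘ f') ≫ (g ⊗ₘ g') = (f ≫ g) ⊗ₘ (f' ≫ g') := by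
  ext p q
  rw [tensorHom_apply, Mat_.comp_apply, Mat_.comp_apply, Mat_.comp_apply, sum_tensor]
  simp_rw [tensor_sum]
  rw [← Finset.sum_product']
  exact Finset.sum_congr rfl fun r _ => tensorHom_comp_tensorHom _ _ _ _

noncomputable instance : MonoidalCategory (Mat_ C) := .ofTensorHom
  (id_tensorHom_id := id_tensor_id)
  (id_tensorHom := fun _ _ _ _ => rfl)
  (tensorHom_id := fun _ _ => rfl)
  (tensorHom_comp_tensorHom := tensor_comp_tensor)
  (associator_naturality := fun {M₁ M₂ M₃ N₁ N₂ N₃} f₁ f₂ f₃ => by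
    ext p ⟨j₁, j₂, j₃⟩
    refine ((associator_isReindexing N₁ N₂ N₃).apply_comp _ p ((j₁, j₂), j₃)).trans ?_
    refine Eq.trans ?_ ((associator_isReindexing M₁ M₂ M₃).comp_apply _ p _).symm
    exact associator_naturality _ _ _)
  (leftUnitor_naturality := fun {M N} f => by
    ext p j
    refine ((leftUnitor_isReindexing N).apply_comp _ p (PUnit.unit, j)).trans ?_
    refine Eq.trans ?_ ((leftUnitor_isReindexing M).comp_apply _ p _).symm
    rw [tensorHom_apply]
    have h : (𝟙 (𝟙_ (Mat_ C)) : 𝟙_ (Mat_ C) ⟶ 𝟙_ (Mat_ C)) p.1 PUnit.unit = 𝟙 (𝟙_ C) :=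
      Mat_.id_apply_self _ _
    rw [h]
    exact leftUnitor_tensorHom _)
  (rightUnitor_naturality := fun {M N} f => by
    ext p j
    refine ((rightUnitor_isReindexing N).apply_comp _ p (j, PUnit.unit)).trans ?_
    refine Eq.trans ?_ ((rightUnitor_isReindexing M).comp_apply _ p _).symm
    rw [tensorHom_apply]
    have h : (𝟙 (𝟙_ (Mat_ C)) : 𝟙_ (Mat_ C) ⟶ 𝟙_ (Mat_ C)) p.2 PUnit.unit = 𝟙 (𝟙_ C) :=
      Mat_.id_apply_self _ _
    rw [h]
    exact rightUnitor_tensorHom _)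
  (pentagon := fun M N K L => by
    refine IsReindexing.unique
      (((associator_isReindexing M N K).tensor (.id L)).comp
        ((associator_isReindexing M (N ⊗ K) L).comp
          ((IsReindexing.id M).tensor (associator_isReindexing N K L))))
      ((associator_isReindexing (M ⊗ N) K L).comp (associator_isReindexing M N (K ⊗ L)))
      (fun p => pentagon_tensorHom _ _ _ _))
  (triangle := fun M N => by
    refine IsReindexing.unique
      ((associator_isReindexing M _ N).comp
          ((IsReindexing.id M).tensor (leftUnitor_isReindexing N)))
      ((rightUnitor_isReindexing M).tensor (.id N)) (fun p => triangle_tensorHom _ _))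

/-- The braiding of `Mat_ C`. -/
noncomputable def braidingIso [BraidedCategory C] (M N : Mat_ C) : M ⊗ N ≅ N ⊗ M :=
  reindex (M := M ⊗ N) (N := N ⊗ M) (Equiv.prodComm M.ι N.ι)
    (fun p => β_ (M.X p.1) (N.X p.2))

theorem braiding_isReindexing [BraidedCategory C] (M N : Mat_ C) :
    IsReindexing (braidingIso M N).hom (Equiv.prodComm M.ι N.ι)
      (fun p => (β_ (M.X p.1) (N.X p.2)).hom) := reindex_isReindexing _ _

theorem braiding_naturality [BraidedCategory C] {M N M' N' : Mat_ C} (f : M ⟶ N) (g : M' ⟶ N') :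
    (f ⊗ₘ g) ≫ (braidingIso N N').hom = (braidingIso M M').hom ≫ (g ⊗ₘ f) := by
  ext p ⟨j, i⟩
  refine ((braiding_isReindexing N N').apply_comp _ p (i, j)).trans ?_
  refine Eq.trans ?_ ((braiding_isReindexing M M').comp_apply _ p _).symm
  exact BraidedCategory.braiding_naturality _ _

theorem braiding_hexagon [BraidedCategory C] (M N K : Mat_ C) :
    (α_ M N K).hom ≫ (braidingIso M (N ⊗ K)).hom ≫ (α_ N K M).hom =
      ((braidingIso M N).hom ⊗ₘ 𝟙 K) ≫ (α_ N M K).hom ≫ (𝟙 N ⊗ₘ (braidingIso M K).hom) := by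
  refine IsReindexing.unique
    ((associator_isReindexing M N K).comp ((braiding_isReindexing M (N ⊗ K)).comp
      (associator_isReindexing N K M)))
    (((braiding_isReindexing M N).tensor (.id K)).comp ((associator_isReindexing N M K).comp
      ((IsReindexing.id N).tensor (braiding_isReindexing M K)))) (fun p => hexagon_tensorHom _ _ _)

theorem braiding_symmetry [SymmetricCategory C] (M N : Mat_ C) :
    (braidingIso M N).hom ≫ (braidingIso N M).hom = 𝟙 (M ⊗ N) :=
  IsReindexing.unique ((braiding_isReindexing M N).comp (braiding_isReindexing N M)) (.id _)
    (fun _ => SymmetricCategory.symmetry _ _)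

noncomputable instance [SymmetricCategory C] : SymmetricCategory (Mat_ C) where
  braiding := braidingIso
  braiding_naturality_right M _ _ g := braiding_naturality (𝟙 M) g
  braiding_naturality_left f M := braiding_naturality f (𝟙 M)
  hexagon_forward := braiding_hexagon
  hexagon_reverse M N K := by
    have e : ∀ M N : Mat_ C, (braidingIso M N).inv = (braidingIso N M).hom := fun M N => by
      rw [← cancel_epi (braidingIso M N).hom, Iso.hom_inv_id, braiding_symmetry]
    have h : α_ K M N ≪≫ braidingIso K (M ⊗ N) ≪≫ α_ M N K =
        whiskerRightIso (braidingIso K M) N ≪≫ α_ M K N ≪≫ whiskerLeftIso M (braidingIso K N) :=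
      Iso.ext (braiding_hexagon K M N)
    have h' := congrArg Iso.inv h
    simp only [Iso.trans_inv, whiskerRightIso_inv, whiskerLeftIso_inv, Category.assoc, e] at h'
    exact h'
  symmetry := braiding_symmetry

end AdditiveCompletion

/-! ### Algebra objects in symmetric monoidal categories

Identities between elements are read as identities between morphisms, each variable being one
tensor factor. -/

section algebras

variable {D : Type u} [Category.{v} D] [MonoidalCategory D]

/-- A unital, not necessarily associative, algebra object. -/
structure UnitalAlgebra (A : D) where
  mul : A ⊗ A ⟶ A
  one : 𝟙_ D ⟶ A
  one_mul : one ▷ A ≫ mul = (λ_ A).hom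
  mul_one : A ◁ one ≫ mul = (ρ_ A).hom

namespace UnitalAlgebra

variable {A : D} (U : UnitalAlgebra A)

/-- The trace `x ↦ ⟨x, 1⟩` determined by a pairing. -/
def trace (form : SelfDuality A) : A ⟶ 𝟙_ D := (ρ_ A).inv ≫ A ◁ U.one ≫ form.cap

/-- `xy = yx`. -/
def IsCommutative [BraidedCategory D] : Prop := (β_ A A).hom ≫ U.mul = U.mul

/-- `(xy)z = x(yz)`. -/
def IsAssociative : Prop :=
  U.mul ▷ A ≫ U.mul = (α_ A A A).hom ≫ A ◁ U.mul ≫ U.mul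

end UnitalAlgebra

/-- A commutative Frobenius algebra object: a unital commutative associative algebra object with
a trace such that `⟨x, y⟩ = tr (xy)` is the pairing of a symmetric self-duality. -/
structure FrobeniusAlgebra [BraidedCategory D] (A : D) extends UnitalAlgebra A where
  commutative : toUnitalAlgebra.IsCommutative
  associative : toUnitalAlgebra.IsAssociative
  tr : A ⟶ 𝟙_ D
  form : SelfDuality A
  form_symm : form.IsSymmetric
  cap_eq : form.cap = mul ≫ tr

/-- `tr 1 = 1`. -/
def FrobeniusAlgebra.IsNormalized [BraidedCategory D] {A : D} (F : FrobeniusAlgebra A) : Prop :=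
  F.one ≫ F.tr = 𝟙 (𝟙_ D)

/-- A Hurwitz algebra object: a unital algebra object with a symmetric self-duality such that
`⟨1, 1⟩ = 1` and `⟨ac, bd⟩ + ⟨ad, bc⟩ = 2 ⟨a, b⟩ ⟨c, d⟩` (as morphisms out of
`(a ⊗ b) ⊗ (c ⊗ d)`). -/
structure HurwitzAlgebra [SymmetricCategory D] [Preadditive D] [Linear ℂ D] (A : D)
    extends UnitalAlgebra A where
  form : SelfDuality A
  form_symm : form.IsSymmetric
  one_one : one ≫ toUnitalAlgebra.trace form = 𝟙 (𝟙_ D)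
  composition :
    tensorμ A A A A ≫ (mul ⊗ₘ mul) ≫ form.cap +
        (A ⊗ A) ◁ (β_ A A).hom ≫ tensorμ A A A A ≫ (mul ⊗ₘ mul) ≫ form.cap =
      (2 : ℂ) • ((form.cap ⊗ₘ form.cap) ≫ (λ_ (𝟙_ D)).hom)

/-- The sum over all permutations of three tensor factors. -/
def symmetrizer₃ [BraidedCategory D] [Preadditive D] (A : D) :
    (A ⊗ A) ⊗ A ⟶ (A ⊗ A) ⊗ A :=
  let σ : (A ⊗ A) ⊗ A ⟶ (A ⊗ A) ⊗ A := (β_ A A).hom ▷ A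
  let ρ : (A ⊗ A) ⊗ A ⟶ (A ⊗ A) ⊗ A := (α_ A A A).hom ≫ A ◁ (β_ A A).hom ≫ (α_ A A A).inv
  𝟙 _ + σ + ρ + σ ≫ ρ + ρ ≫ σ + σ ≫ ρ ≫ σ

/-- The rearrangement `((a ⊗ b) ⊗ c) ⊗ y ↦ (a ⊗ y) ⊗ (b ⊗ c)`. -/
def jordanShuffle [BraidedCategory D] (A : D) : ((A ⊗ A) ⊗ A) ⊗ A ⟶ (A ⊗ A) ⊗ (A ⊗ A) :=
  (α_ (A ⊗ A) A A).hom ≫ (A ⊗ A) ◁ (β_ A A).hom ≫ tensorμ A A A A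

/-- A tracial Jordan algebra object: a unital commutative algebra object with a symmetric
self-duality satisfying `⟨x, yz⟩ = ⟨xy, z⟩`, `⟨1, 1⟩ = 1`, and the polarization of the Jordan
identity `(xy)(xx) = x(y(xx))`, i.e. the equality of the sums of `(ay)(bc)` and of `a(y(bc))`
over all permutations of `a, b, c`. -/
structure TracialJordanAlgebra [SymmetricCategory D] [Preadditive D] (A : D)
    extends UnitalAlgebra A where
  commutative : toUnitalAlgebra.IsCommutative
  form : SelfDuality A
  form_symm : form.IsSymmetric
  form_assoc : mul ▷ A ≫ form.cap = (α_ A A A).hom ≫ A ◁ mul ≫ form.cap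
  one_one : one ≫ toUnitalAlgebra.trace form = 𝟙 (𝟙_ D)
  jordan :
    symmetrizer₃ A ▷ A ≫ jordanShuffle A ≫ (mul ⊗ₘ mul) ≫ mul =
      symmetrizer₃ A ▷ A ≫ jordanShuffle A ≫
        (α_ A A (A ⊗ A)).hom ≫ A ◁ (A ◁ mul ≫ mul) ≫ mul

/-- The cubic Cayley–Hamilton identity
`x³ - 3 tr(x) x² + (9/2 tr(x)² - 3/2 tr(x²)) x - (9/2 tr(x)³ - 9/2 tr(x) tr(x²) + tr(x³)) 1 = 0`,
polarized: each monomial is replaced by its sum over all permutations of `a, b, c`. -/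
def TracialJordanAlgebra.IsCubicCayleyHamilton [SymmetricCategory D] [Preadditive D] [Linear ℂ D]
    {A : D} (J : TracialJordanAlgebra A) : Prop :=
  let tr : A ⟶ 𝟙_ D := J.trace J.form
  -- `a(bc)`
  let cube : (A ⊗ A) ⊗ A ⟶ A := (α_ A A A).hom ≫ A ◁ J.mul ≫ J.mul
  -- `tr(a) bc`
  let t₁ : (A ⊗ A) ⊗ A ⟶ A := (α_ A A A).hom ≫ (tr ⊗ₘ J.mul) ≫ (λ_ A).hom
  -- `tr(a) tr(b) c`
  let t₂ : (A ⊗ A) ⊗ A ⟶ A := ((tr ⊗ₘ tr) ≫ (λ_ (𝟙_ D)).hom) ▷ A ≫ (λ_ A).hom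
  -- `tr(ab) c`
  let t₃ : (A ⊗ A) ⊗ A ⟶ A := (J.mul ≫ tr) ▷ A ≫ (λ_ A).hom
  symmetrizer₃ A ≫
    (cube - (3 : ℂ) • t₁ + (9 / 2 : ℂ) • t₂ - (3 / 2 : ℂ) • t₃
      - ((9 / 2 : ℂ) • (t₂ ≫ tr) - (9 / 2 : ℂ) • (t₁ ≫ tr) + cube ≫ tr) ≫ J.one) = 0

/-- `τ` is a Lie bracket: it is antisymmetric, and `[x, [y, z]] = [[x, y], z] + [y, [x, z]]`. -/
structure IsLieBracket [BraidedCategory D] [Preadditive D] {X : D} (τ : X ⊗ X ⟶ X) : Prop where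
  antisymm : (β_ X X).hom ≫ τ = -τ
  jacobi : (α_ X X X).hom ≫ X ◁ τ ≫ τ =
    τ ▷ X ≫ τ + (β_ X X).hom ▷ X ≫ (α_ X X X).hom ≫ X ◁ τ ≫ τ

end algebras

/-! ### The additive completion: algebra structures on `𝟙 ⊕ X` -/

section unitalization

variable {C : Type u} [Category.{v} C] [Preadditive C] [MonoidalCategory C]
  [MonoidalPreadditive C]

instance : Limits.HasBinaryBiproducts (Mat_ C) :=
  Limits.hasBinaryBiproducts_of_finite_biproducts _

/-- `X` as an object of the additive completion. -/
abbrev inMat (X : C) : Mat_ C := (Mat_.embedding C).obj X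

/-- The direct sum `𝟙 ⊕ X` in the additive completion. -/
noncomputable abbrev onePlus (X : C) : Mat_ C := 𝟙_ (Mat_ C) ⊞ inMat X

/-- A multiplication on `X`, in the additive completion. -/
def matMul {X : C} (τ : X ⊗ X ⟶ X) : inMat X ⊗ inMat X ⟶ inMat X := fun _ _ => τ

/-- A pairing on `X`, in the additive completion. -/
def matCap {X : C} (ε : X ⊗ X ⟶ 𝟙_ C) : inMat X ⊗ inMat X ⟶ 𝟙_ (Mat_ C) := fun _ _ => ε

/-- The unital algebra `𝟙 ⊕ X` with the given pairing has `X`, with its self-duality `s` and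
its multiplication `τ`, as its traceless part: the unit is the inclusion of `𝟙`, the trace
`x ↦ ⟨x, 1⟩` is the projection to `𝟙`, the multiplication of `X` followed by the projection to
`X` is `τ`, and the pairing restricts to that of `s`. -/
structure HasTracelessPart {X : C} (U : UnitalAlgebra (onePlus X))
    (form : SelfDuality (onePlus X)) (s : SelfDuality X) (τ : X ⊗ X ⟶ X) : Prop where
  one_eq : U.one = Limits.biprod.inl
  trace_eq : U.trace form = Limits.biprod.fst
  mul_eq : ((Limits.biprod.inr : inMat X ⟶ onePlus X) ⊗ₘ
    (Limits.biprod.inr : inMat X ⟶ onePlus X)) ≫ U.mul ≫ Limits.biprod.snd = matMul τ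
  cap_eq : ((Limits.biprod.inr : inMat X ⟶ onePlus X) ⊗ₘ
    (Limits.biprod.inr : inMat X ⟶ onePlus X)) ≫ form.cap = matCap s.cap

end unitalization

/-! ### The classical skein theories and their algebra objects -/

namespace Trivalent

open Term in
/-- `Sym(d + 1)`, with the relation `H - I + (two strands) - (cup-cap) = 0`. -/
noncomputable def symTheory (d : ℂ) : SkeinTheory where
  circle := d
  vertexSign := 1
  bigon := d - 1
  triangle := d - 2
  relations := {add (sub treeH treeI) (sub twoStrand cupCap)}

open Term in
/-- The classical `G2(d)`, with the relation `I + H = 2 (crossing) - (two strands) - (cup-cap)`. -/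
noncomputable def g2Theory (d : ℂ) : SkeinTheory where
  circle := d
  vertexSign := -1
  bigon := 1 - d
  triangle := d - 4
  relations := {sub (add treeI treeH) (sub (sub (smul 2 symCross) twoStrand) cupCap)}

open Term in
/-- The classical `F4(d)`, with the relation
`I + H + X = 1/2 ((cup-cap) + (two strands) + (crossing))`. -/
noncomputable def f4Theory (d : ℂ) : SkeinTheory where
  circle := d
  vertexSign := 1
  bigon := (d + 2) / 4
  triangle := (2 - d) / 8
  relations := {sub (add (add treeI treeH) treeX)
    (smul (1 / 2) (add (add cupCap twoStrand) symCross))}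

open Term in
/-- The classical exceptional series `Exc(d, b)` (for `d + 2 ≠ 0` and `b ≠ 0`), with the Jacobi
relation `I - H + X = 0` and the exceptional relation
`square = b/6 (I + H) + 5/6 · b²/(2 + d) ((cup-cap) + (two strands) + (crossing))`. -/
noncomputable def excTheory (d b : ℂ) : SkeinTheory where
  circle := d
  vertexSign := -1
  bigon := b
  triangle := b / 2
  relations := {add (sub treeI treeH) treeX,
    sub square (add (smul (b / 6) (add treeI treeH))
      (smul (5 / 6 * (b ^ 2 / (2 + d))) (add (add cupCap twoStrand) symCross)))}

section objects

variable {C : Type u} [Category.{v} C] [Preadditive C] [Linear ℂ C] [MonoidalCategory C]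
  [MonoidalPreadditive C] [MonoidalLinear ℂ C] [SymmetricCategory C] [RightRigidCategory C]
  [RibbonCategory C]

open Functor.LaxMonoidal in
/-- `X`, with the self-duality `s` and the multiplication `τ`, is an algebra object for the skein
theory `S`: there is a `ℂ`-linear symmetric monoidal functor from the category presented by `S`
that sends the strand to `X`, the cap to the pairing and the trivalent vertex to `τ`. (The twist
of the source is trivial, so that a functor compatible with twists needs that of `X` to be
trivial.) -/
def IsAlgebraObject (S : SkeinTheory) {X : C} (s : SelfDuality X) (τ : X ⊗ X ⟶ X) : Prop :=
  (RibbonCategory.twist X).hom = 𝟙 X ∧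
  ∃ (F : DiagramCategory S ⥤ C) (_ : F.Additive) (_ : F.Linear ℂ) (_ : F.Braided)
    (e : F.obj (DiagramCategory.strand S) ≅ X),
    μ F (DiagramCategory.strand S) (DiagramCategory.strand S) ≫
        F.map (DiagramCategory.ofTerm S Term.cap) =
      (e.hom ⊗ₘ e.hom) ≫ s.cap ≫ ε F ∧
    μ F (DiagramCategory.strand S) (DiagramCategory.strand S) ≫
        F.map (DiagramCategory.ofTerm S Term.vertex) ≫ e.hom =
      (e.hom ⊗ₘ e.hom) ≫ τ

/-- The value of the circle: the ribbon trace of the identity of `X`, computed by means of a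
self-duality `s` of `X`. -/
def circleValue {X : C} (s : SelfDuality X) : 𝟙_ C ⟶ 𝟙_ C :=
  s.cup ≫ (RibbonCategory.twist X).hom ▷ X ≫ (β_ X X).hom ≫ s.cap

/-- The bigon, as an endomorphism of `X`. -/
def bigonValue {X : C} (s : SelfDuality X) (τ : X ⊗ X ⟶ X) : X ⟶ X :=
  (λ_ X).inv ≫ s.cup ▷ X ≫ (α_ X X X).hom ≫ X ◁ τ ≫ τ

/-- `(C, X, τ)` is a trivalent ribbon category. The `n`-box space is `Hom(X^{⊗ n}, 𝟙)`: for
`n = 1` it is zero, and for `n = 0, 2, 3` it is free of rank one, generated by the empty diagram,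
the strand (i.e. the pairing of a self-duality of `X`) and the trivalent vertex. Moreover every
morphism between tensor powers of `X` is a linear combination of diagrams, and the values of the
circle and of the bigon are not zero. Neither the symmetry of the self-duality nor the
rotational invariance of the vertex is part of the definition. -/
structure IsTrivalentRibbon {X : C} (s : SelfDuality X) (τ : X ⊗ X ⟶ X) : Prop where
  box_zero : ∀ f : 𝟙_ C ⟶ 𝟙_ C, ∃! c : ℂ, f = c • 𝟙 (𝟙_ C)
  box_one : ∀ f : X ⟶ 𝟙_ C, f = 0
  box_two : ∀ f : X ⊗ X ⟶ 𝟙_ C, ∃! c : ℂ, f = c • s.cap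
  box_three : ∀ f : (X ⊗ X) ⊗ X ⟶ 𝟙_ C, ∃! c : ℂ, f = c • (τ ▷ X ≫ s.cap)
  generated : ∀ (a b : Word) (f : a.eval X ⟶ b.eval X), ∃ t : Term a b, t.eval s τ = f
  circle_ne_zero : circleValue s ≠ 0
  bigon_ne_zero : ∃ b : ℂ, b ≠ 0 ∧ bigonValue s τ = b • 𝟙 X

end objects

end Trivalent

/-! Computing with elements. For a cocommutative comonoid `Z` in `Mat_ C`, the functor `A ↦ Hom(Z,
A)` is lax symmetric monoidal. The square-zero coalgebra `𝟙 ⊕ A` carries a generic element of `A`,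
namely the projection to `A`, which is a split epimorphism; tensor products of such coalgebras carry
generic pure tensors. Hence two morphisms out of a tensor product agree as soon as they agree on
pure tensors of generalized elements (`Points.hom_ext₂` and its variants), and diagrams can be
handled like multilinear identities in a module over a commutative ring.

Symmetry and rotation. Since `τ` is non-zero, naturality of the twist along `τ` makes the twist of
`X` trivial. The symmetric group on three letters acts on the one-dimensional three-box space by a
character, so both transpositions act by the same sign `σ`. The bigon form is symmetric whatever the
sign of the pairing, because the sign from the copairing cancels the sign from the pairing. As the
bigon is a non-zero scalar, the pairing itself is symmetric, and then `τ` is rotationally invariant.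

Relations. The diagrams `U`, `id`, `P`, `I`, `H`, `K` are six vectors in a space of dimension at
most five, so they satisfy a linear relation. Rotating and crossing legs permutes `U, id, P` and, up
to `σ`, permutes `I, H, K`; closing two legs with `τ` or the cap turns a relation into a linear
equation for its coefficients. For `σ = 1`, (anti)symmetrizing the relation leaves only the shapes
of `Sym` and `F4`. For `σ = -1` it leaves the shape of `G2`, or else every relation is a multiple of
Jacobi. In the last case a relation involving the square must exist; invariance of the square under
rotation, Jacobi, and capping determine all its coefficients and force `d ≠ -2`. In the other cases
the cap and `τ` closures express bigon and triangle through one parameter, which is non-zero because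
the bigon is, and rescaling the pairing normalizes it (`classification`). A model of a skein theory
then evaluates diagrams, which gives the functor (`IsModel.isAlgebraObject`).

Algebras. On `𝟙 ⊕ X` put `(r, x)(r', x') = (r r' + κ⟨x, x'⟩, r x' + r' x + τ(x, x'))`. With `κ = 1`
the `Sym` relation says that the associator vanishes; with `κ = -1` the `G2` relation is the
composition law on traceless elements; with `κ = 1` the `F4` relation is the polarized
Cayley–Hamilton identity on traceless elements, and the Jordan identity follows from it
(`jordan_of_cubic`). -/

set_option linter.unusedSectionVars false

universe u₁

/-! ### Generalized elements

A system of generalized elements of the objects of a `ℂ`-linear symmetric monoidal category is a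
lax symmetric monoidal functor to vector spaces. Identities between morphisms out of a tensor
product may be checked on pure tensors of generalized elements. -/

/-- A lax symmetric monoidal `ℂ`-linear functor to vector spaces. -/
structure Points (C : Type u) [Category.{v} C] [Preadditive C] [Linear ℂ C]
    [MonoidalCategory C] [BraidedCategory C] where
  obj : C → Type v
  [addCommGroup : ∀ A, AddCommGroup (obj A)]
  [module : ∀ A, Module ℂ (obj A)]
  map {A B : C} : (A ⟶ B) →ₗ[ℂ] obj A →ₗ[ℂ] obj B
  pair {A B : C} : obj A →ₗ[ℂ] obj B →ₗ[ℂ] obj (A ⊗ B)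
  one : obj (𝟙_ C)
  map_id {A : C} (a : obj A) : map (𝟙 A) a = a
  map_comp {A B D : C} (f : A ⟶ B) (g : B ⟶ D) (a : obj A) : map (f ≫ g) a = map g (map f a)
  map_whiskerLeft {A B D : C} (f : B ⟶ D) (a : obj A) (b : obj B) :
    map (A ◁ f) (pair a b) = pair a (map f b)
  map_whiskerRight {A B D : C} (f : A ⟶ B) (a : obj A) (b : obj D) :
    map (f ▷ D) (pair a b) = pair (map f a) b
  map_associator {A B D : C} (a : obj A) (b : obj B) (c : obj D) :
    map (α_ A B D).hom (pair (pair a b) c) = pair a (pair b c)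
  map_braiding {A B : C} (a : obj A) (b : obj B) : map (β_ A B).hom (pair a b) = pair b a
  map_leftUnitor_one {A : C} (a : obj A) : map (λ_ A).hom (pair one a) = a

attribute [instance] Points.addCommGroup Points.module

namespace Points

variable {C : Type u} [Category.{v} C] [Preadditive C] [Linear ℂ C] [MonoidalCategory C]

attribute [simp] map_id map_comp map_whiskerLeft map_whiskerRight map_associator map_braiding

section braided

variable [BraidedCategory C] (E : Points C)

@[simp]
theorem map_tensorHom {A B A' B' : C} (f : A ⟶ B) (g : A' ⟶ B') (a : E.obj A) (b : E.obj A') :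
    E.map (f ⊗ₘ g) (E.pair a b) = E.pair (E.map f a) (E.map g b) := by
  simp [MonoidalCategory.tensorHom_def]

@[simp]
theorem map_hom_map_inv {A B : C} (e : A ≅ B) (a : E.obj B) : E.map e.hom (E.map e.inv a) = a := by
  rw [← map_comp, e.inv_hom_id, map_id]

@[simp]
theorem map_inv_map_hom {A B : C} (e : A ≅ B) (a : E.obj A) : E.map e.inv (E.map e.hom a) = a := by
  rw [← map_comp, e.hom_inv_id, map_id]

theorem map_inv_eq_iff {A B : C} (e : A ≅ B) (a : E.obj B) (b : E.obj A) :
    E.map e.inv a = b ↔ a = E.map e.hom b :=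
  ⟨fun h => by rw [← h, map_hom_map_inv], fun h => by rw [h, map_inv_map_hom]⟩

@[simp]
theorem map_associator_inv {A B D : C} (a : E.obj A) (b : E.obj B) (c : E.obj D) :
    E.map (α_ A B D).inv (E.pair a (E.pair b c)) = E.pair (E.pair a b) c := by
  rw [map_inv_eq_iff, map_associator]

end braided

variable [SymmetricCategory C] (E : Points C)

instance : One (E.obj (𝟙_ C)) := ⟨E.one⟩

instance : Mul (E.obj (𝟙_ C)) := ⟨fun r s => E.map (λ_ (𝟙_ C)).hom (E.pair r s)⟩

instance (A : C) : SMul (E.obj (𝟙_ C)) (E.obj A) := ⟨fun r a => E.map (λ_ A).hom (E.pair r a)⟩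

theorem scalar_mul_def (r s : E.obj (𝟙_ C)) : r * s = E.map (λ_ (𝟙_ C)).hom (E.pair r s) := rfl

theorem scalar_smul_def {A : C} (r : E.obj (𝟙_ C)) (a : E.obj A) :
    r • a = E.map (λ_ A).hom (E.pair r a) := rfl

theorem scalar_mul_smul {A : C} (r s : E.obj (𝟙_ C)) (a : E.obj A) :
    (r * s) • a = r • s • a := by
  have h : (λ_ (𝟙_ C)).hom ▷ A ≫ (λ_ A).hom =
    (α_ _ _ _).hom ≫ 𝟙_ C ◁ (λ_ A).hom ≫ (λ_ A).hom := by simp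
  have := congrArg (fun f => E.map f (E.pair (E.pair r s) a)) h
  simp only [map_comp, map_whiskerRight, map_whiskerLeft, map_associator] at this
  exact this

theorem scalar_mul_comm (r s : E.obj (𝟙_ C)) : r * s = s * r := by
  have h : (β_ (𝟙_ C) (𝟙_ C)).hom ≫ (λ_ (𝟙_ C)).hom = (λ_ (𝟙_ C)).hom := by
    rw [braiding_leftUnitor, unitors_equal]
  have := congrArg (fun f => E.map f (E.pair s r)) h
  simp only [map_comp, map_braiding] at this
  exact this

/-- Points of the unit object serve as scalars. Values of pairings lie in this ring, so an identity
of diagrams becomes an identity in a module over a commutative ring. -/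
instance : CommRing (E.obj (𝟙_ C)) :=
  { E.addCommGroup (𝟙_ C) with
    mul_assoc := fun r s t => scalar_mul_smul E r s t
    one_mul := fun r => E.map_leftUnitor_one r
    mul_one := fun r => (scalar_mul_comm E r _).trans (E.map_leftUnitor_one r)
    mul_comm := scalar_mul_comm E
    left_distrib := fun r s t => by simp [scalar_mul_def]
    right_distrib := fun r s t => by simp [scalar_mul_def]
    zero_mul := fun r => by simp [scalar_mul_def]
    mul_zero := fun r => by simp [scalar_mul_def] }

instance (A : C) : Module (E.obj (𝟙_ C)) (E.obj A) where
  one_smul a := E.map_leftUnitor_one a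
  mul_smul := scalar_mul_smul E
  smul_zero r := by simp [scalar_smul_def]
  smul_add r a b := by simp [scalar_smul_def]
  add_smul r s a := by simp [scalar_smul_def]
  zero_smul a := by simp [scalar_smul_def]

instance : Algebra ℂ (E.obj (𝟙_ C)) :=
  Algebra.ofModule (fun c r s => by simp [scalar_mul_def]) (fun c r s => by simp [scalar_mul_def])

instance (A : C) : IsScalarTower ℂ (E.obj (𝟙_ C)) (E.obj A) :=
  ⟨fun c r a => by simp [scalar_smul_def]⟩

@[simp]
theorem map_leftUnitor {A : C} (r : E.obj (𝟙_ C)) (a : E.obj A) :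
    E.map (λ_ A).hom (E.pair r a) = r • a := rfl

@[simp]
theorem map_rightUnitor {A : C} (r : E.obj (𝟙_ C)) (a : E.obj A) :
    E.map (ρ_ A).hom (E.pair a r) = r • a := by
  have := congrArg (fun f => E.map f (E.pair a r)) (braiding_leftUnitor A)
  simp only [map_comp, map_braiding, map_leftUnitor] at this
  exact this.symm

@[simp]
theorem map_leftUnitor_inv {A : C} (a : E.obj A) : E.map (λ_ A).inv a = E.pair 1 a := by
  rw [map_inv_eq_iff, map_leftUnitor, one_smul]

@[simp]
theorem map_rightUnitor_inv {A : C} (a : E.obj A) : E.map (ρ_ A).inv a = E.pair a 1 := by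
  rw [map_inv_eq_iff, map_rightUnitor, one_smul]

@[simp]
theorem map_scalar_smul {A B : C} (f : A ⟶ B) (r : E.obj (𝟙_ C)) (a : E.obj A) :
    E.map f (r • a) = r • E.map f a := by
  have := congrArg (fun f => E.map f (E.pair r a)) (leftUnitor_naturality f)
  simp only [map_comp, map_whiskerLeft, map_leftUnitor] at this
  exact this.symm

theorem pair_scalar_smul_left {A B : C} (r : E.obj (𝟙_ C)) (a : E.obj A) (b : E.obj B) :
    E.pair (r • a) b = r • E.pair a b := by
  have h : (λ_ A).hom ▷ B = (α_ _ _ _).hom ≫ (λ_ (A ⊗ B)).hom := by simp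
  have := congrArg (fun f => E.map f (E.pair (E.pair r a) b)) h
  simpa only [map_comp, map_whiskerRight, map_associator, map_leftUnitor] using this

theorem pair_scalar_smul_right {A B : C} (r : E.obj (𝟙_ C)) (a : E.obj A) (b : E.obj B) :
    E.pair a (r • b) = r • E.pair a b := by
  rw [← map_braiding, pair_scalar_smul_left, map_scalar_smul, map_braiding]

attribute [simp] pair_scalar_smul_left pair_scalar_smul_right

@[simp]
theorem map_tensorμ {A B A' B' : C} (a : E.obj A) (b : E.obj B) (a' : E.obj A') (b' : E.obj B') :
    E.map (tensorμ A B A' B') (E.pair (E.pair a b) (E.pair a' b')) =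
      E.pair (E.pair a a') (E.pair b b') := by
  simp [tensorμ]

end Points

/-! ### Square-zero coalgebras and points at a cocommutative comonoid. -/

section

open Limits ComonObj

section SquareZero

variable {D : Type u} [Category.{v} D] [Preadditive D] [MonoidalCategory D]
  [HasBinaryBiproducts D]

/-- The square-zero coalgebra `𝟙 ⊕ A`, in which `A` consists of primitive elements. -/
noncomputable def squareZero (A : D) : D := 𝟙_ D ⊞ A

namespace squareZero

noncomputable def inl (A : D) : 𝟙_ D ⟶ squareZero A := biprod.inl
noncomputable def inr (A : D) : A ⟶ squareZero A := biprod.inr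
noncomputable def snd (A : D) : squareZero A ⟶ A := biprod.snd

@[ext]
theorem hom_ext {A W : D} {f g : squareZero A ⟶ W} (h : inl A ≫ f = inl A ≫ g)
    (h' : inr A ≫ f = inr A ≫ g) : f = g := biprod.hom_ext' _ _ h h'

noncomputable def counit (A : D) : squareZero A ⟶ 𝟙_ D := biprod.fst

noncomputable def comul (A : D) : squareZero A ⟶ squareZero A ⊗ squareZero A :=
  biprod.desc ((λ_ (𝟙_ D)).inv ≫ (inl A ⊗ₘ inl A))
    ((λ_ A).inv ≫ (inl A ⊗ₘ inr A) + (ρ_ A).inv ≫ (inr A ⊗ₘ inl A))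

@[simp]
theorem inr_snd (A : D) : inr A ≫ snd A = 𝟙 A := biprod.inr_snd

@[simp]
theorem inl_counit (A : D) : inl A ≫ counit A = 𝟙 _ := biprod.inl_fst

@[simp]
theorem inr_counit (A : D) : inr A ≫ counit A = 0 := biprod.inr_fst

@[simp]
theorem inl_comul (A : D) : inl A ≫ comul A = (λ_ (𝟙_ D)).inv ≫ (inl A ⊗ₘ inl A) :=
  biprod.inl_desc _ _

@[simp]
theorem inr_comul (A : D) : inr A ≫ comul A =
    (λ_ A).inv ≫ (inl A ⊗ₘ inr A) + (ρ_ A).inv ≫ (inr A ⊗ₘ inl A) := biprod.inr_desc _ _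

@[simp]
theorem inl_comul_assoc (A : D) {W : D} (h : squareZero A ⊗ squareZero A ⟶ W) :
    inl A ≫ comul A ≫ h = (λ_ (𝟙_ D)).inv ≫ (inl A ⊗ₘ inl A) ≫ h := by
  rw [← Category.assoc, inl_comul, Category.assoc]

@[simp]
theorem inr_comul_assoc (A : D) {W : D} (h : squareZero A ⊗ squareZero A ⟶ W) :
    inr A ≫ comul A ≫ h =
      (λ_ A).inv ≫ (inl A ⊗ₘ inr A) ≫ h + (ρ_ A).inv ≫ (inr A ⊗ₘ inl A) ≫ h := by
  rw [← Category.assoc, inr_comul, Preadditive.add_comp, Category.assoc, Category.assoc]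

variable [MonoidalPreadditive D]

/-- An arbitrary object has no useful comonoid structure, but it is a retract of this one, which is
all that a generic element requires. -/
noncomputable instance (A : D) : ComonObj (squareZero A) where
  counit := counit A
  comul := comul A
  counit_comul := by
    ext <;> simp [← tensorHom_id, MonoidalPreadditive.zero_tensor]
  comul_counit := by
    ext <;> simp [← id_tensorHom, MonoidalPreadditive.tensor_zero, unitors_inv_equal]
  comul_assoc := by
    have h₁ : ∀ {A₁ A₂ B₁ B₂ B₃ B : D} (f : A₁ ⟶ A₂) (h : B ⟶ B₁ ⊗ B₂) (g : B₁ ⊗ B₂ ⟶ B₃),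
        (f ⊗ₘ (h ≫ g)) = A₁ ◁ h ≫ (f ⊗ₘ g) := by
      intros
      rw [whiskerLeft_comp_tensorHom]
    have h₂ : ∀ {A₁ A₂ B₁ B₂ B B' W : D} (f : B₁ ⟶ A₁) (g : B₂ ⟶ A₂) (h : B ⟶ B₁ ⊗ B₂)
        (k : B' ⟶ W), ((h ≫ (f ⊗ₘ g)) ⊗ₘ k) ≫ (α_ _ _ _).hom =
          h ▷ B' ≫ (α_ _ _ _).hom ≫ (f ⊗ₘ (g ⊗ₘ k)) := by
      intros
      rw [← associator_naturality, whiskerRight_comp_tensorHom_assoc]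
    ext
    · simp only [inl_comul_assoc, tensorHom_comp_whiskerLeft, inl_comul,
        tensorHom_comp_whiskerRight_assoc]
      rw [h₁, h₂]
      monoidal
    · simp only [inr_comul_assoc, tensorHom_comp_whiskerLeft, inl_comul, inr_comul,
        tensorHom_comp_whiskerRight_assoc, MonoidalPreadditive.tensor_add,
        MonoidalPreadditive.add_tensor, Preadditive.add_comp, Preadditive.comp_add]
      rw [h₁, h₁, h₁, h₂, h₂, h₂, add_assoc]
      congr 1
      · monoidal
      · congr 1 <;> monoidal

instance [SymmetricCategory D] (A : D) : IsCommComonObj (squareZero A) where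
  comul_comm := by
    change comul A ≫ _ = comul A
    ext
    · simp [unitors_inv_equal]
    · simp [add_comm]

end squareZero

end SquareZero

section linear

variable {D : Type u} [Category.{v} D] [Preadditive D] [Linear ℂ D] [MonoidalCategory D]
  [MonoidalPreadditive D] [MonoidalLinear ℂ D]

theorem smul_tensorHom {A B A' B' : D} (r : ℂ) (f : A ⟶ B) (g : A' ⟶ B') :
    (r • f) ⊗ₘ g = r • (f ⊗ₘ g) := by simp [MonoidalCategory.tensorHom_def]

theorem tensorHom_smul {A B A' B' : D} (r : ℂ) (f : A ⟶ B) (g : A' ⟶ B') :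
    f ⊗ₘ (r • g) = r • (f ⊗ₘ g) := by simp [MonoidalCategory.tensorHom_def]

end linear

section ofComon

variable {C : Type u₁} [Category.{v} C] [Preadditive C] [Linear ℂ C] [MonoidalCategory C]
  [MonoidalPreadditive C] [MonoidalLinear ℂ C] [SymmetricCategory C]
  {D : Type u} [Category.{v} D] [Preadditive D] [Linear ℂ D] [MonoidalCategory D]
  [MonoidalPreadditive D] [MonoidalLinear ℂ D] [SymmetricCategory D]

open Functor.LaxMonoidal

/-- The generalized elements at a cocommutative comonoid `Z`, along a functor `F`. -/
noncomputable def Points.ofComon (F : C ⥤ D) [F.LaxBraided] [F.Additive] [F.Linear ℂ] (Z : D)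
    [ComonObj Z] [IsCommComonObj Z] : Points.{v} C where
  obj A := Z ⟶ F.obj A
  map {A B} := LinearMap.mk₂ ℂ (fun f a => a ≫ F.map f) (by simp) (by simp) (by simp) (by simp)
  pair {A B} := LinearMap.mk₂ ℂ (fun a b => Δ[Z] ≫ (a ⊗ₘ b) ≫ μ F A B)
    (by simp [MonoidalPreadditive.add_tensor]) (by simp [smul_tensorHom])
    (by simp [MonoidalPreadditive.tensor_add]) (by simp [tensorHom_smul])
  one := ε[Z] ≫ Functor.LaxMonoidal.ε F
  map_id a := by simp
  map_comp f g a := by simp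
  map_whiskerLeft f a b := by
    change (Δ[Z] ≫ (a ⊗ₘ b) ≫ μ F _ _) ≫ F.map _ = Δ[Z] ≫ (a ⊗ₘ (b ≫ F.map f)) ≫ μ F _ _
    rw [Category.assoc, Category.assoc, ← μ_natural_right, tensorHom_comp_whiskerLeft_assoc]
  map_whiskerRight f a b := by
    change (Δ[Z] ≫ (a ⊗ₘ b) ≫ μ F _ _) ≫ F.map _ = Δ[Z] ≫ ((a ≫ F.map f) ⊗ₘ b) ≫ μ F _ _
    rw [Category.assoc, Category.assoc, ← μ_natural_left, tensorHom_comp_whiskerRight_assoc]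
  map_associator a b c := by
    change (Δ[Z] ≫ ((Δ[Z] ≫ (a ⊗ₘ b) ≫ μ F _ _) ⊗ₘ c) ≫ μ F _ _) ≫ F.map _ =
      Δ[Z] ≫ (a ⊗ₘ (Δ[Z] ≫ (b ⊗ₘ c) ≫ μ F _ _)) ≫ μ F _ _
    have h₁ : (Δ[Z] ≫ (a ⊗ₘ b) ≫ μ F _ _) ⊗ₘ c =
        Δ[Z] ▷ Z ≫ ((a ⊗ₘ b) ⊗ₘ c) ≫ μ F _ _ ▷ _ := by
      rw [tensorHom_comp_whiskerRight, whiskerRight_comp_tensorHom]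
    have h₂ : a ⊗ₘ (Δ[Z] ≫ (b ⊗ₘ c) ≫ μ F _ _) =
        Z ◁ Δ[Z] ≫ (a ⊗ₘ (b ⊗ₘ c)) ≫ _ ◁ μ F _ _ := by
      rw [tensorHom_comp_whiskerLeft, whiskerLeft_comp_tensorHom]
    rw [h₁, h₂]
    simp only [Category.assoc]
    rw [associativity, associator_naturality_assoc, comul_assoc_assoc]
  map_braiding a b := by
    simp [Functor.LaxBraided.braided]
  map_leftUnitor_one a := by
    change (Δ[Z] ≫ ((ε[Z] ≫ Functor.LaxMonoidal.ε F) ⊗ₘ a) ≫ μ F _ _) ≫ F.map _ = a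
    have h₁ : (ε[Z] ≫ Functor.LaxMonoidal.ε F) ⊗ₘ a =
        (ε[Z] ⊗ₘ a) ≫ Functor.LaxMonoidal.ε F ▷ _ := by rw [tensorHom_comp_whiskerRight]
    rw [h₁]
    simp
end ofComon

end

/-! ### Generic elements and their tensor products. -/

section

open Limits ComonObj

section projections

variable {D : Type u} [Category.{v} D] [MonoidalCategory D] [SymmetricCategory D]

/-- The first projection from a tensor product of comonoids. -/
def comonFst (Z W : D) [ComonObj W] : Z ⊗ W ⟶ Z := Z ◁ ε[W] ≫ (ρ_ Z).hom

/-- The second projection from a tensor product of comonoids. -/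
def comonSnd (Z W : D) [ComonObj Z] : Z ⊗ W ⟶ W := ε[Z] ▷ W ≫ (λ_ W).hom

/-- The counit laws of both factors collapse the doubled tensor product. This is what makes the
generic element of `A ⊗ B` a pure tensor of two pulled-back generic elements. -/
theorem comul_comonFst_comonSnd (Z W : D) [ComonObj Z] [ComonObj W] :
    Δ[Z ⊗ W] ≫ (comonFst Z W ⊗ₘ comonSnd Z W) = 𝟙 (Z ⊗ W) := by
  have h : comonFst Z W ⊗ₘ comonSnd Z W =
      ((𝟙 Z ⊗ₘ ε[W]) ⊗ₘ (ε[Z] ⊗ₘ 𝟙 W)) ≫ ((ρ_ Z).hom ⊗ₘ (λ_ W).hom) := by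
    simp [comonFst, comonSnd]
  rw [Comon.tensorObj_comul, h, Category.assoc, ← tensorμ_natural_assoc,
    tensorHom_comp_tensorHom_assoc, id_tensorHom, tensorHom_id, comul_counit, counit_comul]
  rw [tensorμ, braiding_tensorUnit_left]
  monoidal

/-- Pulling points back along a comonoid morphism preserves pairs; this keeps iterated generic
elements pure when another factor is tensored on the right. -/
instance (Z W : D) [ComonObj Z] [ComonObj W] : IsComonHom (comonFst Z W) where
  hom_counit := by
    rw [Comon.tensorObj_counit, comonFst, MonoidalCategory.tensorHom_def']
    simp [unitors_equal]
  hom_comul := by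
    have h : comonFst Z W ⊗ₘ comonFst Z W =
        ((𝟙 Z ⊗ₘ ε[W]) ⊗ₘ (𝟙 Z ⊗ₘ ε[W])) ≫ ((ρ_ Z).hom ⊗ₘ (ρ_ Z).hom) := by
      simp [comonFst]
    rw [Comon.tensorObj_comul, h, Category.assoc, ← tensorμ_natural_assoc,
      tensorHom_comp_tensorHom_assoc, id_tensorHom_id, Category.comp_id, counit_comul_hom,
      tensorμ, braiding_tensorUnit_right, comonFst,
      ← Category.comp_id Δ[Z], ← tensorHom_comp_tensorHom_assoc, MonoidalCategory.tensorHom_def']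
    monoidal

end projections

section generic

variable {C : Type u₁} [Category.{v} C] [Preadditive C] [Linear ℂ C] [MonoidalCategory C]
  [MonoidalPreadditive C] [MonoidalLinear ℂ C] [SymmetricCategory C]
  {D : Type u} [Category.{v} D] [Preadditive D] [Linear ℂ D] [MonoidalCategory D]
  [MonoidalPreadditive D] [MonoidalLinear ℂ D] [SymmetricCategory D]
  (F : C ⥤ D) [F.Braided] [F.Additive] [F.Linear ℂ]

open Functor.LaxMonoidal Functor.OplaxMonoidal

theorem Points.ofComon_pair (Z : D) [ComonObj Z] [IsCommComonObj Z] {A B : C}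
    (a : Z ⟶ F.obj A) (b : Z ⟶ F.obj B) :
    (Points.ofComon F Z).pair a b = Δ[Z] ≫ (a ⊗ₘ b) ≫ μ F A B := rfl

theorem Points.comp_ofComon_pair {Z W : D} [ComonObj Z] [IsCommComonObj Z] [ComonObj W]
    [IsCommComonObj W] (p : W ⟶ Z) [IsComonHom p] {A B : C}
    (a : Z ⟶ F.obj A) (b : Z ⟶ F.obj B) :
    p ≫ (Points.ofComon F Z).pair a b = (Points.ofComon F W).pair (p ≫ a) (p ≫ b) := by
  rw [Points.ofComon_pair, Points.ofComon_pair, IsComonHom.hom_comul_assoc,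
    tensorHom_comp_tensorHom_assoc]

/-- A generalized element of `A` that detects equality of morphisms out of `A`: a split
epimorphism from a cocommutative comonoid to `F A`. -/
structure GenericPoint (A : C) where
  Z : D
  [comon : ComonObj Z]
  [comm : IsCommComonObj Z]
  x : Z ⟶ F.obj A
  sec : F.obj A ⟶ Z
  sec_x : sec ≫ x = 𝟙 _

attribute [instance] GenericPoint.comon GenericPoint.comm

namespace GenericPoint

variable {F}

noncomputable def points {A : C} (P : GenericPoint F A) : Points C := .ofComon F P.Z

/-- Evaluation at the generic element is precomposition with a split epimorphism, so its section
recovers the morphism. -/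
theorem hom_ext [F.Faithful] {A W : C} (P : GenericPoint F A) {f g : A ⟶ W}
    (h : P.points.map f P.x = P.points.map g P.x) : f = g := by
  apply F.map_injective
  have h' : P.sec ≫ P.x ≫ F.map f = P.sec ≫ P.x ≫ F.map g := congrArg (P.sec ≫ ·) h
  rwa [← Category.assoc, ← Category.assoc, P.sec_x, Category.id_comp, Category.id_comp] at h'

noncomputable def single [HasBinaryBiproducts D] (A : C) : GenericPoint F A where
  Z := squareZero (F.obj A)
  x := squareZero.snd _
  sec := squareZero.inr _
  sec_x := squareZero.inr_snd _

noncomputable def tensor {A B : C} (P : GenericPoint F A) (Q : GenericPoint F B) :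
    GenericPoint F (A ⊗ B) where
  Z := P.Z ⊗ Q.Z
  x := (P.x ⊗ₘ Q.x) ≫ μ F A B
  sec := δ F A B ≫ (P.sec ⊗ₘ Q.sec)
  sec_x := by simp [tensorHom_comp_tensorHom_assoc, P.sec_x, Q.sec_x]

/-- Pulling back generalized elements along the first projection. -/
noncomputable def left {A B A' : C} (P : GenericPoint F A) (Q : GenericPoint F B)
    (a : P.points.obj A') : (P.tensor Q).points.obj A' :=
  (comonFst P.Z Q.Z ≫ a : P.Z ⊗ Q.Z ⟶ F.obj A')

/-- Pulling back generalized elements along the second projection. -/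
noncomputable def right {A B A' : C} (P : GenericPoint F A) (Q : GenericPoint F B)
    (b : Q.points.obj A') : (P.tensor Q).points.obj A' :=
  (comonSnd P.Z Q.Z ≫ b : P.Z ⊗ Q.Z ⟶ F.obj A')

theorem left_pair {A B A₁ A₂ : C} (P : GenericPoint F A) (Q : GenericPoint F B)
    (a₁ : P.points.obj A₁) (a₂ : P.points.obj A₂) :
    P.left Q (P.points.pair a₁ a₂) = (P.tensor Q).points.pair (P.left Q a₁) (P.left Q a₂) :=
  Points.comp_ofComon_pair F (comonFst P.Z Q.Z) _ _

theorem tensor_x {A B : C} (P : GenericPoint F A) (Q : GenericPoint F B) :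
    (P.tensor Q).x = (P.tensor Q).points.pair (P.left Q P.x) (P.right Q Q.x) := by
  change (P.x ⊗ₘ Q.x) ≫ μ F A B =
    Δ[P.Z ⊗ Q.Z] ≫ ((comonFst P.Z Q.Z ≫ P.x) ⊗ₘ (comonSnd P.Z Q.Z ≫ Q.x)) ≫ μ F A B
  rw [← tensorHom_comp_tensorHom_assoc, ← Category.assoc Δ[P.Z ⊗ Q.Z],
    comul_comonFst_comonSnd, Category.id_comp]

end GenericPoint

end generic

end

/-! ### The additive completion is linear monoidal, and the embedding into it is braided. -/

section

open Limits

namespace AdditiveCompletion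

variable {C : Type u} [Category.{v} C] [Preadditive C] [MonoidalCategory C]
  [MonoidalPreadditive C]

instance : MonoidalPreadditive (Mat_ C) where
  whiskerLeft_zero {M N K} := by
    ext p q
    exact MonoidalPreadditive.tensor_zero _
  zero_whiskerRight {M N K} := by
    ext p q
    exact MonoidalPreadditive.zero_tensor _
  whiskerLeft_add f g := by
    ext p q
    exact MonoidalPreadditive.tensor_add _ _ _
  add_whiskerRight f g := by
    ext p q
    exact MonoidalPreadditive.add_tensor _ _ _

instance [Linear ℂ C] [MonoidalLinear ℂ C] : MonoidalLinear ℂ (Mat_ C) where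
  whiskerLeft_smul M _ _ r f := by
    ext p q
    exact tensorHom_smul _ _ _
  smul_whiskerRight r _ _ f M := by
    ext p q
    exact smul_tensorHom _ _ _

theorem embedding_map_isReindexing {A B : C} (f : A ⟶ B) :
    IsReindexing ((Mat_.embedding C).map f) (Equiv.refl PUnit) (fun _ => f) :=
  ⟨fun _ => rfl, fun _ _ h => (h rfl).elim⟩

noncomputable def embeddingμIso (A B : C) :
    (Mat_.embedding C).obj A ⊗ (Mat_.embedding C).obj B ≅ (Mat_.embedding C).obj (A ⊗ B) :=
  reindex (M := (Mat_.embedding C).obj A ⊗ (Mat_.embedding C).obj B)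
    (N := (Mat_.embedding C).obj (A ⊗ B)) (Equiv.prodPUnit PUnit) (fun _ => Iso.refl _)

theorem embeddingμIso_isReindexing (A B : C) :
    IsReindexing (embeddingμIso A B).hom (Equiv.prodPUnit PUnit) (fun _ => 𝟙 (A ⊗ B)) :=
  reindex_isReindexing _ _

noncomputable def embeddingεIso : 𝟙_ (Mat_ C) ≅ (Mat_.embedding C).obj (𝟙_ C) :=
  Iso.refl (𝟙_ (Mat_ C))

theorem embeddingεIso_isReindexing :
    IsReindexing (embeddingεIso (C := C)).hom (Equiv.refl PUnit) (fun _ => 𝟙 (𝟙_ C)) :=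
  IsReindexing.id (𝟙_ (Mat_ C))

noncomputable instance embeddingMonoidal : (Mat_.embedding C).Monoidal :=
  Functor.CoreMonoidal.toMonoidal
  { εIso := embeddingεIso
    μIso := embeddingμIso
    μIso_hom_natural_left := fun f X => IsReindexing.unique
      (((embedding_map_isReindexing f).tensor (.id _)).comp (embeddingμIso_isReindexing _ _))
      ((embeddingμIso_isReindexing _ _).comp (embedding_map_isReindexing _))
      (fun _ => by change (f ⊗ₘ 𝟙 X) ≫ 𝟙 _ = 𝟙 _ ≫ f ▷ X; simp)
    μIso_hom_natural_right := fun X f => IsReindexing.unique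
      (((IsReindexing.id _).tensor (embedding_map_isReindexing f)).comp
        (embeddingμIso_isReindexing _ _))
      ((embeddingμIso_isReindexing _ _).comp (embedding_map_isReindexing _))
      (fun _ => by change (𝟙 X ⊗ₘ f) ≫ 𝟙 _ = 𝟙 _ ≫ X ◁ f; simp)
    associativity := fun X Y Z => IsReindexing.unique
      (((embeddingμIso_isReindexing X Y).tensor (.id _)).comp
        ((embeddingμIso_isReindexing _ _).comp (embedding_map_isReindexing _)))
      ((associator_isReindexing _ _ _).comp (((IsReindexing.id _).tensor
        (embeddingμIso_isReindexing Y Z)).comp (embeddingμIso_isReindexing _ _)))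
      (fun _ => by change (𝟙 (X ⊗ Y) ⊗ₘ 𝟙 Z) ≫ 𝟙 _ ≫ (α_ X Y Z).hom =
        (α_ X Y Z).hom ≫ (𝟙 X ⊗ₘ 𝟙 (Y ⊗ Z)) ≫ 𝟙 _; simp)
    left_unitality := fun X => IsReindexing.unique (leftUnitor_isReindexing _)
      ((embeddingεIso_isReindexing.tensor (.id _)).comp ((embeddingμIso_isReindexing _ _).comp
        (embedding_map_isReindexing _)))
      (fun _ => by change (λ_ X).hom = (𝟙 (𝟙_ C) ⊗ₘ 𝟙 X) ≫ 𝟙 _ ≫ (λ_ X).hom; simp)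
    right_unitality := fun X => IsReindexing.unique (rightUnitor_isReindexing _)
      (((IsReindexing.id _).tensor embeddingεIso_isReindexing).comp
        ((embeddingμIso_isReindexing _ _).comp (embedding_map_isReindexing _)))
      (fun _ => by change (ρ_ X).hom = (𝟙 X ⊗ₘ 𝟙 (𝟙_ C)) ≫ 𝟙 _ ≫ (ρ_ X).hom; simp) }

noncomputable instance embeddingBraided [SymmetricCategory C] : (Mat_.embedding C).Braided where
  braided A B := IsReindexing.unique
    ((embeddingμIso_isReindexing A B).comp (embedding_map_isReindexing _))
    ((braiding_isReindexing _ _).comp (embeddingμIso_isReindexing B A))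
    (fun _ => by change 𝟙 _ ≫ (β_ A B).hom = (β_ A B).hom ≫ 𝟙 _; simp)

instance [Linear ℂ C] : (Mat_.embedding C).Linear ℂ where

end AdditiveCompletion

end

/-! ### Morphisms are determined by their values on pure tensors. -/

section

open Limits

namespace Points

variable {C : Type u} [Category.{v} C] [Preadditive C] [Linear ℂ C] [MonoidalCategory C]
  [MonoidalPreadditive C] [MonoidalLinear ℂ C] [SymmetricCategory C]

/-- The generic element of `A`. -/
noncomputable abbrev generic (A : C) : GenericPoint (Mat_.embedding C) A := .single A

theorem hom_ext₁ {A W : C} {f g : A ⟶ W}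
    (h : ∀ (E : Points.{v} C) (a : E.obj A), E.map f a = E.map g a) : f = g :=
  (generic A).hom_ext (h _ _)

theorem hom_ext₂ {A B W : C} {f g : A ⊗ B ⟶ W}
    (h : ∀ (E : Points.{v} C) (a : E.obj A) (b : E.obj B),
      E.map f (E.pair a b) = E.map g (E.pair a b)) : f = g := by
  refine ((generic A).tensor (generic B)).hom_ext ?_
  rw [GenericPoint.tensor_x]
  exact h _ _ _

theorem hom_ext₃ {A₁ A₂ A₃ W : C} {f g : (A₁ ⊗ A₂) ⊗ A₃ ⟶ W}
    (h : ∀ (E : Points.{v} C) (a₁ : E.obj A₁) (a₂ : E.obj A₂) (a₃ : E.obj A₃),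
      E.map f (E.pair (E.pair a₁ a₂) a₃) = E.map g (E.pair (E.pair a₁ a₂) a₃)) : f = g := by
  refine (((generic A₁).tensor (generic A₂)).tensor (generic A₃)).hom_ext ?_
  rw [GenericPoint.tensor_x, GenericPoint.tensor_x, GenericPoint.left_pair]
  exact h _ _ _ _

theorem hom_ext₁₂ {A₁ A₂ A₃ W : C} {f g : A₁ ⊗ (A₂ ⊗ A₃) ⟶ W}
    (h : ∀ (E : Points.{v} C) (a₁ : E.obj A₁) (a₂ : E.obj A₂) (a₃ : E.obj A₃),
      E.map f (E.pair a₁ (E.pair a₂ a₃)) = E.map g (E.pair a₁ (E.pair a₂ a₃))) : f = g := by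
  rw [← cancel_epi (α_ A₁ A₂ A₃).hom]
  exact hom_ext₃ fun E a₁ a₂ a₃ => by simpa using h E a₁ a₂ a₃

theorem hom_ext₄ {A₁ A₂ A₃ A₄ W : C} {f g : ((A₁ ⊗ A₂) ⊗ A₃) ⊗ A₄ ⟶ W}
    (h : ∀ (E : Points.{v} C) (a₁ : E.obj A₁) (a₂ : E.obj A₂) (a₃ : E.obj A₃) (a₄ : E.obj A₄),
      E.map f (E.pair (E.pair (E.pair a₁ a₂) a₃) a₄) =
        E.map g (E.pair (E.pair (E.pair a₁ a₂) a₃) a₄)) : f = g := by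
  refine ((((generic A₁).tensor (generic A₂)).tensor (generic A₃)).tensor (generic A₄)).hom_ext ?_
  rw [GenericPoint.tensor_x, GenericPoint.tensor_x, GenericPoint.tensor_x,
    GenericPoint.left_pair, GenericPoint.left_pair, GenericPoint.left_pair]
  exact h _ _ _ _ _

theorem hom_ext₂₂ {A₁ A₂ A₃ A₄ W : C} {f g : (A₁ ⊗ A₂) ⊗ (A₃ ⊗ A₄) ⟶ W}
    (h : ∀ (E : Points.{v} C) (a₁ : E.obj A₁) (a₂ : E.obj A₂) (a₃ : E.obj A₃) (a₄ : E.obj A₄),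
      E.map f (E.pair (E.pair a₁ a₂) (E.pair a₃ a₄)) =
        E.map g (E.pair (E.pair a₁ a₂) (E.pair a₃ a₄))) : f = g := by
  rw [← cancel_epi (α_ (A₁ ⊗ A₂) A₃ A₄).hom]
  exact hom_ext₄ fun E a₁ a₂ a₃ a₄ => by simpa using h E a₁ a₂ a₃ a₄

theorem hom_ext₁₃ {A₁ A₂ A₃ A₄ W : C} {f g : (A₁ ⊗ (A₂ ⊗ A₃)) ⊗ A₄ ⟶ W}
    (h : ∀ (E : Points.{v} C) (a₁ : E.obj A₁) (a₂ : E.obj A₂) (a₃ : E.obj A₃) (a₄ : E.obj A₄),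
      E.map f (E.pair (E.pair a₁ (E.pair a₂ a₃)) a₄) =
        E.map g (E.pair (E.pair a₁ (E.pair a₂ a₃)) a₄)) : f = g := by
  rw [← cancel_epi ((α_ A₁ A₂ A₃).hom ▷ A₄)]
  exact hom_ext₄ fun E a₁ a₂ a₃ a₄ => by simpa using h E a₁ a₂ a₃ a₄

end Points

end

/-! ### Bending strands -/

namespace SelfDuality

section

variable {C : Type u} [Category.{v} C] [MonoidalCategory C] {X : C} (s : SelfDuality X)

/-- Bending down the upper strand. -/
def flat {W : C} (f : W ⟶ X) : W ⊗ X ⟶ 𝟙_ C := f ▷ X ≫ s.cap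

/-- Bending down the last upper strand. -/
def bend {W : C} (f : W ⟶ X ⊗ X) : W ⊗ X ⟶ X :=
  f ▷ X ≫ (α_ X X X).hom ≫ X ◁ s.cap ≫ (ρ_ X).hom

/-- The copairing bends the strand up again, and the zigzag identity straightens it. -/
theorem eq_of_flat {W : C} (f : W ⟶ X) :
    f = (ρ_ W).inv ≫ W ◁ s.cup ≫ (α_ W X X).inv ≫ s.flat f ▷ X ≫ (λ_ X).hom := by
  have h : W ◁ s.cup ≫ (α_ W X X).inv ≫ (f ▷ X) ▷ X =
      f ▷ _ ≫ X ◁ s.cup ≫ (α_ X X X).inv := by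
    rw [← whisker_exchange_assoc, associator_inv_naturality_left]
  rw [flat, comp_whiskerRight, Category.assoc, reassoc_of% h, reassoc_of% s.zigzag_right]
  simp

theorem eq_of_bend {W : C} (f : W ⟶ X ⊗ X) :
    f = (ρ_ W).inv ≫ W ◁ s.cup ≫ (α_ W X X).inv ≫ s.bend f ▷ X := by
  have h : W ◁ s.cup ≫ (α_ W X X).inv ≫ (f ▷ X) ▷ X =
      f ▷ _ ≫ (X ⊗ X) ◁ s.cup ≫ (α_ (X ⊗ X) X X).inv := by
    rw [← whisker_exchange_assoc, associator_inv_naturality_left]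
  have h' : (X ⊗ X) ◁ s.cup ≫ (α_ (X ⊗ X) X X).inv ≫ (α_ X X X).hom ▷ X ≫
      (X ◁ s.cap) ▷ X = (α_ X X _).hom ≫ X ◁ (X ◁ s.cup ≫ (α_ X X X).inv ≫ s.cap ▷ X) ≫
        (α_ X _ X).inv := by
    simp
  rw [bend, comp_whiskerRight, comp_whiskerRight, comp_whiskerRight, reassoc_of% h,
    reassoc_of% h', s.zigzag_right]
  monoidal

theorem flat_injective {W : C} {f g : W ⟶ X} (h : s.flat f = s.flat g) : f = g := by
  rw [s.eq_of_flat f, h, ← s.eq_of_flat]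

theorem bend_injective {W : C} {f g : W ⟶ X ⊗ X} (h : s.bend f = s.bend g) : f = g := by
  rw [s.eq_of_bend f, h, ← s.eq_of_bend]

/-- The box form of a diagram with two lower and two upper legs. -/
def box {W : C} (f : W ⟶ X ⊗ X) : (W ⊗ X) ⊗ X ⟶ 𝟙_ C := s.flat (s.bend f)

theorem box_injective {W : C} {f g : W ⟶ X ⊗ X} (h : s.box f = s.box g) : f = g :=
  s.bend_injective (s.flat_injective h)

end

section

variable {C : Type u} [Category.{v} C] [Preadditive C] [Linear ℂ C] [MonoidalCategory C]
  [MonoidalPreadditive C] [MonoidalLinear ℂ C] {X : C} (s : SelfDuality X)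

/-- `box` as a linear map. -/
def boxₗ (W : C) : (W ⟶ X ⊗ X) →ₗ[ℂ] ((W ⊗ X) ⊗ X ⟶ 𝟙_ C) where
  toFun := s.box
  map_add' f g := by simp [box, flat, bend]
  map_smul' c f := by simp [box, flat, bend]

theorem boxₗ_injective (W : C) : Function.Injective (s.boxₗ W) := fun _ _ h => s.box_injective h

/-- Rescaling the pairing by a non-zero scalar. -/
noncomputable def rescale (c : ℂ) (hc : c ≠ 0) : SelfDuality X where
  cap := c • s.cap
  cup := c⁻¹ • s.cup
  zigzag_left := by simp [smul_smul, hc, s.zigzag_left]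
  zigzag_right := by simp [smul_smul, hc, s.zigzag_right]

end

end SelfDuality

/-! ### Diagrams as morphisms -/

section diagrams

variable {C : Type u} [Category.{v} C] [MonoidalCategory C] {X : C}

namespace SelfDuality

variable (s : SelfDuality X) (τ : X ⊗ X ⟶ X)

/-- The comultiplication dual to `τ`. -/
def comul : X ⟶ X ⊗ X := (λ_ X).inv ≫ s.cup ▷ X ≫ (α_ X X X).hom ≫ X ◁ τ

/-- The tree with a horizontal inner edge. -/
def treeH : X ⊗ X ⟶ X ⊗ X := X ◁ s.comul τ ≫ (α_ X X X).inv ≫ τ ▷ X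

end SelfDuality

end diagrams

namespace Points

variable {C : Type u} [Category.{v} C] [Preadditive C] [Linear ℂ C] [MonoidalCategory C]
  [MonoidalPreadditive C] [MonoidalLinear ℂ C] [SymmetricCategory C] {X : C} (E : Points C)
  (s : SelfDuality X) (τ : X ⊗ X ⟶ X)

/-- The contraction `p ⊗ q, z ↦ ⟨q, z⟩ p`. -/
def contract (ω : E.obj (X ⊗ X)) (z : E.obj X) : E.obj X :=
  E.map ((α_ X X X).hom ≫ X ◁ s.cap ≫ (ρ_ X).hom) (E.pair ω z)

@[simp]
theorem contract_pair (p q z : E.obj X) :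
    E.contract s (E.pair p q) z = E.map s.cap (E.pair q z) • p := by
  simp [contract]

theorem contract_smul (c : ℂ) (ω : E.obj (X ⊗ X)) (z : E.obj X) :
    E.contract s (c • ω) z = c • E.contract s ω z := by
  simp [contract]

theorem map_bend {W : C} (f : W ⟶ X ⊗ X) (w : E.obj W) (z : E.obj X) :
    E.map (s.bend f) (E.pair w z) = E.contract s (E.map f w) z := by
  simp [SelfDuality.bend, contract]

theorem map_flat {W : C} (f : W ⟶ X) (w : E.obj W) (z : E.obj X) :
    E.map (s.flat f) (E.pair w z) = E.map s.cap (E.pair (E.map f w) z) := by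
  simp [SelfDuality.flat]

theorem map_box {W : C} (f : W ⟶ X ⊗ X) (w : E.obj W) (z z' : E.obj X) :
    E.map (s.box f) (E.pair (E.pair w z) z') =
      E.map s.cap (E.pair (E.contract s (E.map f w) z) z') := by
  rw [SelfDuality.box, map_flat, map_bend]

theorem contract_cup (z : E.obj X) : E.contract s (E.map s.cup 1) z = z := by
  have := congrArg (fun f => E.map f (E.pair 1 z)) s.zigzag_left
  simp only [map_comp, map_whiskerRight, map_leftUnitor, one_smul, map_rightUnitor_inv] at this
  simp [contract, this]

theorem contract_cup_smul (r : E.obj (𝟙_ C)) (z : E.obj X) :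
    E.contract s (E.map s.cup r) z = r • z := by
  conv_lhs => rw [← mul_one r, ← smul_eq_mul, E.map_scalar_smul, contract,
    E.pair_scalar_smul_left, E.map_scalar_smul, ← contract, E.contract_cup]

end Points

/-! ### Rotationally invariant vertices -/

section

variable {C : Type u} [Category.{v} C] [Preadditive C] [Linear ℂ C] [MonoidalCategory C]
  [MonoidalPreadditive C] [MonoidalLinear ℂ C] [SymmetricCategory C] {X : C}

/-- `s` is symmetric and `τ` is rotationally invariant and commutative up to the sign `σ`. -/
structure IsRotational (s : SelfDuality X) (τ : X ⊗ X ⟶ X) (σ : ℂ) : Prop where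
  symm : s.IsSymmetric
  comm : (β_ X X).hom ≫ τ = σ • τ
  rot : τ ▷ X ≫ s.cap = (α_ X X X).hom ≫ X ◁ τ ≫ s.cap

variable {s : SelfDuality X} {τ : X ⊗ X ⟶ X} {σ : ℂ} (E : Points.{v} C)

/-- A point `ω` of `X ⊗ X` need not be a sum of pure tensors. The identity is therefore proved for
morphisms, where pure tensors suffice, and then evaluated at `ω`. The other contraction lemmas
follow the same pattern. -/
theorem contract_braiding (ω : E.obj (X ⊗ X)) (z w : E.obj X) :
    E.map s.cap (E.pair (E.contract s (E.map (β_ X X).hom ω) z) w) =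
      E.map s.cap (E.pair (E.contract s ω w) z) := by
  let k : ((X ⊗ X) ⊗ X) ⊗ X ⟶ 𝟙_ C :=
    ((α_ X X X).hom ≫ X ◁ s.cap ≫ (ρ_ X).hom) ▷ X ≫ s.cap
  have hk : ((β_ X X).hom ▷ X) ▷ X ≫ k =
      (α_ _ _ _).hom ≫ (X ⊗ X) ◁ (β_ X X).hom ≫ (α_ _ _ _).inv ≫ k :=
    Points.hom_ext₄ fun E p q z w => by simp [k, mul_comm]
  have := congrArg (fun f => E.map f (E.pair (E.pair ω z) w)) hk
  simpa only [k, Points.contract, Points.map_comp, Points.map_whiskerRight,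
    Points.map_whiskerLeft, Points.map_associator, Points.map_associator_inv, Points.map_braiding] using this

namespace IsRotational

variable (h : IsRotational s τ σ)
include h

theorem dot_comm (x y : E.obj X) : E.map s.cap (E.pair x y) = E.map s.cap (E.pair y x) := by
  conv_lhs => rw [← h.symm, E.map_comp, E.map_braiding]

theorem mul_comm (x y : E.obj X) : E.map τ (E.pair y x) = σ • E.map τ (E.pair x y) := by
  have := congrArg (fun f => E.map f (E.pair x y)) h.comm
  simpa using this

theorem dot_mul (x y z : E.obj X) : E.map s.cap (E.pair (E.map τ (E.pair x y)) z) =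
    E.map s.cap (E.pair x (E.map τ (E.pair y z))) := by
  have := congrArg (fun f => E.map f (E.pair (E.pair x y) z)) h.rot
  simpa using this

/-- If `p ⊗ q` stands for the copairing, the left side is `⟨q y, z⟩ p = ⟨q, y z⟩ p`, and the zigzag
identity returns `y z`. -/
theorem contract_comul (y z : E.obj X) :
    E.contract s (E.map (s.comul τ) y) z = E.map τ (E.pair y z) := by
  have hk : ((α_ X X X).hom ≫ X ◁ τ) ▷ X ≫ (α_ X X X).hom ≫ X ◁ s.cap ≫ (ρ_ X).hom =
      (α_ _ _ _).hom ≫ (X ⊗ X) ◁ τ ≫ (α_ X X X).hom ≫ X ◁ s.cap ≫ (ρ_ X).hom :=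
    Points.hom_ext₄ fun E p q y z => by simp [h.dot_mul]
  have := congrArg (fun f => E.map f (E.pair (E.pair (E.map s.cup 1) y) z)) hk
  have h' := E.contract_cup s (E.map τ (E.pair y z))
  simp only [Points.contract] at h' ⊢
  rw [← h', SelfDuality.comul]
  simpa only [Points.map_leftUnitor_inv, Points.map_comp, Points.map_whiskerRight,
    Points.map_whiskerLeft, Points.map_associator, Points.map_associator_inv, Points.map_braiding] using this

/-- `τ ▷ X` on the first leg, under a contraction of the last leg. -/
theorem contract_mul_left (x z : E.obj X) (ω : E.obj (X ⊗ X)) :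
    E.contract s (E.map (τ ▷ X) (E.map (α_ X X X).inv (E.pair x ω))) z =
      E.map τ (E.pair x (E.contract s ω z)) := by
  have hk : ((α_ X X X).inv ≫ τ ▷ X) ▷ X ≫ (α_ X X X).hom ≫ X ◁ s.cap ≫ (ρ_ X).hom =
      (α_ _ _ _).hom ≫ X ◁ ((α_ X X X).hom ≫ X ◁ s.cap ≫ (ρ_ X).hom) ≫ τ :=
    Points.hom_ext₁₃ fun E x p q z => by simp
  have := congrArg (fun f => E.map f (E.pair (E.pair x ω) z)) hk
  simpa only [Points.contract, Points.map_comp, Points.map_whiskerRight,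
    Points.map_whiskerLeft, Points.map_associator, Points.map_associator_inv, Points.map_braiding] using this

theorem contract_treeH (x y z : E.obj X) :
    E.contract s (E.map (s.treeH τ) (E.pair x y)) z =
      E.map τ (E.pair x (E.map τ (E.pair y z))) := by
  rw [SelfDuality.treeH, E.map_comp, E.map_comp, E.map_whiskerLeft, h.contract_mul_left,
    h.contract_comul]

theorem contract_treeH_map (ω : E.obj (X ⊗ X)) (z : E.obj X) :
    E.contract s (E.map (s.treeH τ) ω) z =
      E.map ((α_ X X X).hom ≫ X ◁ τ ≫ τ) (E.pair ω z) := by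
  have hk : s.bend (s.treeH τ) = (α_ X X X).hom ≫ X ◁ τ ≫ τ :=
    Points.hom_ext₃ fun E x y z => by simp [E.map_bend, h.contract_treeH]
  rw [← hk, E.map_bend]

theorem treeH_comp_cap : s.treeH τ ≫ s.cap = X ◁ (s.comul τ ≫ τ) ≫ s.cap := by
  rw [SelfDuality.treeH, Category.assoc, Category.assoc, h.rot]
  simp

/-- In box form the six diagrams become three products of pairings and three pairings of products,
one for each way of splitting four legs into two pairs. The action of permutations of the legs can
be read off from these forms. -/
theorem box_id (x y z w : E.obj X) :
    E.map (s.box (𝟙 (X ⊗ X))) (E.pair (E.pair (E.pair x y) z) w) =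
      E.map s.cap (E.pair x w) * E.map s.cap (E.pair y z) := by
  simp [E.map_box, _root_.mul_comm]

theorem box_braiding (x y z w : E.obj X) :
    E.map (s.box (β_ X X).hom) (E.pair (E.pair (E.pair x y) z) w) =
      E.map s.cap (E.pair x z) * E.map s.cap (E.pair y w) := by
  simp [E.map_box]

theorem box_cupCap (x y z w : E.obj X) :
    E.map (s.box (s.cap ≫ s.cup)) (E.pair (E.pair (E.pair x y) z) w) =
      E.map s.cap (E.pair x y) * E.map s.cap (E.pair z w) := by
  rw [E.map_box, E.map_comp, E.contract_cup_smul]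
  simp

theorem box_treeI (x y z w : E.obj X) :
    E.map (s.box (τ ≫ s.comul τ)) (E.pair (E.pair (E.pair x y) z) w) =
      E.map s.cap (E.pair (E.map τ (E.pair x y)) (E.map τ (E.pair z w))) := by
  rw [E.map_box, E.map_comp, h.contract_comul, h.dot_mul]

theorem box_treeH (x y z w : E.obj X) :
    E.map (s.box (s.treeH τ)) (E.pair (E.pair (E.pair x y) z) w) =
      E.map s.cap (E.pair (E.map τ (E.pair w x)) (E.map τ (E.pair y z))) := by
  rw [E.map_box, h.contract_treeH, h.dot_comm, h.dot_mul]

theorem box_treeX (x y z w : E.obj X) :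
    E.map (s.box (s.treeH τ ≫ (β_ X X).hom)) (E.pair (E.pair (E.pair x y) z) w) =
      E.map s.cap (E.pair (E.map τ (E.pair z x)) (E.map τ (E.pair y w))) := by
  rw [E.map_box, E.map_comp, contract_braiding, ← E.map_box, h.box_treeH]

end IsRotational

end

/-! ### Trivalent ribbon categories -/

namespace Trivalent

namespace IsTrivalentRibbon

variable {C : Type u} [Category.{v} C] [Preadditive C] [Linear ℂ C] [MonoidalCategory C]
  [MonoidalPreadditive C] [MonoidalLinear ℂ C] [SymmetricCategory C] [RightRigidCategory C]
  [RibbonCategory C] {X : C} {s : SelfDuality X} {τ : X ⊗ X ⟶ X}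
  (h : IsTrivalentRibbon s τ)
include h

theorem exists_eq_smul_id (f : X ⟶ X) : ∃ c : ℂ, f = c • 𝟙 X := by
  obtain ⟨c, hc, -⟩ := h.box_two (s.flat f)
  exact ⟨c, s.flat_injective (by rw [hc]; simp [SelfDuality.flat])⟩

theorem exists_eq_smul (f : X ⊗ X ⟶ X) : ∃ c : ℂ, f = c • τ := by
  obtain ⟨c, hc, -⟩ := h.box_three (s.flat f)
  exact ⟨c, s.flat_injective (by rw [hc]; simp [SelfDuality.flat])⟩

theorem eq_zero_of_unit (f : 𝟙_ C ⟶ X) : f = 0 := by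
  apply s.flat_injective
  rw [← cancel_epi (λ_ X).inv, h.box_one (_ ≫ s.flat f), h.box_one (_ ≫ s.flat 0)]

theorem smul_flat_inj {c c' : ℂ} (hc : c • s.flat τ = c' • s.flat τ) : c = c' :=
  (h.box_three (c • s.flat τ)).unique rfl hc

theorem smul_inj {c c' : ℂ} (hc : c • τ = c' • τ) : c = c' :=
  h.smul_flat_inj (by simpa [SelfDuality.flat] using congrArg s.flat hc)

theorem smul_cap_inj {c c' : ℂ} (hc : c • s.cap = c' • s.cap) : c = c' :=
  (h.box_two (c • s.cap)).unique rfl hc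

/-- The twist is a scalar `t`. Since the double braiding is trivial, naturality along `τ` gives `t =
t²`; and `t ≠ 0` because the twist is invertible while `τ ≠ 0`. -/
theorem twist_eq_id : (RibbonCategory.twist X).hom = 𝟙 X := by
  obtain ⟨t, ht⟩ := h.exists_eq_smul_id (RibbonCategory.twist X).hom
  have h₁ := RibbonCategory.twist_naturality τ
  rw [RibbonCategory.twist_tensor, SymmetricCategory.symmetry, ht] at h₁
  have h₂ : t = t * t := h.smul_inj (by simpa [smul_tensorHom, tensorHom_smul, smul_smul] using h₁)
  have h₃ : t ≠ 0 := by
    rintro rfl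
    have h₄ : 𝟙 X = 0 := by
      rw [← (RibbonCategory.twist X).hom_inv_id, ht, zero_smul, Limits.zero_comp]
    have h₅ : τ = 0 := by rw [← Category.comp_id τ, h₄, Limits.comp_zero]
    exact zero_ne_one (α := ℂ) (h.smul_inj (by rw [h₅, smul_zero, smul_zero]))
  have h₄ : t = 1 := mul_right_cancel₀ h₃ (h₂.symm.trans (one_mul t).symm)
  rw [ht, h₄, one_smul]

theorem exists_braiding_cap : ∃ ε : ℂ, ε * ε = 1 ∧ (β_ X X).hom ≫ s.cap = ε • s.cap := by
  obtain ⟨ε, hε, -⟩ := h.box_two ((β_ X X).hom ≫ s.cap)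
  refine ⟨ε, h.smul_cap_inj ?_, hε⟩
  have : s.cap = (β_ X X).hom ≫ (β_ X X).hom ≫ s.cap := by simp
  rw [hε, Linear.comp_smul, hε, smul_smul] at this
  rw [← this, one_smul]

/-- The three-box is an eigenvector of both transpositions, with the same sign. -/
theorem exists_sign : ∃ σ : ℂ, σ * σ = 1 ∧ (β_ X X).hom ▷ X ≫ s.flat τ = σ • s.flat τ ∧
    (α_ X X X).hom ≫ X ◁ (β_ X X).hom ≫ (α_ X X X).inv ≫ s.flat τ = σ • s.flat τ := by
  obtain ⟨σ, hσ, -⟩ := h.box_three ((β_ X X).hom ▷ X ≫ s.flat τ)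
  obtain ⟨σ', hσ', -⟩ := h.box_three
    ((α_ X X X).hom ≫ X ◁ (β_ X X).hom ≫ (α_ X X X).inv ≫ s.flat τ)
  change _ = σ • s.flat τ at hσ
  change _ = σ' • s.flat τ at hσ'
  let a : (X ⊗ X) ⊗ X ⟶ (X ⊗ X) ⊗ X := (β_ X X).hom ▷ X
  let b : (X ⊗ X) ⊗ X ⟶ (X ⊗ X) ⊗ X := (α_ X X X).hom ≫ X ◁ (β_ X X).hom ≫ (α_ X X X).inv
  have ha : a ≫ s.flat τ = σ • s.flat τ := hσ
  have hb : b ≫ s.flat τ = σ' • s.flat τ := by simpa [b] using hσ'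
  have haa : a ≫ a ≫ s.flat τ = s.flat τ := by
    simp only [a, ← Category.assoc, ← comp_whiskerRight]
    simp
  have hbb : b ≫ b ≫ s.flat τ = s.flat τ := Points.hom_ext₃ fun E x y z => by simp [b]
  have hab : a ≫ b ≫ a ≫ s.flat τ = b ≫ a ≫ b ≫ s.flat τ :=
    Points.hom_ext₃ fun E x y z => by simp [a, b]
  simp only [ha, hb, Linear.comp_smul, smul_smul] at haa hbb hab
  have e₁ : σ * σ = 1 := h.smul_flat_inj (by rw [haa, one_smul])
  have e₂ : σ' * σ' = 1 := h.smul_flat_inj (by rw [hbb, one_smul])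
  have e₃ := h.smul_flat_inj hab
  -- The braid relation `aba = bab` compares `σ²σ'` with `σσ'²`, and both squares are 1.
  have e : σ' = σ := by linear_combination σ * e₂ - σ' * e₁ + e₃
  exact ⟨σ, e₁, hσ, e ▸ hσ'⟩

/-- The pairing is symmetric: the bigon is a symmetric bilinear form. -/
theorem isSymmetric : s.IsSymmetric := by
  obtain ⟨ε, hε, hcap⟩ := h.exists_braiding_cap
  obtain ⟨σ, hσ, h₁₂, h₂₃⟩ := h.exists_sign
  obtain ⟨b, hb, hbigon⟩ := h.bigon_ne_zero
  have dot : ∀ (E : Points.{v} C) (x y : E.obj X),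
      E.map s.cap (E.pair y x) = ε • E.map s.cap (E.pair x y) := fun E x y => by
    simpa using congrArg (fun f => E.map f (E.pair x y)) hcap
  have t₁₂ : ∀ (E : Points.{v} C) (x y z : E.obj X),
      E.map s.cap (E.pair (E.map τ (E.pair y x)) z) =
        σ • E.map s.cap (E.pair (E.map τ (E.pair x y)) z) := fun E x y z => by
    simpa [SelfDuality.flat] using congrArg (fun f => E.map f (E.pair (E.pair x y) z)) h₁₂
  have t₂₃ : ∀ (E : Points.{v} C) (x y z : E.obj X),
      E.map s.cap (E.pair (E.map τ (E.pair x z)) y) =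
        σ • E.map s.cap (E.pair (E.map τ (E.pair x y)) z) := fun E x y z => by
    simpa [SelfDuality.flat] using congrArg (fun f => E.map f (E.pair (E.pair x y) z)) h₂₃
  -- On elements this is `⟨p (q x), y⟩`. When `p ⊗ q` is the copairing it becomes the bigon form `b
  -- ⟨x, y⟩`.
  let k : ((X ⊗ X) ⊗ X) ⊗ X ⟶ 𝟙_ C := ((α_ X X X).hom ≫ X ◁ τ ≫ τ) ▷ X ≫ s.cap
  have hk : ((β_ X X).hom ▷ X) ▷ X ≫
      (α_ _ _ _).hom ≫ (X ⊗ X) ◁ (β_ X X).hom ≫ (α_ _ _ _).inv ≫ k = ε • k := by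
    refine Points.hom_ext₄ fun E p q x y => ?_
    simp only [k, map_smul, LinearMap.smul_apply, Points.map_comp, Points.map_whiskerRight,
    Points.map_whiskerLeft, Points.map_associator, Points.map_associator_inv, Points.map_braiding]
    rw [t₂₃ E q x, t₂₃ E p y, dot E (E.map τ (E.pair q x)), smul_smul, smul_smul]
    congr 1
    linear_combination (-σ) * hε
  -- Exchanging both `p, q` and `x, y` in `k` costs `ε`, and exchanging `p, q` in the copairing
  -- costs `ε` again. The two cancel, so the bigon form is symmetric.
  have hcup : s.cup ≫ (β_ X X).hom = ε • s.cup := by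
    refine s.box_injective (Points.hom_ext₃ fun E r z w => ?_)
    rw [E.map_box, E.map_comp, contract_braiding, E.contract_cup_smul, E.map_box,
      LinearMap.map_smul, LinearMap.smul_apply, E.contract_smul, E.contract_cup_smul]
    simp [dot E z w]
  refine Points.hom_ext₂ fun E x y => ?_
  have hx : ∀ x : E.obj X,
      E.map τ (E.map (X ◁ τ) (E.map (α_ X X X).hom (E.pair (E.map s.cup 1) x))) = b • x :=
    fun x => by simpa [bigonValue] using congrArg (fun f => E.map f x) hbigon
  have hΩ : E.map (β_ X X).hom (E.map s.cup 1) = ε • E.map s.cup 1 := by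
    rw [← E.map_comp, hcup, LinearMap.map_smul, LinearMap.smul_apply]
  have := congrArg (fun f => E.map f (E.pair (E.pair (E.map s.cup 1) x) y)) hk
  simp only [k, Points.map_comp, Points.map_whiskerRight,
    Points.map_whiskerLeft, Points.map_associator, Points.map_associator_inv, Points.map_braiding, map_smul,
    LinearMap.smul_apply, hΩ, hx, smul_smul] at this
  rw [E.map_comp, E.map_braiding]
  have hε₀ : ε ≠ 0 := by rintro rfl; simp at hε
  exact smul_right_injective _ (mul_ne_zero hε₀ hb) this

/-- A rotation is a product of two transpositions of the three legs, so it acts on the three-box by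
`σ² = 1`; symmetry of the pairing turns this into `⟨xy, z⟩ = ⟨x, yz⟩`. -/
theorem exists_isRotational : ∃ σ : ℂ, σ * σ = 1 ∧ IsRotational s τ σ := by
  obtain ⟨σ, hσ, h₁₂, h₂₃⟩ := h.exists_sign
  have dot : ∀ (E : Points.{v} C) (x y : E.obj X),
      E.map s.cap (E.pair y x) = E.map s.cap (E.pair x y) := fun E x y => by
    simpa using congrArg (fun f => E.map f (E.pair x y)) h.isSymmetric
  have comm : (β_ X X).hom ≫ τ = σ • τ :=
    s.flat_injective (by simpa [SelfDuality.flat] using h₁₂)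
  have mul : ∀ (E : Points.{v} C) (x y : E.obj X),
      E.map τ (E.pair y x) = σ • E.map τ (E.pair x y) := fun E x y => by
    simpa using congrArg (fun f => E.map f (E.pair x y)) comm
  have t₂₃ : ∀ (E : Points.{v} C) (x y z : E.obj X),
      E.map s.cap (E.pair (E.map τ (E.pair x z)) y) =
        σ • E.map s.cap (E.pair (E.map τ (E.pair x y)) z) := fun E x y z => by
    simpa [SelfDuality.flat] using congrArg (fun f => E.map f (E.pair (E.pair x y) z)) h₂₃
  refine ⟨σ, hσ, h.isSymmetric, comm, Points.hom_ext₃ fun E x y z => ?_⟩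
  simp only [Points.map_comp, Points.map_whiskerRight, Points.map_whiskerLeft,
    Points.map_associator]
  rw [dot E (E.map τ (E.pair y z)), t₂₃ E y x z, mul E x y]
  simp [smul_smul, hσ]

theorem comul_comp_cap : s.comul τ ≫ s.cap = 0 := h.box_one _

theorem cup_comp_mul : s.cup ≫ τ = 0 := h.eq_zero_of_unit _

theorem exists_bigon : ∃ b : ℂ, b ≠ 0 ∧ s.comul τ ≫ τ = b • 𝟙 X := by
  obtain ⟨b, hb, hbigon⟩ := h.bigon_ne_zero
  exact ⟨b, hb, by rw [← hbigon, SelfDuality.comul, bigonValue]; simp⟩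

theorem cup_comp_cap {d : ℂ} (hd : circleValue s = d • 𝟙 (𝟙_ C)) : s.cup ≫ s.cap = d • 𝟙 _ := by
  rw [← hd, circleValue, h.twist_eq_id, h.isSymmetric]
  simp

end IsTrivalentRibbon
end Trivalent

/-! ### Relations between diagrams with four legs -/

section

variable {C : Type u} [Category.{v} C] [Preadditive C] [Linear ℂ C] [MonoidalCategory C]
  [MonoidalPreadditive C] [MonoidalLinear ℂ C] [SymmetricCategory C] {X : C}

/-- A rotationally invariant vertex whose circle, bigon, triangle and lollipop have been
evaluated. -/
structure IsEvaluated (s : SelfDuality X) (τ : X ⊗ X ⟶ X) (σ d b t : ℂ) : Prop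
    extends IsRotational s τ σ where
  sign : σ * σ = 1
  circle : s.cup ≫ s.cap = d • 𝟙 (𝟙_ C)
  lollipop : s.cup ≫ τ = 0
  comul_cap : s.comul τ ≫ s.cap = 0
  bigon : s.comul τ ≫ τ = b • 𝟙 X
  triangle : s.treeH τ ≫ τ = t • τ

/-- A linear combination of the diagrams with four legs and at most two vertices. -/
def fourLegs (s : SelfDuality X) (τ : X ⊗ X ⟶ X) (u i p v h k : ℂ) : X ⊗ X ⟶ X ⊗ X :=
  u • (s.cap ≫ s.cup) + i • 𝟙 (X ⊗ X) + p • (β_ X X).hom + v • (τ ≫ s.comul τ) +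
    h • s.treeH τ + k • (s.treeH τ ≫ (β_ X X).hom)

section

variable {s : SelfDuality X} {τ : X ⊗ X ⟶ X} {u i p v h k u' i' p' v' h' k' : ℂ}

theorem fourLegs_add : fourLegs s τ u i p v h k + fourLegs s τ u' i' p' v' h' k' =
    fourLegs s τ (u + u') (i + i') (p + p') (v + v') (h + h') (k + k') := by
  simp only [fourLegs]; module

theorem fourLegs_smul (c : ℂ) : c • fourLegs s τ u i p v h k =
    fourLegs s τ (c * u) (c * i) (c * p) (c * v) (c * h) (c * k) := by
  simp only [fourLegs]; module

theorem fourLegs_add_eq_zero (e : fourLegs s τ u i p v h k = 0)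
    (e' : fourLegs s τ u' i' p' v' h' k' = 0) :
    fourLegs s τ (u + u') (i + i') (p + p') (v + v') (h + h') (k + k') = 0 := by
  rw [← fourLegs_add, e, e', add_zero]

theorem fourLegs_smul_eq_zero (c : ℂ) (e : fourLegs s τ u i p v h k = 0) :
    fourLegs s τ (c * u) (c * i) (c * p) (c * v) (c * h) (c * k) = 0 := by
  rw [← fourLegs_smul, e, smul_zero]

end

namespace IsRotational

variable {s : SelfDuality X} {τ : X ⊗ X ⟶ X} {σ : ℂ} (H : IsRotational s τ σ)
  {u i p v h k : ℂ}
include H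

theorem box_fourLegs (E : Points.{v} C) (x y z w : E.obj X) :
    E.map (s.box (fourLegs s τ u i p v h k)) (E.pair (E.pair (E.pair x y) z) w) =
      u • (E.map s.cap (E.pair x y) * E.map s.cap (E.pair z w)) +
      i • (E.map s.cap (E.pair x w) * E.map s.cap (E.pair y z)) +
      p • (E.map s.cap (E.pair x z) * E.map s.cap (E.pair y w)) +
      v • E.map s.cap (E.pair (E.map τ (E.pair x y)) (E.map τ (E.pair z w))) +
      h • E.map s.cap (E.pair (E.map τ (E.pair w x)) (E.map τ (E.pair y z))) +
      k • E.map s.cap (E.pair (E.map τ (E.pair z x)) (E.map τ (E.pair y w))) := by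
  change E.map (s.boxₗ _ (fourLegs s τ u i p v h k)) _ = _
  simp only [fourLegs, map_add, LinearMap.map_smul, LinearMap.add_apply, LinearMap.smul_apply]
  simp only [SelfDuality.boxₗ, LinearMap.coe_mk, AddHom.coe_mk, H.box_id, H.box_braiding,
    H.box_cupCap, H.box_treeI, H.box_treeH, H.box_treeX]

/-- A quarter turn exchanges `U` with `id` and `I` with `H`. -/
theorem box_fourLegs_rotate (E : Points.{v} C) (x y z w : E.obj X) :
    E.map (s.box (fourLegs s τ u i p v h k)) (E.pair (E.pair (E.pair y z) w) x) =
      E.map (s.box (fourLegs s τ i u p h v (σ * k))) (E.pair (E.pair (E.pair x y) z) w) := by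
  have e₁ : E.map s.cap (E.pair (E.map τ (E.pair w y)) (E.map τ (E.pair z x))) =
      σ • E.map s.cap (E.pair (E.map τ (E.pair z x)) (E.map τ (E.pair y w))) := by
    rw [H.dot_comm E, H.mul_comm E y w]
    simp
  rw [H.box_fourLegs, H.box_fourLegs, e₁,
    H.dot_comm E (E.map τ (E.pair y z)) (E.map τ (E.pair w x)), H.dot_comm E y x,
    H.dot_comm E w x, H.dot_comm E z x, _root_.mul_comm (E.map s.cap (E.pair y z)),
    _root_.mul_comm (E.map s.cap (E.pair y w))]
  module

/-- Together with `fourLegs_swap` this lets the permutations of the three pairings of four legs act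
on relations. The composite of the two is a 3-cycle on `U, id, P`, and on `I, H, K` up to signs. -/
theorem fourLegs_rotate (e : fourLegs s τ u i p v h k = 0) :
    fourLegs s τ i u p h v (σ * k) = 0 := by
  refine s.box_injective (Points.hom_ext₄ fun E x y z w => ?_)
  rw [← H.box_fourLegs_rotate, e]
  change E.map (s.boxₗ _ 0) _ = E.map (s.boxₗ _ 0) _
  simp

theorem comul_braiding : s.comul τ ≫ (β_ X X).hom = σ • s.comul τ := by
  refine s.box_injective (Points.hom_ext₃ fun E x z w => ?_)
  rw [E.map_box, E.map_comp, contract_braiding, E.map_box, LinearMap.map_smul,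
    LinearMap.smul_apply, E.contract_smul, H.contract_comul, H.contract_comul, H.dot_mul,
    H.mul_comm E z w, map_smul, map_smul, map_smul, LinearMap.smul_apply, ← H.dot_mul,
    LinearMap.map_smul]

theorem cup_braiding : s.cup ≫ (β_ X X).hom = s.cup := by
  refine s.box_injective (Points.hom_ext₃ fun E r z w => ?_)
  rw [E.map_box, E.map_comp, contract_braiding, E.contract_cup_smul, E.map_box,
    E.contract_cup_smul]
  simp [H.dot_comm E z w]

theorem fourLegs_braiding :
    fourLegs s τ u i p v h k ≫ (β_ X X).hom = fourLegs s τ u p i (σ * v) k h := by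
  simp only [fourLegs, Preadditive.add_comp, Linear.smul_comp, Category.assoc, H.cup_braiding,
    H.comul_braiding, SymmetricCategory.symmetry, Category.id_comp, Category.comp_id,
    Linear.comp_smul]
  module

theorem fourLegs_swap (e : fourLegs s τ u i p v h k = 0) :
    fourLegs s τ u p i (σ * v) k h = 0 := by
  rw [← H.fourLegs_braiding, e, Limits.zero_comp]

end IsRotational

namespace IsEvaluated

variable {s : SelfDuality X} {τ : X ⊗ X ⟶ X} {σ d b t : ℂ} (H : IsEvaluated s τ σ d b t)
  {u i p v h k : ℂ}
include H

theorem treeH_cap : s.treeH τ ≫ s.cap = b • s.cap := by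
  rw [H.treeH_comp_cap, H.bigon]
  simp

theorem fourLegs_mul : fourLegs s τ u i p v h k ≫ τ = (i + σ * p + b * v + t * h + σ * t * k) • τ := by
  simp only [fourLegs, Preadditive.add_comp, Linear.smul_comp, Category.assoc, H.lollipop,
    H.bigon, H.triangle, H.comm, Category.id_comp, Linear.comp_smul, Category.comp_id,
    Limits.comp_zero]
  module

theorem fourLegs_cap : fourLegs s τ u i p v h k ≫ s.cap = (d * u + i + p + b * h + b * k) • s.cap := by
  have hs := H.symm
  rw [SelfDuality.IsSymmetric] at hs
  simp only [fourLegs, Preadditive.add_comp, Linear.smul_comp, Category.assoc, H.circle,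
    H.comul_cap, H.treeH_cap, hs, Category.id_comp, Linear.comp_smul, Category.comp_id,
    Limits.comp_zero]
  module

end IsEvaluated

end

/-! ### Commutative vertices: the relation of `Sym` or of `F4`. -/

section

variable {C : Type u} [Category.{v} C] [Preadditive C] [Linear ℂ C] [MonoidalCategory C]
  [MonoidalPreadditive C] [MonoidalLinear ℂ C] [SymmetricCategory C] {X : C}
  {s : SelfDuality X} {τ : X ⊗ X ⟶ X}

theorem fourLegs_congr {u i p v h k u' i' p' v' h' k' : ℂ} (e : fourLegs s τ u i p v h k = 0)
    (hu : u = u') (hi : i = i') (hp : p = p') (hv : v = v') (hh : h = h') (hk : k = k') :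
    fourLegs s τ u' i' p' v' h' k' = 0 := by
  rw [← hu, ← hi, ← hp, ← hv, ← hh, ← hk, e]

namespace IsEvaluated

variable {σ d b t : ℂ} {u i p v h k : ℂ}

/-- Closing the two upper legs of a relation with `τ`, or with the cap as in `coeff_cap`, leaves a
scalar multiple of a non-zero diagram, hence a linear equation for the coefficients. -/
theorem coeff_mul (H : IsEvaluated s τ σ d b t) (hτ : τ ≠ 0)
    (e : fourLegs s τ u i p v h k = 0) : i + σ * p + b * v + t * h + σ * t * k = 0 := by
  have := H.fourLegs_mul (u := u) (i := i) (p := p) (v := v) (h := h) (k := k)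
  rw [e, Limits.zero_comp] at this
  exact (smul_eq_zero.1 this.symm).resolve_right hτ

theorem coeff_cap (H : IsEvaluated s τ σ d b t) (hc : s.cap ≠ 0)
    (e : fourLegs s τ u i p v h k = 0) : d * u + i + p + b * h + b * k = 0 := by
  have := H.fourLegs_cap (u := u) (i := i) (p := p) (v := v) (h := h) (k := k)
  rw [e, Limits.zero_comp] at this
  exact (smul_eq_zero.1 this.symm).resolve_right hc

/-- The relation of `Sym`, up to rescaling. -/
def SymRelation (s : SelfDuality X) (τ : X ⊗ X ⟶ X) : Prop :=
  ∃ x : ℂ, fourLegs s τ x (-x) 0 1 (-1) 0 = 0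

/-- The relation of `F4`, up to rescaling. -/
def F4Relation (s : SelfDuality X) (τ : X ⊗ X ⟶ X) : Prop :=
  ∃ x : ℂ, fourLegs s τ (-x) (-x) (-x) 1 1 1 = 0

/-- The relation of `G2`, up to rescaling. -/
def G2Relation (s : SelfDuality X) (τ : X ⊗ X ⟶ X) : Prop :=
  ∃ x : ℂ, fourLegs s τ x x (-2 * x) 1 1 0 = 0

/-- Subtracting the quarter turn cancels `P` and `K` and antisymmetrizes the pairs `U, id` and `I,
H`. -/
theorem symRelation_of_ne (H : IsEvaluated s τ 1 d b t) (e : fourLegs s τ u i p v h k = 0)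
    (hvh : v ≠ h) : SymRelation s τ := by
  have e₁ := fourLegs_add_eq_zero e (fourLegs_smul_eq_zero (-1) (H.fourLegs_rotate e))
  have hne : v - h ≠ 0 := sub_ne_zero.2 hvh
  refine ⟨(u - i) / (v - h), fourLegs_congr (fourLegs_smul_eq_zero (v - h)⁻¹ e₁) ?_ ?_ ?_ ?_ ?_ ?_⟩
  all_goals field_simp
  all_goals ring

/-- The sum over the 3-cycle has the `F4` shape unless `v + h + k = 0`. In that case either two of
the tree coefficients differ, which gives `Sym`, or no trees occur; a relation among `U, id, P`
alone is trivial. -/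
theorem symRelation_or_f4Relation (H : IsEvaluated s τ 1 d b t) (hτ : τ ≠ 0)
    (e : fourLegs s τ u i p v h k = 0)
    (hne : ¬ (u = 0 ∧ i = 0 ∧ p = 0 ∧ v = 0 ∧ h = 0 ∧ k = 0)) :
    SymRelation s τ ∨ F4Relation s τ := by
  have e₁ := H.fourLegs_rotate (H.fourLegs_swap e)
  have e₂ := H.fourLegs_rotate (H.fourLegs_swap e₁)
  have e₃ := fourLegs_add_eq_zero (fourLegs_add_eq_zero e e₁) e₂
  by_cases hs' : v + h + k = 0
  -- Closing the cyclic sum with `τ` gives `2 (u + i + p) + (b + 2t)(v + h + k) = 0`.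
  · have hs : u + i + p = 0 := by
      linear_combination (1 / 2 : ℂ) * H.coeff_mul hτ e₃ - (b / 2 + t) * hs'
    left
    by_cases hvh : v = h
    · by_cases hhk : h = k
      · have hv : v = 0 := by linear_combination (1 / 3 : ℂ) * (hs' + 2 * hvh + hhk)
        have hh : h = 0 := hvh ▸ hv
        have hk : k = 0 := hhk ▸ hh
        subst hv hh hk
        -- Without trees, the antisymmetrized relations close up with `τ` to differences of two of
        -- `u, i, p`; as these vanish along with the sum, all three are zero.
        have f₁ := fourLegs_add_eq_zero e (fourLegs_smul_eq_zero (-1) (H.fourLegs_rotate e))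
        have f₂ := fourLegs_add_eq_zero e₁ (fourLegs_smul_eq_zero (-1) (H.fourLegs_rotate e₁))
        have c₁ := H.coeff_mul hτ f₁
        have c₂ := H.coeff_mul hτ f₂
        refine (hne ⟨?_, ?_, ?_, rfl, rfl, rfl⟩).elim
        · linear_combination (1 / 3 : ℂ) * (hs - c₁ + c₂)
        · linear_combination (1 / 3 : ℂ) * (hs + 2 * c₁ + c₂)
        · linear_combination (1 / 3 : ℂ) * (hs - c₁ - 2 * c₂)
      · exact H.symRelation_of_ne e₂ (by simpa using hhk)
    · exact H.symRelation_of_ne e hvh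
  · right
    refine ⟨-(u + i + p) / (v + h + k),
      fourLegs_congr (fourLegs_smul_eq_zero (v + h + k)⁻¹ e₃) ?_ ?_ ?_ ?_ ?_ ?_⟩
    all_goals field_simp
    all_goals ring

end IsEvaluated

end

/-! ### Anticommutative vertices: the relation of `G2` or only Jacobi. -/

section

variable {C : Type u} [Category.{v} C] [Preadditive C] [Linear ℂ C] [MonoidalCategory C]
  [MonoidalPreadditive C] [MonoidalLinear ℂ C] [SymmetricCategory C] {X : C}
  {s : SelfDuality X} {τ : X ⊗ X ⟶ X}

namespace IsEvaluated

variable {d b t : ℂ} {u i p v h k : ℂ}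

/-- Stacking `H` onto `U + id + P = 0` gives `b U + H + K = 0`. Adding its quarter turn cancels `K`,
and subtracting `2b/3` times the original relation gives the required coefficients of `U, id, P`. -/
theorem g2Relation_of_sum_eq_zero (H : IsEvaluated s τ (-1) d b t)
    (e : fourLegs s τ 1 1 1 0 0 0 = 0) : G2Relation s τ := by
  have e₁ : fourLegs s τ b 0 0 0 1 1 = 0 := by
    have := congrArg (fun f => s.treeH τ ≫ f) e
    simp only [fourLegs, zero_smul, add_zero, one_smul, Preadditive.comp_add, Category.comp_id,
      Limits.comp_zero, ← Category.assoc, H.treeH_cap, Linear.smul_comp] at this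
    rw [← this]
    simp only [fourLegs]
    module
  refine ⟨b / 3, fourLegs_congr (fourLegs_add_eq_zero
    (fourLegs_add_eq_zero e₁ (H.fourLegs_rotate e₁)) (fourLegs_smul_eq_zero (-2 * b / 3) e))
    ?_ ?_ ?_ ?_ ?_ ?_⟩
  all_goals ring

/-- Adding the quarter turn cancels `K`, because `σ = -1`, and equalizes the coefficients in the
pairs `U, id` and `I, H`. -/
theorem g2Relation_of_add_ne (H : IsEvaluated s τ (-1) d b t)
    (e : fourLegs s τ u i p v h k = 0) (hs : u + i + p = 0) (hvh : v + h ≠ 0) :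
    G2Relation s τ := by
  have e₁ := fourLegs_add_eq_zero e (H.fourLegs_rotate e)
  refine ⟨-p / (v + h), fourLegs_congr (fourLegs_smul_eq_zero (v + h)⁻¹ e₁) ?_ ?_ ?_ ?_ ?_ ?_⟩
  · field_simp
    linear_combination hs
  · field_simp
    linear_combination hs
  all_goals field_simp
  all_goals ring

/-- The relation plus its quarter turn, closed with `τ`, reads `u + i - 2p + (b + t)(v + h) = 0`;
under the hypotheses this is `-3p = 0`. -/
theorem eq_zero_of_add_eq_zero (H : IsEvaluated s τ (-1) d b t) (hτ : τ ≠ 0)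
    (e : fourLegs s τ u i p v h k = 0) (hs : u + i + p = 0) (hvh : v + h = 0) : p = 0 := by
  have c := H.coeff_mul hτ (fourLegs_add_eq_zero e (H.fourLegs_rotate e))
  linear_combination (-1 / 3 : ℂ) * c + (1 / 3 : ℂ) * (hs + (b + t) * hvh)

/-- For an antisymmetric vertex that does not satisfy the relation of `G2`, every relation is a
multiple of the Jacobi relation. -/
theorem g2Relation_or_jacobi (H : IsEvaluated s τ (-1) d b t) (hτ : τ ≠ 0)
    (e : fourLegs s τ u i p v h k = 0) :
    G2Relation s τ ∨ (u = 0 ∧ i = 0 ∧ p = 0 ∧ h = -v ∧ k = v) := by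
  have e₁ := H.fourLegs_rotate (H.fourLegs_swap e)
  have e₂ := H.fourLegs_rotate (H.fourLegs_swap e₁)
  by_cases hs : u + i + p = 0
  · by_cases h₀ : v + h = 0
    · by_cases h₁ : k + -1 * v = 0
      · have hp := H.eq_zero_of_add_eq_zero hτ e hs h₀
        have hi := H.eq_zero_of_add_eq_zero hτ e₁ (by linear_combination hs) h₁
        right
        refine ⟨?_, hi, hp, ?_, ?_⟩
        · linear_combination hs - hi - hp
        · linear_combination h₀
        · linear_combination h₁
      · exact .inl (H.g2Relation_of_add_ne e₁ (by linear_combination hs) h₁)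
    · exact .inl (H.g2Relation_of_add_ne e hs h₀)
  · left
    have e₃ := fourLegs_add_eq_zero (fourLegs_add_eq_zero e e₁) e₂
    -- The cyclic sum is a multiple of `U + id + P` plus a multiple of `I - H + K`. A quarter turn
    -- fixes the former and negates the latter, so only `U + id + P` survives.
    have e₄ := fourLegs_add_eq_zero e₃ (H.fourLegs_rotate e₃)
    refine H.g2Relation_of_sum_eq_zero
      (fourLegs_congr (fourLegs_smul_eq_zero (2 * (u + i + p))⁻¹ e₄) ?_ ?_ ?_ ?_ ?_ ?_)
    all_goals field_simp
    all_goals ring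

end IsEvaluated

end

/-! ### The dimension bound, the square, and the exceptional relation. -/

section

variable {C : Type u} [Category.{v} C] [Preadditive C] [Linear ℂ C] [MonoidalCategory C]
  [MonoidalPreadditive C] [MonoidalLinear ℂ C] [SymmetricCategory C] {X : C}
  {s : SelfDuality X} {τ : X ⊗ X ⟶ X}

/-- Bending strands embeds the endomorphisms of `X ⊗ X` into the four-box space, which cannot hold
six independent vectors. -/
theorem SelfDuality.exists_linear_relation (s : SelfDuality X)
    (h4 : Module.rank ℂ (((X ⊗ X) ⊗ X) ⊗ X ⟶ 𝟙_ C) ≤ 5) (f : Fin 6 → (X ⊗ X ⟶ X ⊗ X)) :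
    ∃ g : Fin 6 → ℂ, ∑ j, g j • f j = 0 ∧ ∃ j, g j ≠ 0 := by
  refine Fintype.not_linearIndependent_iff.1 fun hf => ?_
  have hle := (hf.map' (s.boxₗ (X ⊗ X))
    (LinearMap.ker_eq_bot.2 (s.boxₗ_injective _))).cardinal_lift_le_rank
  have := hle.trans (Cardinal.lift_le.2 h4)
  simp only [Cardinal.mk_fintype, Fintype.card_fin, Cardinal.lift_natCast,
    Cardinal.lift_ofNat] at this
  exact absurd this (by norm_num)

theorem Points.hom_ext₅ {A₁ A₂ A₃ A₄ A₅ W : C} {f g : (((A₁ ⊗ A₂) ⊗ A₃) ⊗ A₄) ⊗ A₅ ⟶ W}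
    (h : ∀ (E : Points.{v} C) (a₁ : E.obj A₁) (a₂ : E.obj A₂) (a₃ : E.obj A₃) (a₄ : E.obj A₄)
      (a₅ : E.obj A₅), E.map f (E.pair (E.pair (E.pair (E.pair a₁ a₂) a₃) a₄) a₅) =
        E.map g (E.pair (E.pair (E.pair (E.pair a₁ a₂) a₃) a₄) a₅)) : f = g := by
  refine (((((generic A₁).tensor (generic A₂)).tensor (generic A₃)).tensor (generic A₄)).tensor
    (generic A₅)).hom_ext ?_
  rw [GenericPoint.tensor_x, GenericPoint.tensor_x, GenericPoint.tensor_x,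
    GenericPoint.tensor_x, GenericPoint.left_pair, GenericPoint.left_pair,
    GenericPoint.left_pair, GenericPoint.left_pair, GenericPoint.left_pair,
    GenericPoint.left_pair]
  exact h _ _ _ _ _ _

namespace IsRotational

variable {σ : ℂ}

theorem contract_mul_right (H : IsRotational s τ σ) (E : Points.{v} C) (ω : E.obj (X ⊗ X))
    (y z : E.obj X) :
    E.contract s (E.map (X ◁ τ) (E.map (α_ X X X).hom (E.pair ω y))) z =
      E.contract s ω (E.map τ (E.pair y z)) := by
  have hk : ((α_ X X X).hom ≫ X ◁ τ) ▷ X ≫ (α_ X X X).hom ≫ X ◁ s.cap ≫ (ρ_ X).hom =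
      (α_ _ _ _).hom ≫ (X ⊗ X) ◁ τ ≫ (α_ X X X).hom ≫ X ◁ s.cap ≫ (ρ_ X).hom :=
    Points.hom_ext₄ fun E p q y z => by simp [H.dot_mul]
  have := congrArg (fun f => E.map f (E.pair (E.pair ω y) z)) hk
  simpa only [Points.contract, Points.map_comp, Points.map_whiskerRight,
    Points.map_whiskerLeft, Points.map_associator] using this

theorem treeH_eq (H : IsRotational s τ σ) :
    s.treeH τ = s.comul τ ▷ X ≫ (α_ X X X).hom ≫ X ◁ τ := by
  refine s.bend_injective (Points.hom_ext₃ fun E y z w => ?_)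
  rw [E.map_bend, E.map_bend, H.contract_treeH, E.map_comp, E.map_comp, E.map_whiskerRight,
    H.contract_mul_right, H.contract_comul]

/-- The square is invariant under a quarter turn. -/
theorem box_square_rotate (H : IsRotational s τ σ) (E : Points.{v} C) (x y z w : E.obj X) :
    E.map (s.box (s.treeH τ ≫ s.treeH τ)) (E.pair (E.pair (E.pair y z) w) x) =
      E.map (s.box (s.treeH τ ≫ s.treeH τ)) (E.pair (E.pair (E.pair x y) z) w) := by
  let m : (X ⊗ X) ⊗ X ⟶ X := (α_ X X X).hom ≫ X ◁ τ ≫ τ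
  -- Let `p ⊗ q` stand for the comultiplication of `y`. The square is `⟨(xp)(qz), w⟩` on one side
  -- and, with the first `H` written as in `treeH_eq`, `⟨p((qz)w), x⟩` on the other; associativity
  -- and symmetry of the pairing identify them.
  have hk : (((α_ X X X).inv ≫ τ ▷ X) ▷ X ≫ m) ▷ X ≫ s.cap =
      (α_ _ _ _).hom ▷ X ≫ (α_ _ _ _).hom ≫ (β_ _ _).hom ≫
        (((α_ X X X).hom ≫ X ◁ τ) ▷ X ≫ m) ▷ X ≫ s.cap := by
    rw [← cancel_epi ((((α_ X X X).hom ▷ X) ▷ X))]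
    refine Points.hom_ext₅ fun E x p q z w => ?_
    simp only [m, Points.map_comp, Points.map_whiskerRight, Points.map_associator,
      Points.map_associator_inv, Points.map_whiskerLeft, Points.map_braiding]
    rw [H.dot_mul, H.dot_mul, H.dot_comm]
  rw [E.map_box, E.map_box, E.map_comp, E.map_comp, H.contract_treeH_map, H.contract_treeH_map]
  have := congrArg (fun f => E.map f (E.pair (E.pair (E.pair x (E.map (s.comul τ) y)) z) w)) hk
  simp only [Points.map_comp, Points.map_whiskerRight, Points.map_associator,
    Points.map_braiding] at this
  conv_rhs => rw [SelfDuality.treeH]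
  rw [H.treeH_eq]
  simp only [Points.map_comp, Points.map_whiskerRight, Points.map_whiskerLeft, m] at this ⊢
  exact this.symm
end IsRotational

namespace IsEvaluated

variable {d b t : ℂ}

theorem exists_relation (s : SelfDuality X) (τ : X ⊗ X ⟶ X)
    (h4 : Module.rank ℂ (((X ⊗ X) ⊗ X) ⊗ X ⟶ 𝟙_ C) ≤ 5) :
    ∃ u i p v h k : ℂ, fourLegs s τ u i p v h k = 0 ∧
      ¬ (u = 0 ∧ i = 0 ∧ p = 0 ∧ v = 0 ∧ h = 0 ∧ k = 0) := by
  obtain ⟨g, hg, j, hj⟩ := s.exists_linear_relation h4 ![s.cap ≫ s.cup, 𝟙 (X ⊗ X),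
    (β_ X X).hom, τ ≫ s.comul τ, s.treeH τ, s.treeH τ ≫ (β_ X X).hom]
  refine ⟨g 0, g 1, g 2, g 3, g 4, g 5, ?_, fun h => hj ?_⟩
  · simpa [Fin.sum_univ_six, fourLegs] using hg
  · obtain ⟨h₀, h₁, h₂, h₃, h₄, h₅⟩ := h
    fin_cases j <;> assumption

/-- In the exceptional case Jacobi already expresses `K` through `I` and `H`, so the square takes
its place as sixth diagram. -/
theorem exists_square_relation (s : SelfDuality X) (τ : X ⊗ X ⟶ X)
    (h4 : Module.rank ℂ (((X ⊗ X) ⊗ X) ⊗ X ⟶ 𝟙_ C) ≤ 5) :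
    ∃ u i p v h q : ℂ, fourLegs s τ u i p v h 0 + q • (s.treeH τ ≫ s.treeH τ) = 0 ∧
      ¬ (u = 0 ∧ i = 0 ∧ p = 0 ∧ v = 0 ∧ h = 0 ∧ q = 0) := by
  obtain ⟨g, hg, j, hj⟩ := s.exists_linear_relation h4 ![s.cap ≫ s.cup, 𝟙 (X ⊗ X),
    (β_ X X).hom, τ ≫ s.comul τ, s.treeH τ, s.treeH τ ≫ s.treeH τ]
  refine ⟨g 0, g 1, g 2, g 3, g 4, g 5, ?_, fun h => hj ?_⟩
  · simpa [Fin.sum_univ_six, fourLegs] using hg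
  · obtain ⟨h₀, h₁, h₂, h₃, h₄, h₅⟩ := h
    fin_cases j <;> assumption

theorem symRelation_or_f4Relation_of_rank_le (H : IsEvaluated s τ 1 d b t) (hτ : τ ≠ 0)
    (h4 : Module.rank ℂ (((X ⊗ X) ⊗ X) ⊗ X ⟶ 𝟙_ C) ≤ 5) :
    SymRelation s τ ∨ F4Relation s τ := by
  obtain ⟨u, i, p, v, h, k, e, hne⟩ := exists_relation s τ h4
  exact H.symRelation_or_f4Relation hτ e hne

theorem jacobi_of_rank_le (H : IsEvaluated s τ (-1) d b t) (hτ : τ ≠ 0)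
    (hG : ¬ G2Relation s τ) (h4 : Module.rank ℂ (((X ⊗ X) ⊗ X) ⊗ X ⟶ 𝟙_ C) ≤ 5) :
    fourLegs s τ 0 0 0 1 (-1) 1 = 0 := by
  obtain ⟨u, i, p, v, h, k, e, hne⟩ := exists_relation s τ h4
  obtain ⟨rfl, rfl, rfl, rfl, rfl⟩ := (H.g2Relation_or_jacobi hτ e).resolve_left hG
  have hv : k ≠ 0 := by
    rintro rfl
    simp at hne
  refine fourLegs_congr (fourLegs_smul_eq_zero k⁻¹ e) ?_ ?_ ?_ ?_ ?_ ?_ <;>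
    simp [hv]

/-- Once Jacobi is the only relation, every symmetry of the square that is expressed through smaller
diagrams determines coefficients of its expansion. -/
theorem exceptional_of_rank_le (H : IsEvaluated s τ (-1) d b t) (hτ : τ ≠ 0) (hc : s.cap ≠ 0)
    (hb : b ≠ 0) (hG : ¬ G2Relation s τ)
    (h4 : Module.rank ℂ (((X ⊗ X) ⊗ X) ⊗ X ⟶ 𝟙_ C) ≤ 5) :
    d + 2 ≠ 0 ∧ t = b / 2 ∧ s.treeH τ ≫ s.treeH τ =
      fourLegs s τ (5 / 6 * (b ^ 2 / (2 + d))) (5 / 6 * (b ^ 2 / (2 + d)))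
        (5 / 6 * (b ^ 2 / (2 + d))) (b / 6) (b / 6) 0 := by
  have J := H.jacobi_of_rank_le hτ hG h4
  have ht : t = b / 2 := by linear_combination (-1 / 2 : ℂ) * H.coeff_mul hτ J
  obtain ⟨q₁, q₂, q₃, q₄, q₅, hQ⟩ : ∃ q₁ q₂ q₃ q₄ q₅ : ℂ, s.treeH τ ≫ s.treeH τ =
      fourLegs s τ q₁ q₂ q₃ q₄ q₅ 0 := by
    obtain ⟨u, i, p, v, h, q, e, hne⟩ := exists_square_relation s τ h4
    -- If the square did not occur, the relation would be a multiple of Jacobi with no `K`, hence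
    -- trivial.
    by_cases hq : q = 0
    · subst hq
      rw [zero_smul, add_zero] at e
      obtain ⟨rfl, rfl, rfl, rfl, hv⟩ := (H.g2Relation_or_jacobi hτ e).resolve_left hG
      simp [← hv] at hne
    · refine ⟨-q⁻¹ * u, -q⁻¹ * i, -q⁻¹ * p, -q⁻¹ * v, -q⁻¹ * h, ?_⟩
      have := congrArg (fun f => q⁻¹ • f) e
      simp only [smul_add, smul_smul, inv_mul_cancel₀ hq, one_smul, smul_zero] at this
      rw [eq_neg_of_add_eq_zero_right this]
      simp only [fourLegs]
      module
  have hrot : fourLegs s τ q₁ q₂ q₃ q₄ q₅ 0 = fourLegs s τ q₂ q₁ q₃ q₅ q₄ (-1 * 0) := by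
    refine s.box_injective (Points.hom_ext₄ fun E x y z w => ?_)
    refine Eq.trans ?_ (H.box_fourLegs_rotate E x y z w)
    rw [← hQ]
    exact (H.box_square_rotate E x y z w).symm
  have hdiff : fourLegs s τ (q₁ - q₂) (q₂ - q₁) 0 (q₄ - q₅) (q₅ - q₄) 0 = 0 := by
    rw [← sub_eq_zero.2 hrot]
    simp only [fourLegs]
    module
  -- Rotation invariance of the square gives a relation without `K`, hence trivial: `q₁ = q₂` and
  -- `q₄ = q₅`.
  obtain ⟨h₁₂, -, -, -, h₄₅⟩ := (H.g2Relation_or_jacobi hτ hdiff).resolve_left hG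
  have hβ : s.treeH τ ≫ (β_ X X).hom = s.treeH τ - τ ≫ s.comul τ := by
    rw [← sub_eq_zero, ← J]
    simp only [fourLegs]
    module
  -- Jacobi reads `K = H - I`, so crossing the upper legs of the square subtracts `t I`. Comparing
  -- coefficients modulo Jacobi gives `q₂ = q₃` and `q₅ = t - 2q₄`.
  have hQβ : (s.treeH τ ≫ s.treeH τ) ≫ (β_ X X).hom =
      s.treeH τ ≫ s.treeH τ - t • (τ ≫ s.comul τ) := by
    rw [Category.assoc, hβ, Preadditive.comp_sub, ← Category.assoc _ τ, H.triangle,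
      Linear.smul_comp]
  have hflip : fourLegs s τ 0 (q₃ - q₂) (q₂ - q₃) (t - 2 * q₄) (-q₅) q₅ = 0 := by
    have := sub_eq_zero.2 hQβ
    rw [hQ, H.fourLegs_braiding] at this
    rw [← this]
    simp only [fourLegs]
    module
  obtain ⟨-, h₂₃, -, -, h₅⟩ := (H.g2Relation_or_jacobi hτ hflip).resolve_left hG
  have e₄ : q₄ = b / 6 := by linear_combination (1 / 3 : ℂ) * (ht - h₄₅ + h₅)
  have e₅ : q₅ = b / 6 := by linear_combination e₄ + h₄₅
  have e₂ : q₂ = q₁ := by linear_combination -h₁₂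
  have e₃ : q₃ = q₁ := by linear_combination h₂₃ + e₂
  -- Capping the square produces two bigons. This fixes the remaining coefficient by `(2 + d) q =
  -- 5b²/6`, and `b ≠ 0` excludes `d = -2`.
  have hcap : fourLegs s τ q₁ q₂ q₃ q₄ q₅ 0 ≫ s.cap = (b * b) • s.cap := by
    rw [← hQ, Category.assoc, H.treeH_cap, Linear.comp_smul, H.treeH_cap, smul_smul]
  rw [H.fourLegs_cap] at hcap
  have hsum := smul_left_injective ℂ hc hcap
  subst e₂ e₃ e₅ e₄
  have hq : (2 + d) * q₃ = 5 / 6 * b ^ 2 := by linear_combination hsum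
  have hd : 2 + d ≠ 0 := by
    intro h0
    rw [h0, zero_mul] at hq
    exact hb (by simpa using hq.symm)
  refine ⟨by rwa [add_comm], ht, ?_⟩
  have : 5 / 6 * (b ^ 2 / (2 + d)) = q₃ := by field_simp; linear_combination -6 * hq
  rw [this, hQ]

end IsEvaluated

end

/-! ### Normalizing the relations by rescaling the pairing. -/

section

variable {C : Type u} [Category.{v} C] [Preadditive C] [Linear ℂ C] [MonoidalCategory C]
  [MonoidalPreadditive C] [MonoidalLinear ℂ C] [SymmetricCategory C] {X : C}
  {s : SelfDuality X} {τ : X ⊗ X ⟶ X}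

theorem SelfDuality.comul_rescale (c : ℂ) (hc : c ≠ 0) :
    (s.rescale c hc).comul τ = c⁻¹ • s.comul τ := by
  simp [comul, rescale]

theorem SelfDuality.treeH_rescale (c : ℂ) (hc : c ≠ 0) :
    (s.rescale c hc).treeH τ = c⁻¹ • s.treeH τ := by
  simp [treeH, comul_rescale]

theorem SelfDuality.isRescalingOf_rescale (s : SelfDuality X) (c : ℂ) (hc : c ≠ 0) :
    (s.rescale c hc).IsRescalingOf s := ⟨c, hc, rfl⟩

/-- The cup-cap does not change, while each tree involves one copairing and is multiplied by `c⁻¹`.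
-/
theorem fourLegs_rescale (c : ℂ) (hc : c ≠ 0) (u i p v h k : ℂ) :
    fourLegs (s.rescale c hc) τ u i p v h k =
      fourLegs s τ u i p (c⁻¹ * v) (c⁻¹ * h) (c⁻¹ * k) := by
  simp only [fourLegs, SelfDuality.comul_rescale, SelfDuality.treeH_rescale]
  simp only [SelfDuality.rescale, Linear.smul_comp, Linear.comp_smul, smul_smul,
    inv_mul_cancel₀ hc, one_smul, _root_.mul_comm]

theorem fourLegs_rescale_eq_zero {u i p v h k u' i' p' v' h' k' : ℂ} (c r : ℂ) (hc : c ≠ 0)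
    (e : fourLegs s τ u i p v h k = 0)
    (hu : r * u = u') (hi : r * i = i') (hp : r * p = p') (hv : c * r * v = v')
    (hh : c * r * h = h') (hk : c * r * k = k') :
    fourLegs (s.rescale c hc) τ u' i' p' v' h' k' = 0 := by
  rw [fourLegs_rescale]
  refine fourLegs_congr (fourLegs_smul_eq_zero r e) hu hi hp ?_ ?_ ?_
  · rw [← hv]; field_simp
  · rw [← hh]; field_simp
  · rw [← hk]; field_simp

namespace IsEvaluated

variable {σ d b t : ℂ}

theorem rescale (H : IsEvaluated s τ σ d b t) (c : ℂ) (hc : c ≠ 0) {b' t' : ℂ}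
    (hb : b = c * b') (ht : t = c * t') : IsEvaluated (s.rescale c hc) τ σ d b' t' where
  symm := by
    have := H.symm
    rw [SelfDuality.IsSymmetric] at this ⊢
    simp [SelfDuality.rescale, this]
  comm := H.comm
  rot := by simp [SelfDuality.rescale, H.rot]
  sign := H.sign
  circle := by simp [SelfDuality.rescale, H.circle, smul_smul, hc]
  lollipop := by simp [SelfDuality.rescale, H.lollipop]
  comul_cap := by
    rw [SelfDuality.comul_rescale]
    simp [SelfDuality.rescale, H.comul_cap]
  bigon := by
    rw [SelfDuality.comul_rescale, Linear.smul_comp, H.bigon, smul_smul, hb,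
      inv_mul_cancel_left₀ hc]
  triangle := by
    rw [SelfDuality.treeH_rescale, Linear.smul_comp, H.triangle, smul_smul, ht,
      inv_mul_cancel_left₀ hc]

/-- Closing the relation with the cap and with `τ` gives `b = x (d - 1)` and `t = x (d - 2)`. Hence
`x ≠ 0`, and rescaling by `x` removes it. The `G2` case is the same; for `F4` the factor is `2x`, to
meet the coefficient `1/2`. -/
theorem exists_sym (H : IsEvaluated s τ σ d b t) (hτ : τ ≠ 0) (hc : s.cap ≠ 0) (hb : b ≠ 0)
    (h : SymRelation s τ) : ∃ s' : SelfDuality X, s'.IsRescalingOf s ∧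
      IsEvaluated s' τ σ d (d - 1) (d - 2) ∧ fourLegs s' τ (-1) 1 0 (-1) 1 0 = 0 := by
  obtain ⟨x, e⟩ := h
  have hb' : b = x * (d - 1) := by linear_combination -H.coeff_cap hc e
  have ht : t = x * (d - 2) := by linear_combination hb' - H.coeff_mul hτ e
  have hx : x ≠ 0 := by
    rintro rfl
    exact hb (by simpa using hb')
  exact ⟨_, s.isRescalingOf_rescale x hx, H.rescale x hx hb' ht,
    fourLegs_rescale_eq_zero x (-x⁻¹) hx e (by field_simp) (by field_simp) (by simp)
      (by field_simp) (by field_simp) (by simp)⟩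

theorem exists_g2 (H : IsEvaluated s τ (-1) d b t) (hτ : τ ≠ 0) (hc : s.cap ≠ 0) (hb : b ≠ 0)
    (h : G2Relation s τ) : ∃ s' : SelfDuality X, s'.IsRescalingOf s ∧
      IsEvaluated s' τ (-1) d (1 - d) (d - 4) ∧ fourLegs s' τ 1 1 (-2) 1 1 0 = 0 := by
  obtain ⟨x, e⟩ := h
  have hb' : b = x * (1 - d) := by linear_combination H.coeff_cap hc e
  have ht : t = x * (d - 4) := by linear_combination H.coeff_mul hτ e - hb'
  have hx : x ≠ 0 := by
    rintro rfl
    exact hb (by simpa using hb')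
  exact ⟨_, s.isRescalingOf_rescale x hx, H.rescale x hx hb' ht,
    fourLegs_rescale_eq_zero x x⁻¹ hx e (by field_simp) (by field_simp) (by field_simp)
      (by field_simp) (by field_simp) (by simp)⟩

theorem exists_f4 (H : IsEvaluated s τ 1 d b t) (hτ : τ ≠ 0) (hc : s.cap ≠ 0) (hb : b ≠ 0)
    (h : F4Relation s τ) : ∃ s' : SelfDuality X, s'.IsRescalingOf s ∧
      IsEvaluated s' τ 1 d ((d + 2) / 4) ((2 - d) / 8) ∧
        fourLegs s' τ (-1 / 2) (-1 / 2) (-1 / 2) 1 1 1 = 0 := by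
  obtain ⟨x, e⟩ := h
  have hb' : b = (2 * x) * ((d + 2) / 4) := by
    linear_combination (1 / 2 : ℂ) * H.coeff_cap hc e
  have ht : t = (2 * x) * ((2 - d) / 8) := by
    linear_combination (1 / 2 : ℂ) * (H.coeff_mul hτ e - hb')
  have hx : x ≠ 0 := by
    rintro rfl
    exact hb (by simpa using hb')
  have hx' : 2 * x ≠ 0 := mul_ne_zero two_ne_zero hx
  exact ⟨_, s.isRescalingOf_rescale (2 * x) hx', H.rescale (2 * x) hx' hb' ht,
    fourLegs_rescale_eq_zero (2 * x) (2 * x)⁻¹ hx' e (by field_simp) (by field_simp)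
      (by field_simp) (by field_simp) (by field_simp) (by field_simp)⟩

end IsEvaluated

namespace Trivalent.IsTrivalentRibbon

variable [RightRigidCategory C] [RibbonCategory C] {d : ℂ}

theorem cap_ne_zero (h : IsTrivalentRibbon s τ) : s.cap ≠ 0 := fun h₀ =>
  zero_ne_one (α := ℂ) (h.smul_cap_inj (by simp [h₀]))

theorem mul_ne_zero (h : IsTrivalentRibbon s τ) : τ ≠ 0 := fun h₀ =>
  zero_ne_one (α := ℂ) (h.smul_inj (by simp [h₀]))

theorem exists_isEvaluated (h : IsTrivalentRibbon s τ) (hd : circleValue s = d • 𝟙 (𝟙_ C)) :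
    ∃ b t : ℂ, b ≠ 0 ∧ (IsEvaluated s τ 1 d b t ∨ IsEvaluated s τ (-1) d b t) := by
  obtain ⟨σ, hσ, H⟩ := h.exists_isRotational
  obtain ⟨b, hb, hbigon⟩ := h.exists_bigon
  obtain ⟨t, ht⟩ := h.exists_eq_smul (s.treeH τ ≫ τ)
  have K : IsEvaluated s τ σ d b t :=
    ⟨H, hσ, h.cup_comp_cap hd, h.cup_comp_mul, h.comul_comp_cap, hbigon, ht⟩
  refine ⟨b, t, hb, ?_⟩
  rcases mul_self_eq_one_iff.1 hσ with rfl | rfl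
  · exact .inl K
  · exact .inr K

/-- The classification of the skein theories, after rescaling the pairing. -/
theorem classification (h : IsTrivalentRibbon s τ) (hd : circleValue s = d • 𝟙 (𝟙_ C))
    (h4 : Module.rank ℂ (((X ⊗ X) ⊗ X) ⊗ X ⟶ 𝟙_ C) ≤ 5) :
    ∃ s' : SelfDuality X, s'.IsRescalingOf s ∧
      ((IsEvaluated s' τ 1 d (d - 1) (d - 2) ∧ fourLegs s' τ (-1) 1 0 (-1) 1 0 = 0) ∨
      (IsEvaluated s' τ (-1) d (1 - d) (d - 4) ∧ fourLegs s' τ 1 1 (-2) 1 1 0 = 0) ∨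
      (IsEvaluated s' τ 1 d ((d + 2) / 4) ((2 - d) / 8) ∧
        fourLegs s' τ (-1 / 2) (-1 / 2) (-1 / 2) 1 1 1 = 0) ∨
      (d + 2 ≠ 0 ∧ ∃ b : ℂ, b ≠ 0 ∧ IsEvaluated s' τ (-1) d b (b / 2) ∧
        fourLegs s' τ 0 0 0 1 (-1) 1 = 0 ∧ s'.treeH τ ≫ s'.treeH τ =
          fourLegs s' τ (5 / 6 * (b ^ 2 / (2 + d))) (5 / 6 * (b ^ 2 / (2 + d)))
            (5 / 6 * (b ^ 2 / (2 + d))) (b / 6) (b / 6) 0)) := by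
  have hτ := h.mul_ne_zero
  have hc := h.cap_ne_zero
  obtain ⟨b, t, hb, H | H⟩ := h.exists_isEvaluated hd
  · rcases H.symRelation_or_f4Relation_of_rank_le hτ h4 with h' | h'
    · obtain ⟨s', hs', K⟩ := H.exists_sym hτ hc hb h'
      exact ⟨s', hs', .inl K⟩
    · obtain ⟨s', hs', K⟩ := H.exists_f4 hτ hc hb h'
      exact ⟨s', hs', .inr (.inr (.inl K))⟩
  · by_cases hG : IsEvaluated.G2Relation s τ
    · obtain ⟨s', hs', K⟩ := H.exists_g2 hτ hc hb hG
      exact ⟨s', hs', .inr (.inl K)⟩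
    · obtain ⟨hd', rfl, hQ⟩ := H.exceptional_of_rank_le hτ hc hb hG h4
      -- The exceptional theory keeps `b` as a parameter, so no rescaling is needed.
      exact ⟨s, ⟨1, one_ne_zero, (one_smul _ _).symm⟩,
        .inr (.inr (.inr ⟨hd', b, hb, H, H.jacobi_of_rank_le hτ hG h4, hQ⟩))⟩

end Trivalent.IsTrivalentRibbon

end

/-! ### Functors out of a diagram category -/

namespace Trivalent

variable {C : Type u} [Category.{v} C] [Preadditive C] [Linear ℂ C] [MonoidalCategory C]
  [MonoidalPreadditive C] [MonoidalLinear ℂ C] [SymmetricCategory C] {X : C}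
  {s : SelfDuality X} {τ : X ⊗ X ⟶ X} {S : SkeinTheory}

theorem Term.eval_split : (Term.split).eval s τ = s.comul τ := by
  simp [split, eval, SelfDuality.comul, Word.eval]

theorem Term.eval_treeH : (Term.treeH).eval s τ = s.treeH τ := by
  simp [treeH, eval, eval_split, SelfDuality.treeH, Word.eval]

/-- The relations of the skein theory `S` hold for `s` and `τ`. -/
structure IsModel (S : SkeinTheory) (s : SelfDuality X) (τ : X ⊗ X ⟶ X) : Prop where
  evaluated : IsEvaluated s τ S.vertexSign S.circle S.bigon S.triangle
  relations : ∀ f ∈ S.relations, f.eval s τ = 0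

theorem IsModel.eval_eq (M : IsModel S s τ) {a b : Word} {f g : Term a b} (h : Rel S f g) :
    f.eval s τ = g.eval s τ := by
  induction h with
  | refl => rfl
  | symm _ h => exact h.symm
  | trans _ _ h h' => exact h.trans h'
  | comp_congr _ _ h h' => simp only [Term.eval, h, h']
  | tensor_congr _ _ h h' => exact congrArg₂ (· ⊗ₘ ·) h h'
  | add_congr _ _ h h' => simp only [Term.eval, h, h']
  | smul_congr _ _ h => simp only [Term.eval, h]
  | add_assoc => exact _root_.add_assoc _ _ _
  | add_comm => exact _root_.add_comm _ _
  | one_smul => exact _root_.one_smul _ _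
  | zero_smul => exact _root_.zero_smul _ _
  | mul_smul => exact SemigroupAction.mul_smul _ _ _
  | add_smul => exact _root_.add_smul _ _ _
  | tensor_comp => exact tensorHom_comp_tensorHom _ _ _ _
  | assoc_naturality => exact associator_naturality _ _ _
  | leftUnit_naturality f => simp [Term.eval, Word.eval]
  | rightUnit_naturality f => simp [Term.eval, Word.eval]
  | pentagon => simp [Term.eval, Word.eval]
  | triangle => simp [Term.eval, Word.eval]
  | cross_cross => exact SymmetricCategory.symmetry _ _
  | cross_naturality => exact BraidedCategory.braiding_naturality _ _
  | hexagon => simp [Term.eval, Word.eval]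
  | zigzag_left => simpa [Term.eval, Word.eval] using s.zigzag_left
  | zigzag_right => simpa [Term.eval, Word.eval] using s.zigzag_right
  | cap_symm => exact M.evaluated.symm
  | rotation => simpa [Term.eval, Word.eval] using M.evaluated.rot
  | circle => exact M.evaluated.circle
  | twisted_vertex => exact M.evaluated.comm
  | lollipop => exact M.evaluated.lollipop
  | bigon => exact (congrArg (· ≫ τ) Term.eval_split).trans M.evaluated.bigon
  | trigon => exact (congrArg (· ≫ τ) Term.eval_treeH).trans M.evaluated.triangle
  | fourLegs f hf => exact M.relations f hf
  | add_tensor => exact MonoidalPreadditive.add_tensor _ _ _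
  | tensor_add => exact MonoidalPreadditive.tensor_add _ _ _
  | smul_tensor => exact smul_tensorHom _ _ _
  | tensor_smul => exact tensorHom_smul _ _ _
  | _ => simp [Term.eval, Word.eval]

/-- The evaluation of diagrams in a model. -/
noncomputable def IsModel.functor (M : IsModel S s τ) : DiagramCategory S ⥤ C where
  obj A := A.word.eval X
  map f := Quot.lift (Term.eval s τ) (fun _ _ h => M.eval_eq h) f
  map_id _ := rfl
  map_comp f g := by
    induction f using Quot.ind
    induction g using Quot.ind
    rfl

instance (M : IsModel S s τ) : M.functor.Additive where
  map_add {_ _ f g} := by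
    induction f using Quot.ind
    induction g using Quot.ind
    rfl

instance (M : IsModel S s τ) : M.functor.Linear ℂ where
  map_smul f r := by
    induction f using Quot.ind
    rfl

noncomputable instance (M : IsModel S s τ) : M.functor.Monoidal :=
  Functor.CoreMonoidal.toMonoidal
    { εIso := Iso.refl (𝟙_ C)
      μIso := fun A B => Iso.refl (A.word.eval X ⊗ B.word.eval X)
      μIso_hom_natural_left := fun {A B} f D => by
        induction f using Quot.ind with | mk f => ?_
        change f.eval s τ ▷ _ ≫ 𝟙 _ = 𝟙 _ ≫ (f.eval s τ ⊗ₘ 𝟙 _)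
        simp
      μIso_hom_natural_right := fun {A B} D f => by
        induction f using Quot.ind with | mk f => ?_
        change _ ◁ f.eval s τ ≫ 𝟙 _ = 𝟙 _ ≫ (𝟙 _ ⊗ₘ f.eval s τ)
        simp
      associativity := fun A B D => by
        change 𝟙 (A.word.eval X ⊗ B.word.eval X) ▷ D.word.eval X ≫ 𝟙 _ ≫ (α_ _ _ _).hom =
          (α_ _ _ _).hom ≫ _ ◁ 𝟙 _ ≫ 𝟙 _
        simp
      left_unitality := fun A => by
        change (λ_ (A.word.eval X)).hom = 𝟙 _ ▷ _ ≫ 𝟙 _ ≫ (λ_ _).hom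
        simp
      right_unitality := fun A => by
        change (ρ_ (A.word.eval X)).hom = _ ◁ 𝟙 _ ≫ 𝟙 _ ≫ (ρ_ _).hom
        simp }

noncomputable instance (M : IsModel S s τ) : M.functor.Braided where
  braided A B := by
    change 𝟙 _ ≫ (β_ (A.word.eval X) (B.word.eval X)).hom = (β_ _ _).hom ≫ 𝟙 _
    simp

variable [RightRigidCategory C] [RibbonCategory C]

theorem IsModel.isAlgebraObject (M : IsModel S s τ)
    (h : (RibbonCategory.twist X).hom = 𝟙 X) : IsAlgebraObject S s τ := by
  refine ⟨h, M.functor, inferInstance, inferInstance, inferInstance, Iso.refl X, ?_, ?_⟩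
  · change 𝟙 _ ≫ s.cap = (𝟙 X ⊗ₘ 𝟙 X) ≫ s.cap ≫ 𝟙 _
    simp
  · change 𝟙 _ ≫ τ ≫ 𝟙 X = (𝟙 X ⊗ₘ 𝟙 X) ≫ τ
    simp

section

/-- `Term.eval` for diagrams with four legs. -/
noncomputable def Term.evalTwo (s : SelfDuality X) (τ : X ⊗ X ⟶ X) (f : Term two two) :
    X ⊗ X ⟶ X ⊗ X := f.eval s τ

variable (f g : Term Term.two Term.two)

theorem Term.evalTwo_add : (add f g).evalTwo s τ = f.evalTwo s τ + g.evalTwo s τ := rfl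

theorem Term.evalTwo_smul (r : ℂ) : (smul r f).evalTwo s τ = r • f.evalTwo s τ := rfl

theorem Term.evalTwo_sub : (sub f g).evalTwo s τ = f.evalTwo s τ + (-1 : ℂ) • g.evalTwo s τ := rfl

theorem Term.evalTwo_twoStrand : twoStrand.evalTwo s τ = 𝟙 (X ⊗ X) := rfl

theorem Term.evalTwo_cupCap : cupCap.evalTwo s τ = s.cap ≫ s.cup := rfl

theorem Term.evalTwo_symCross : symCross.evalTwo s τ = (β_ X X).hom := rfl

theorem Term.evalTwo_treeI : treeI.evalTwo s τ = τ ≫ s.comul τ :=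
  congrArg (τ ≫ ·) eval_split

theorem Term.evalTwo_treeH : treeH.evalTwo s τ = s.treeH τ := eval_treeH

theorem Term.evalTwo_treeX : treeX.evalTwo s τ = s.treeH τ ≫ (β_ X X).hom :=
  congrArg (· ≫ (β_ X X).hom) eval_treeH

theorem Term.evalTwo_square : square.evalTwo s τ = s.treeH τ ≫ s.treeH τ :=
  congrArg₂ (· ≫ ·) eval_treeH eval_treeH

end

variable {d b : ℂ}

theorem isModel_symTheory (H : IsEvaluated s τ 1 d (d - 1) (d - 2))
    (e : fourLegs s τ (-1) 1 0 (-1) 1 0 = 0) : IsModel (symTheory d) s τ := by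
  refine ⟨H, ?_⟩
  rintro f rfl
  change Term.evalTwo s τ _ = 0
  rw [← e]
  simp only [Term.evalTwo_add, Term.evalTwo_sub, Term.evalTwo_treeH, Term.evalTwo_treeI,
    Term.evalTwo_twoStrand, Term.evalTwo_cupCap, fourLegs]
  module

theorem isModel_g2Theory (H : IsEvaluated s τ (-1) d (1 - d) (d - 4))
    (e : fourLegs s τ 1 1 (-2) 1 1 0 = 0) : IsModel (g2Theory d) s τ := by
  refine ⟨H, ?_⟩
  rintro f rfl
  change Term.evalTwo s τ _ = 0
  rw [← e]
  simp only [Term.evalTwo_add, Term.evalTwo_sub, Term.evalTwo_smul, Term.evalTwo_treeH,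
    Term.evalTwo_treeI, Term.evalTwo_twoStrand, Term.evalTwo_cupCap, Term.evalTwo_symCross,
    fourLegs]
  module

theorem isModel_f4Theory (H : IsEvaluated s τ 1 d ((d + 2) / 4) ((2 - d) / 8))
    (e : fourLegs s τ (-1 / 2) (-1 / 2) (-1 / 2) 1 1 1 = 0) : IsModel (f4Theory d) s τ := by
  refine ⟨H, ?_⟩
  rintro f rfl
  change Term.evalTwo s τ _ = 0
  rw [← e]
  simp only [Term.evalTwo_add, Term.evalTwo_sub, Term.evalTwo_smul, Term.evalTwo_treeH,
    Term.evalTwo_treeI, Term.evalTwo_treeX, Term.evalTwo_twoStrand, Term.evalTwo_cupCap,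
    Term.evalTwo_symCross, fourLegs]
  module

theorem isModel_excTheory (H : IsEvaluated s τ (-1) d b (b / 2))
    (e : fourLegs s τ 0 0 0 1 (-1) 1 = 0) (hQ : s.treeH τ ≫ s.treeH τ =
      fourLegs s τ (5 / 6 * (b ^ 2 / (2 + d))) (5 / 6 * (b ^ 2 / (2 + d)))
        (5 / 6 * (b ^ 2 / (2 + d))) (b / 6) (b / 6) 0) :
    IsModel (excTheory d b) s τ := by
  refine ⟨H, ?_⟩
  rintro f (rfl | rfl)
  · change Term.evalTwo s τ _ = 0
    rw [← e]
    simp only [Term.evalTwo_add, Term.evalTwo_sub, Term.evalTwo_treeH, Term.evalTwo_treeI,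
      Term.evalTwo_treeX, fourLegs]
    module
  · change Term.evalTwo s τ _ = 0
    simp only [Term.evalTwo_add, Term.evalTwo_sub, Term.evalTwo_smul, Term.evalTwo_treeH,
      Term.evalTwo_treeI, Term.evalTwo_square, Term.evalTwo_twoStrand, Term.evalTwo_cupCap,
      Term.evalTwo_symCross, hQ, fourLegs]
    module

end Trivalent

/-! ### Four-leg relations as identities between elements; the Lie bracket. -/

section

variable {C : Type u} [Category.{v} C] [Preadditive C] [Linear ℂ C] [MonoidalCategory C]
  [MonoidalPreadditive C] [MonoidalLinear ℂ C] [SymmetricCategory C] {X : C}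
  {s : SelfDuality X} {τ : X ⊗ X ⟶ X} {σ d b t : ℂ}

namespace IsEvaluated

theorem contract_treeX (H : IsEvaluated s τ σ d b t) (E : Points.{v} C) (x y z : E.obj X) :
    E.contract s (E.map (s.treeH τ ≫ (β_ X X).hom) (E.pair x y)) z =
      E.map τ (E.pair y (E.map τ (E.pair x z))) := by
  have hk : s.bend (s.treeH τ ≫ (β_ X X).hom) =
      (β_ X X).hom ▷ X ≫ (α_ X X X).hom ≫ X ◁ τ ≫ τ := by
    refine s.flat_injective (Points.hom_ext₄ fun E x y z w => ?_)
    change E.map (s.box _) _ = _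
    rw [H.box_treeX, H.mul_comm E x z, H.mul_comm E w y, E.map_flat]
    simp only [Points.map_comp, Points.map_whiskerLeft, Points.map_whiskerRight,
      Points.map_associator, Points.map_braiding, map_smul, LinearMap.smul_apply]
    rw [smul_smul, H.sign, one_smul, H.dot_comm E (E.map τ (E.pair x z)), H.dot_mul, H.dot_comm]
  rw [← E.map_bend, hk]
  simp

/-- A relation between diagrams with four legs, in terms of elements. -/
theorem fourLegs_apply (H : IsEvaluated s τ σ d b t) {u i p v h k : ℂ}
    (e : fourLegs s τ u i p v h k = 0) (E : Points.{v} C) (x y z : E.obj X) :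
    u • E.map s.cap (E.pair x y) • z + i • E.map s.cap (E.pair y z) • x +
      p • E.map s.cap (E.pair x z) • y + v • E.map τ (E.pair (E.map τ (E.pair x y)) z) +
      h • E.map τ (E.pair x (E.map τ (E.pair y z))) +
      k • E.map τ (E.pair y (E.map τ (E.pair x z))) = 0 := by
  have := congrArg (fun f => E.map (s.bend f) (E.pair (E.pair x y) z)) e
  have h₀ : s.bend (0 : X ⊗ X ⟶ X ⊗ X) = 0 := by simp [SelfDuality.bend]
  simp only [h₀, map_zero, LinearMap.zero_apply] at this
  rw [← this, ← H.contract_treeX E x y z, ← H.contract_treeH E x y z, ← H.contract_comul, E.map_bend]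
  have h₁ : E.contract s (E.pair x y) z = E.map s.cap (E.pair y z) • x := E.contract_pair s _ _ _
  have h₂ : E.contract s (E.map (β_ X X).hom (E.pair x y)) z = E.map s.cap (E.pair x z) • y := by
    rw [E.map_braiding, E.contract_pair]
  have h₃ := E.contract_cup_smul s (E.map s.cap (E.pair x y)) z
  rw [← h₁, ← h₂, ← h₃, ← E.map_comp, ← E.map_comp]
  simp only [fourLegs, Points.contract, map_add, LinearMap.map_smul, LinearMap.add_apply,
    LinearMap.smul_apply, E.map_id]

/-- On elements the relation `I - H + K = 0` is `(xy)z - x(yz) + y(xz) = 0`. -/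
theorem isLieBracket (H : IsEvaluated s τ (-1) d b t) (e : fourLegs s τ 0 0 0 1 (-1) 1 = 0) :
    IsLieBracket τ where
  antisymm := by rw [H.comm, neg_one_smul]
  jacobi := Points.hom_ext₃ fun E x y z => by
    have := H.fourLegs_apply e E x y z
    simp only [zero_smul, zero_add, one_smul, neg_one_smul] at this
    simp only [map_add, LinearMap.add_apply, Points.map_comp, Points.map_whiskerLeft,
      Points.map_whiskerRight, Points.map_associator, Points.map_braiding]
    rw [← sub_eq_zero, ← neg_eq_zero, ← this]
    abel

end IsEvaluated

end

/-! ### The additive completion -/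

namespace Points

open AdditiveCompletion

variable {C : Type u} [Category.{v} C] [Preadditive C] [Linear ℂ C] [MonoidalCategory C]
  [MonoidalPreadditive C] [MonoidalLinear ℂ C] [SymmetricCategory C]

open Functor.LaxMonoidal in
/-- The restriction of a system of generalized elements along the embedding into the additive
completion. -/
noncomputable def restrict (E : Points.{v} (Mat_ C)) : Points.{v} C where
  obj A := E.obj (inMat A)
  map {A B} := E.map ∘ₗ (Mat_.embedding C).mapLinearMap ℂ
  pair {A B} := E.pair.compr₂ (E.map (μ (Mat_.embedding C) A B))
  one := E.map (ε (Mat_.embedding C)) E.one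
  map_id a := by simp
  map_comp f g a := by simp
  map_whiskerLeft {A B D} f a b := by
    have := congrArg (fun g => E.map g (E.pair a b)) (μ_natural_right (Mat_.embedding C) A f)
    simp only [map_comp, E.map_whiskerLeft] at this
    exact this.symm
  map_whiskerRight {A B D} f a b := by
    have := congrArg (fun g => E.map g (E.pair a b)) (μ_natural_left (Mat_.embedding C) f D)
    simp only [map_comp, E.map_whiskerRight] at this
    exact this.symm
  map_associator {A B D} a b c := by
    have := congrArg (fun g => E.map g (E.pair (E.pair a b) c))
      (associativity (Mat_.embedding C) A B D)
    simp only [map_comp, E.map_whiskerRight, E.map_whiskerLeft, E.map_associator] at this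
    exact this
  map_braiding {A B} a b := by
    have := congrArg (fun g => E.map g (E.pair a b))
      (Functor.LaxBraided.braided (F := Mat_.embedding C) A B)
    simp only [map_comp, E.map_braiding] at this
    exact this
  map_leftUnitor_one {A} a := by
    have := congrArg (fun g => E.map g (E.pair E.one a)) (left_unitality (Mat_.embedding C) A)
    simp only [map_comp, E.map_whiskerRight, E.map_leftUnitor_one] at this
    exact this.symm

end Points

namespace AdditiveCompletion

open Functor.LaxMonoidal

section

variable {C : Type u} [Category.{v} C] [Preadditive C] [MonoidalCategory C]
  [MonoidalPreadditive C] {X : C}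

theorem matMul_eq (τ : X ⊗ X ⟶ X) :
    matMul τ = μ (Mat_.embedding C) X X ≫ (Mat_.embedding C).map τ := by
  ext p q
  refine Eq.trans ?_ ((embeddingμIso_isReindexing X X).comp_apply _ p q).symm
  exact (Category.id_comp τ).symm

theorem matCap_comp_ε (c : X ⊗ X ⟶ 𝟙_ C) :
    matCap c ≫ ε (Mat_.embedding C) = μ (Mat_.embedding C) X X ≫ (Mat_.embedding C).map c := by
  refine Eq.trans (Category.comp_id _) ?_
  ext p q
  refine Eq.trans ?_ ((embeddingμIso_isReindexing X X).comp_apply _ p q).symm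
  exact (Category.id_comp c).symm

theorem matCap_isReindexing (c : X ⊗ X ⟶ 𝟙_ C) :
    IsReindexing (matCap c) (Equiv.prodPUnit PUnit) (fun _ => c) :=
  ⟨fun _ => rfl, fun _ _ h => absurd (Subsingleton.elim (α := PUnit) _ _) h⟩

theorem matCup_isReindexing (c : 𝟙_ C ⟶ X ⊗ X) :
    IsReindexing (M := 𝟙_ (Mat_ C)) (N := inMat X ⊗ inMat X) (fun _ _ => c)
      (Equiv.prodPUnit PUnit).symm (fun _ => c) :=
  ⟨fun _ => rfl, fun _ _ h => absurd (Subsingleton.elim (α := PUnit × PUnit) _ _) h⟩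

theorem associator_inv_isReindexing (M N K : Mat_ C) :
    IsReindexing (α_ M N K).inv (Equiv.prodAssoc M.ι N.ι K.ι).symm
      (fun p => (α_ (M.X p.1) (N.X p.2.1) (K.X p.2.2)).inv) := by
  have h := reindexHom_isReindexing (M := M ⊗ (N ⊗ K)) (N := (M ⊗ N) ⊗ K)
    (Equiv.prodAssoc M.ι N.ι K.ι).symm (fun p => (α_ (M.X p.1) (N.X p.2.1) (K.X p.2.2)).inv)
  have e := IsReindexing.unique (h.comp (associator_isReindexing M N K)) (.id _)
    (fun p => Iso.inv_hom_id _)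
  rwa [(Iso.eq_comp_inv _).2 e, Category.id_comp] at h

/-- A self-duality, in the additive completion. -/
noncomputable def matDuality (s : SelfDuality X) : SelfDuality (inMat X) where
  cap := matCap s.cap
  cup := fun _ _ => s.cup
  zigzag_left := by
    rw [Iso.eq_comp_inv]
    refine IsReindexing.unique ((((matCup_isReindexing s.cup).tensor (.id (inMat X))).comp
      ((associator_isReindexing _ _ _).comp ((IsReindexing.id _).tensor
        (matCap_isReindexing s.cap)))).comp (rightUnitor_isReindexing _))
      (leftUnitor_isReindexing _) fun _ => ?_
    change ((s.cup ⊗ₘ 𝟙 X) ≫ (α_ X X X).hom ≫ (𝟙 X ⊗ₘ s.cap)) ≫ (ρ_ X).hom = (λ_ X).hom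
    rw [← Iso.eq_comp_inv, tensorHom_id, id_tensorHom, s.zigzag_left]
  zigzag_right := by
    rw [Iso.eq_comp_inv]
    refine IsReindexing.unique ((((IsReindexing.id (inMat X)).tensor
      (matCup_isReindexing s.cup)).comp ((associator_inv_isReindexing _ _ _).comp
        ((matCap_isReindexing s.cap).tensor (IsReindexing.id _)))).comp
          (leftUnitor_isReindexing _)) (rightUnitor_isReindexing _) fun _ => ?_
    change ((𝟙 X ⊗ₘ s.cup) ≫ (α_ X X X).inv ≫ (s.cap ⊗ₘ 𝟙 X)) ≫ (λ_ X).hom = (ρ_ X).hom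
    rw [← Iso.eq_comp_inv, tensorHom_id, id_tensorHom, s.zigzag_right]

end

end AdditiveCompletion

namespace Points

open AdditiveCompletion Functor.LaxMonoidal

variable {C : Type u} [Category.{v} C] [Preadditive C] [Linear ℂ C] [MonoidalCategory C]
  [MonoidalPreadditive C] [MonoidalLinear ℂ C] [SymmetricCategory C] {X : C}
  (E : Points.{v} (Mat_ C))

theorem restrict_map_mul (τ : X ⊗ X ⟶ X) (x y : E.obj (inMat X)) :
    E.restrict.map τ (E.restrict.pair x y) = E.map (matMul τ) (E.pair x y) := by
  rw [matMul_eq, E.map_comp]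
  rfl

theorem restrict_map_cap (c : X ⊗ X ⟶ 𝟙_ C) (x y : E.obj (inMat X)) :
    E.restrict.map c (E.restrict.pair x y) =
      E.map (ε (Mat_.embedding C)) (E.map (matCap c) (E.pair x y)) := by
  rw [← E.map_comp, matCap_comp_ε, E.map_comp]
  rfl

theorem restrict_smul (r : E.obj (𝟙_ (Mat_ C))) (x : E.obj (inMat X)) :
    @HSMul.hSMul (E.restrict.obj (𝟙_ C)) (E.restrict.obj X) (E.restrict.obj X) _
      (E.map (ε (Mat_.embedding C)) r) x = r • x := by
  have := congrArg (fun g => E.map g (E.pair r x)) (left_unitality (Mat_.embedding C) X)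
  simp only [map_comp, E.map_whiskerRight] at this
  exact this.symm

/-- Scalars of the restricted points are compared with those of `E` along this map. Being injective,
it carries identities known for `C` back to the additive completion. -/
theorem map_ε_injective : Function.Injective (E.map (ε (Mat_.embedding C))) :=
  Function.LeftInverse.injective (g := E.map (Functor.OplaxMonoidal.η (Mat_.embedding C)))
    fun r => by rw [← E.map_comp, Functor.Monoidal.ε_η, E.map_id]

section

variable {s : SelfDuality X} {τ : X ⊗ X ⟶ X} {σ d b t : ℂ} (H : IsEvaluated s τ σ d b t)
include H

theorem matCap_symm (x y : E.obj (inMat X)) :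
    E.map (matCap s.cap) (E.pair x y) = E.map (matCap s.cap) (E.pair y x) := by
  have := H.dot_comm E.restrict x y
  simp only [restrict_map_cap] at this
  exact E.map_ε_injective this

theorem matMul_comm (x y : E.obj (inMat X)) :
    E.map (matMul τ) (E.pair y x) = σ • E.map (matMul τ) (E.pair x y) := by
  have := H.mul_comm E.restrict x y
  simp only [restrict_map_mul] at this
  exact this

theorem matCap_mul (x y z : E.obj (inMat X)) :
    E.map (matCap s.cap) (E.pair (E.map (matMul τ) (E.pair x y)) z) =
      E.map (matCap s.cap) (E.pair x (E.map (matMul τ) (E.pair y z))) := by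
  have := H.dot_mul E.restrict x y z
  simp only [restrict_map_cap, restrict_map_mul] at this
  exact E.map_ε_injective this

theorem mat_fourLegs {u i p v h k : ℂ} (e : fourLegs s τ u i p v h k = 0)
    (x y z : E.obj (inMat X)) :
    u • E.map (matCap s.cap) (E.pair x y) • z + i • E.map (matCap s.cap) (E.pair y z) • x +
      p • E.map (matCap s.cap) (E.pair x z) • y +
      v • E.map (matMul τ) (E.pair (E.map (matMul τ) (E.pair x y)) z) +
      h • E.map (matMul τ) (E.pair x (E.map (matMul τ) (E.pair y z))) +
      k • E.map (matMul τ) (E.pair y (E.map (matMul τ) (E.pair x z))) = 0 := by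
  have := H.fourLegs_apply e E.restrict x y z
  simp only [restrict_map_cap, restrict_map_mul] at this
  rw [← E.restrict_smul, ← E.restrict_smul, ← E.restrict_smul]
  exact this

end

end Points

section

open Limits

/-! ### Adjoining a unit -/

section

variable {D : Type u} [Category.{v} D] [Preadditive D] [Linear ℂ D] [MonoidalCategory D]
  [MonoidalPreadditive D] [MonoidalLinear ℂ D] [SymmetricCategory D] [HasBinaryBiproducts D]
  {Y : D}

namespace Points

variable (E : Points.{v} D)

theorem biprod_eq (a : E.obj (𝟙_ D ⊞ Y)) :
    a = E.map biprod.inl (E.map biprod.fst a) + E.map biprod.inr (E.map biprod.snd a) := by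
  rw [← E.map_comp, ← E.map_comp, ← LinearMap.add_apply, ← map_add, biprod.total, E.map_id]

theorem biprod_ext {a b : E.obj (𝟙_ D ⊞ Y)}
    (h₁ : E.map biprod.fst a = E.map biprod.fst b) (h₂ : E.map biprod.snd a = E.map biprod.snd b) :
    a = b := by
  rw [E.biprod_eq a, h₁, h₂, ← E.biprod_eq]

theorem pair_scalar_right {A : D} (a : E.obj A) (r : E.obj (𝟙_ D)) :
    E.pair a r = r • E.pair a 1 := by
  rw [← pair_scalar_smul_right, smul_eq_mul, mul_one]

theorem pair_scalar_left {A : D} (r : E.obj (𝟙_ D)) (a : E.obj A) :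
    E.pair r a = r • E.pair 1 a := by
  rw [← pair_scalar_smul_left, smul_eq_mul, mul_one]

theorem map_inl_scalar (r : E.obj (𝟙_ D)) :
    E.map (biprod.inl : _ ⟶ 𝟙_ D ⊞ Y) r = r • E.map biprod.inl 1 := by
  rw [← map_scalar_smul, smul_eq_mul, mul_one]

@[simp]
theorem map_fst_inl (r : E.obj (𝟙_ D)) :
    E.map (biprod.fst : 𝟙_ D ⊞ Y ⟶ _) (E.map biprod.inl r) = r := by
  rw [← E.map_comp, biprod.inl_fst, E.map_id]

@[simp]
theorem map_snd_inl (r : E.obj (𝟙_ D)) :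
    E.map (biprod.snd : 𝟙_ D ⊞ Y ⟶ _) (E.map biprod.inl r) = 0 := by
  rw [← E.map_comp, biprod.inl_snd, map_zero, LinearMap.zero_apply]

@[simp]
theorem map_fst_inr (y : E.obj Y) :
    E.map (biprod.fst : 𝟙_ D ⊞ Y ⟶ _) (E.map biprod.inr y) = 0 := by
  rw [← E.map_comp, biprod.inr_fst, map_zero, LinearMap.zero_apply]

@[simp]
theorem map_snd_inr (y : E.obj Y) :
    E.map (biprod.snd : 𝟙_ D ⊞ Y ⟶ _) (E.map biprod.inr y) = y := by
  rw [← E.map_comp, biprod.inr_snd, E.map_id]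

end Points

/-- The pairing `⟨(r, x), (r', x')⟩ = r r' + ⟨x, x'⟩` on `𝟙 ⊕ Y`. -/
noncomputable def unitalCap (c : Y ⊗ Y ⟶ 𝟙_ D) :
    (𝟙_ D ⊞ Y) ⊗ (𝟙_ D ⊞ Y) ⟶ 𝟙_ D :=
  (biprod.fst ⊗ₘ biprod.fst) ≫ (λ_ (𝟙_ D)).hom + (biprod.snd ⊗ₘ biprod.snd) ≫ c

/-- The multiplication `(r, x) (r', x') = (r r' + κ ⟨x, x'⟩, r x' + r' x + x x')` on `𝟙 ⊕ Y`. -/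
noncomputable def unitalMul (κ : ℂ) (c : Y ⊗ Y ⟶ 𝟙_ D) (m : Y ⊗ Y ⟶ Y) :
    (𝟙_ D ⊞ Y) ⊗ (𝟙_ D ⊞ Y) ⟶ 𝟙_ D ⊞ Y :=
  ((biprod.fst ⊗ₘ biprod.fst) ≫ (λ_ (𝟙_ D)).hom + κ • (biprod.snd ⊗ₘ biprod.snd) ≫ c) ≫ biprod.inl +
    ((biprod.fst ⊗ₘ biprod.snd) ≫ (λ_ Y).hom + (biprod.snd ⊗ₘ biprod.fst) ≫ (ρ_ Y).hom +
      (biprod.snd ⊗ₘ biprod.snd) ≫ m) ≫ biprod.inr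

namespace Points

variable (E : Points.{v} D) (c : Y ⊗ Y ⟶ 𝟙_ D) (m : Y ⊗ Y ⟶ Y) (κ : ℂ) (a b : E.obj (𝟙_ D ⊞ Y))

@[simp]
theorem map_unitalCap : E.map (unitalCap c) (E.pair a b) =
    E.map biprod.fst a * E.map biprod.fst b +
      E.map c (E.pair (E.map biprod.snd a) (E.map biprod.snd b)) := by
  simp [unitalCap]

@[simp]
theorem map_fst_unitalMul : E.map biprod.fst (E.map (unitalMul κ c m) (E.pair a b)) =
    E.map biprod.fst a * E.map biprod.fst b +
      κ • E.map c (E.pair (E.map biprod.snd a) (E.map biprod.snd b)) := by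
  simp [unitalMul]

@[simp]
theorem map_snd_unitalMul : E.map biprod.snd (E.map (unitalMul κ c m) (E.pair a b)) =
    E.map biprod.fst a • E.map biprod.snd b + E.map biprod.fst b • E.map biprod.snd a +
      E.map m (E.pair (E.map biprod.snd a) (E.map biprod.snd b)) := by
  simp [unitalMul]

end Points

/-- The unital algebra `𝟙 ⊕ Y`. -/
noncomputable def unitalAlgebra (κ : ℂ) (c : Y ⊗ Y ⟶ 𝟙_ D) (m : Y ⊗ Y ⟶ Y) :
    UnitalAlgebra (𝟙_ D ⊞ Y) where
  mul := unitalMul κ c m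
  one := biprod.inl
  one_mul := Points.hom_ext₂ fun E r a => E.biprod_ext (by simp) (by simp)
  mul_one := Points.hom_ext₂ fun E a r => E.biprod_ext (by simp [mul_comm]) (by simp)

/-- The self-duality of `𝟙 ⊕ Y` determined by a self-duality of `Y`. -/
noncomputable def unitalDuality (s : SelfDuality Y) : SelfDuality (𝟙_ D ⊞ Y) where
  cap := unitalCap s.cap
  cup := (λ_ (𝟙_ D)).inv ≫ (biprod.inl ⊗ₘ biprod.inl) + s.cup ≫ (biprod.inr ⊗ₘ biprod.inr)
  zigzag_left := by
    -- The copairing is not a pure tensor, so the part of the zigzag in `Y` is first reduced, on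
    -- pure tensors, to the zigzag of `s`. The part in `𝟙` is then computed on elements.
    have h : (biprod.inr ⊗ₘ biprod.inr) ▷ (𝟙_ D ⊞ Y) ≫ (α_ _ _ _).hom ≫
        (𝟙_ D ⊞ Y) ◁ unitalCap s.cap = (Y ⊗ Y) ◁ biprod.snd ≫ (α_ _ _ _).hom ≫ Y ◁ s.cap ≫
          biprod.inr ▷ _ :=
      Points.hom_ext₃ fun E p q a => by simp [E.pair_scalar_right _ (E.map s.cap _)]
    have h' : s.cup ▷ _ ≫ (biprod.inr ⊗ₘ biprod.inr) ▷ (𝟙_ D ⊞ Y) ≫ (α_ _ _ _).hom ≫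
        (𝟙_ D ⊞ Y) ◁ unitalCap s.cap =
        𝟙_ D ◁ biprod.snd ≫ (λ_ Y).hom ≫ (ρ_ Y).inv ≫ biprod.inr ▷ _ := by
      rw [h, ← whisker_exchange_assoc, reassoc_of% s.zigzag_left]
    refine Points.hom_ext₂ fun E r a => ?_
    have e := congrArg (fun f => E.map f (E.pair r a)) h'
    simp only [Points.map_comp, Points.map_whiskerRight, Points.map_whiskerLeft,
      Points.map_leftUnitor, Points.map_rightUnitor_inv] at e
    simp only [Points.map_comp, Points.map_whiskerRight, map_add, LinearMap.add_apply, e]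
    conv_rhs => rw [E.biprod_eq a]
    simp [E.pair_scalar_right _ (r * _), E.map_inl_scalar (E.map biprod.fst a), mul_smul]
    exact smul_comm _ _ _
  zigzag_right := by
    have h : (𝟙_ D ⊞ Y) ◁ (biprod.inr ⊗ₘ biprod.inr) ≫ (α_ _ _ _).inv ≫
        unitalCap s.cap ▷ (𝟙_ D ⊞ Y) = biprod.snd ▷ (Y ⊗ Y) ≫ (α_ _ _ _).inv ≫ s.cap ▷ Y ≫
          _ ◁ biprod.inr :=
      Points.hom_ext₁₂ fun E a p q => by simp [E.pair_scalar_left (E.map s.cap _)]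
    have h' : _ ◁ s.cup ≫ (𝟙_ D ⊞ Y) ◁ (biprod.inr ⊗ₘ biprod.inr) ≫ (α_ _ _ _).inv ≫
        unitalCap s.cap ▷ (𝟙_ D ⊞ Y) =
        biprod.snd ▷ 𝟙_ D ≫ (ρ_ Y).hom ≫ (λ_ Y).inv ≫ _ ◁ biprod.inr := by
      rw [h, whisker_exchange_assoc, reassoc_of% s.zigzag_right]
    refine Points.hom_ext₂ fun E a r => ?_
    have e := congrArg (fun f => E.map f (E.pair a r)) h'
    simp only [Points.map_comp, Points.map_whiskerRight, Points.map_whiskerLeft,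
      Points.map_rightUnitor, Points.map_leftUnitor_inv] at e
    simp only [Points.map_comp, Points.map_whiskerLeft, map_add, LinearMap.add_apply, e]
    conv_rhs => rw [E.biprod_eq a]
    simp [E.pair_scalar_left (E.map biprod.fst a), E.map_inl_scalar r,
      E.map_inl_scalar (E.map biprod.fst a)]
    exact smul_comm _ _ _

theorem unitalDuality_isSymmetric {s : SelfDuality Y} (h : s.IsSymmetric) :
    (unitalDuality s).IsSymmetric :=
  Points.hom_ext₂ fun E a b => by
    have := congrArg (fun f => E.map f (E.pair (E.map biprod.snd a) (E.map biprod.snd b))) h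
    simp only [Points.map_comp, Points.map_braiding] at this
    simp [unitalDuality, this, mul_comm]

theorem trace_unitalAlgebra (κ : ℂ) (s : SelfDuality Y) (m : Y ⊗ Y ⟶ Y) :
    (unitalAlgebra κ s.cap m).trace (unitalDuality s) = biprod.fst :=
  Points.hom_ext₁ fun E a => by
    simp [UnitalAlgebra.trace, unitalAlgebra, unitalDuality]

end

end

section

open Limits

/-! ### The traceless part of a cubic Jordan algebra -/

section

variable {R M : Type*} [CommRing R] [Algebra ℂ R] [AddCommGroup M] [Module R M] [Module ℂ M]
  [IsScalarTower ℂ R M]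

/-- The Jordan identity, for the traceless parts of the three symmetrized variables. -/
theorem jordan_of_cubic (B : M →ₗ[R] M →ₗ[R] R) (m : M →ₗ[R] M →ₗ[R] M)
    (hB : ∀ x y, B x y = B y x) (hm : ∀ x y, m x y = m y x)
    (hBm : ∀ x y z, B (m x y) z = B x (m y z))
    (hr : ∀ x y z, (2 : R) • (m (m x y) z + m x (m y z) + m y (m x z)) =
      B x y • z + B y z • x + B x z • y) (a b c y : M) :
    (B a y • m b c - B y (m b c) • a + m (m a y) (m b c) - m a (m y (m b c))) +
      (B b y • m c a - B y (m c a) • b + m (m b y) (m c a) - m b (m y (m c a))) +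
      (B c y • m a b - B y (m a b) • c + m (m c y) (m a b) - m c (m y (m a b))) = 0 := by
  -- This is the cubic relation at `b, c, ay` minus `a` times the cubic relation at `b, c, y`.
  have key : ∀ a b c, (2 : R) • (m (m a y) (m b c) - m a (m y (m b c))) =
      (-2 : R) • m b (m c (m a y)) + (-2 : R) • m c (m b (m a y)) + (2 : R) • m a (m b (m c y)) +
      (2 : R) • m a (m c (m b y)) + B y (m c a) • b + B y (m a b) • c - B c y • m a b -
      B b y • m c a := by
    intro a b c
    have h₁ := hr b c (m a y)
    have h₂ := congrArg (m a) (hr b c y)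
    rw [hm (m b c) (m a y), ← hBm, hB (m c a) y, ← hBm b, hm b a, hB (m a b) y] at h₁
    simp only [map_add, map_smul, hm (m b c) y, hm a c] at h₂
    linear_combination (norm := module) h₁ - h₂
  have h₂ : Function.Injective fun x : M => (2 : R) • x := by
    intro x y h
    have h' : (2 : ℂ) • x = (2 : ℂ) • y := by simpa [two_smul] using h
    exact smul_right_injective M (two_ne_zero (α := ℂ)) h'
  refine h₂ ?_
  simp only
  -- In the cyclic sum each nested product of `a, b, c` applied to `y` occurs once with each sign,
  -- and the terms with `B` cancel likewise.
  linear_combination (norm := module) key a b c + key b c a + key c a b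

end

section

variable {C : Type u} [Category.{v} C] [Preadditive C] [Linear ℂ C] [MonoidalCategory C]
  [MonoidalPreadditive C] [MonoidalLinear ℂ C] [SymmetricCategory C] {X : C}
  {s : SelfDuality X} {τ : X ⊗ X ⟶ X} {σ d b t : ℂ}

namespace IsEvaluated

/-- Any `κ` is allowed, since it affects only the unit component of a product of traceless elements.
-/
theorem hasTracelessPart (s : SelfDuality X) (τ : X ⊗ X ⟶ X) (κ : ℂ) :
    HasTracelessPart (unitalAlgebra κ (matCap s.cap) (matMul τ))
      (unitalDuality (AdditiveCompletion.matDuality s)) s τ where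
  one_eq := rfl
  trace_eq := trace_unitalAlgebra κ (AdditiveCompletion.matDuality s) _
  mul_eq := Points.hom_ext₂ fun E x y => by simp [unitalAlgebra]
  cap_eq := Points.hom_ext₂ fun E x y => by
    simp [unitalDuality, AdditiveCompletion.matDuality]

theorem matDuality_isSymmetric (H : IsEvaluated s τ σ d b t) :
    (AdditiveCompletion.matDuality s).IsSymmetric :=
  Points.hom_ext₂ fun E x y => by
    rw [E.map_comp, E.map_braiding]
    exact E.matCap_symm H y x

theorem isCommutative (H : IsEvaluated s τ 1 d b t) (κ : ℂ) :
    (unitalAlgebra κ (matCap s.cap) (matMul τ)).IsCommutative :=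
  Points.hom_ext₂ fun E x y => E.biprod_ext
    (by simp [unitalAlgebra, mul_comm, E.matCap_symm H (E.map biprod.snd y)])
    (by
      have := E.matMul_comm H (E.map biprod.snd x) (E.map biprod.snd y)
      simp only [unitalAlgebra, Points.map_comp, Points.map_braiding, Points.map_snd_unitalMul,
        this, one_smul]
      abel)

/-- The associator of `𝟙 ⊕ X`. -/
theorem unitalMul_assoc (H : IsEvaluated s τ σ d b t) (E : Points.{v} (Mat_ C))
    (x y z : E.obj (onePlus X)) :
    E.map (unitalMul 1 (matCap s.cap) (matMul τ))
        (E.pair (E.map (unitalMul 1 (matCap s.cap) (matMul τ)) (E.pair x y)) z) =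
      E.map (unitalMul 1 (matCap s.cap) (matMul τ))
        (E.pair x (E.map (unitalMul 1 (matCap s.cap) (matMul τ)) (E.pair y z))) +
      E.map biprod.inr (
        E.map (matCap s.cap) (E.pair (E.map biprod.snd x) (E.map biprod.snd y)) • E.map biprod.snd z -
        E.map (matCap s.cap) (E.pair (E.map biprod.snd y) (E.map biprod.snd z)) • E.map biprod.snd x +
        E.map (matMul τ) (E.pair (E.map (matMul τ)
          (E.pair (E.map biprod.snd x) (E.map biprod.snd y))) (E.map biprod.snd z)) -
        E.map (matMul τ) (E.pair (E.map biprod.snd x) (E.map (matMul τ)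
          (E.pair (E.map biprod.snd y) (E.map biprod.snd z))))) := by
  refine E.biprod_ext ?_ ?_
  · simp [E.matCap_mul H]
    ring
  · simp
    module

/-- The commutative Frobenius algebra `𝟙 ⊕ X`. -/
noncomputable def frobeniusAlgebra (H : IsEvaluated s τ 1 d b t)
    (e : fourLegs s τ (-1) 1 0 (-1) 1 0 = 0) : FrobeniusAlgebra (onePlus X) where
  toUnitalAlgebra := unitalAlgebra 1 (matCap s.cap) (matMul τ)
  commutative := H.isCommutative 1
  associative := Points.hom_ext₃ fun E x y z => by
    have := E.mat_fourLegs H e (E.map biprod.snd x) (E.map biprod.snd y) (E.map biprod.snd z)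
    simp only [unitalAlgebra, Points.map_comp, Points.map_whiskerRight, Points.map_whiskerLeft,
      Points.map_associator]
    rw [unitalMul_assoc H E]
    rw [add_eq_left]
    refine Eq.trans (congrArg _ ?_) (map_zero _)
    -- The `Sym` relation is exactly minus the associator of the traceless parts.
    linear_combination (norm := module) -this
  tr := biprod.fst
  form := unitalDuality (AdditiveCompletion.matDuality s)
  form_symm := unitalDuality_isSymmetric H.matDuality_isSymmetric
  cap_eq := Points.hom_ext₂ fun E x y => by
    simp [unitalDuality, unitalAlgebra, AdditiveCompletion.matDuality]

/-- For an anticommutative vertex `⟨xy, z⟩` is an alternating form; this and the next two lemmas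
record its sign under transpositions. -/
theorem matCap_mul_add (H : IsEvaluated s τ (-1) d b t) (E : Points.{v} (Mat_ C))
    (p q r : E.obj (inMat X)) : E.map (matCap s.cap) (E.pair p (E.map (matMul τ) (E.pair q r))) +
      E.map (matCap s.cap) (E.pair (E.map (matMul τ) (E.pair p r)) q) = 0 := by
  rw [E.matCap_mul H, E.matMul_comm H q r]
  simp

theorem matCap_add_mul (H : IsEvaluated s τ (-1) d b t) (E : Points.{v} (Mat_ C))
    (p q r : E.obj (inMat X)) : E.map (matCap s.cap) (E.pair (E.map (matMul τ) (E.pair p q)) r) +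
      E.map (matCap s.cap) (E.pair (E.map (matMul τ) (E.pair p r)) q) = 0 := by
  rw [E.matCap_mul H, H.matCap_mul_add E]

theorem matCap_mul_add_swap (H : IsEvaluated s τ (-1) d b t) (E : Points.{v} (Mat_ C))
    (p q r : E.obj (inMat X)) : E.map (matCap s.cap) (E.pair p (E.map (matMul τ) (E.pair q r))) +
      E.map (matCap s.cap) (E.pair r (E.map (matMul τ) (E.pair q p))) = 0 := by
  rw [E.matCap_symm H r, E.matCap_symm H p, H.matCap_add_mul E]

/-- This is the `G2` relation applied to `x, z, y` and paired with `w`, rewritten with the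
antisymmetry of `⟨xy, z⟩`. -/
theorem composition_traceless (H : IsEvaluated s τ (-1) d b t)
    (e : fourLegs s τ 1 1 (-2) 1 1 0 = 0) (E : Points.{v} (Mat_ C)) (x y z w : E.obj (inMat X)) :
    E.map (matCap s.cap) (E.pair x z) * E.map (matCap s.cap) (E.pair y w) +
      E.map (matCap s.cap) (E.pair x w) * E.map (matCap s.cap) (E.pair y z) +
      E.map (matCap s.cap)
        (E.pair (E.map (matMul τ) (E.pair x z)) (E.map (matMul τ) (E.pair y w))) +
      E.map (matCap s.cap)
        (E.pair (E.map (matMul τ) (E.pair x w)) (E.map (matMul τ) (E.pair y z))) =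
      2 * (E.map (matCap s.cap) (E.pair x y) * E.map (matCap s.cap) (E.pair z w)) := by
  have h₁ := congrArg (fun p => E.map (matCap s.cap) (E.pair p w)) (E.mat_fourLegs H e x z y)
  have h₂ := H.matCap_add_mul E x (E.map (matMul τ) (E.pair z y)) w
  have h₃ := E.matMul_comm H y z
  simp only [one_smul, zero_smul, add_zero, neg_smul, map_add, map_neg, LinearMap.add_apply,
    LinearMap.neg_apply, Points.pair_scalar_smul_left, Points.map_scalar_smul, two_smul,
    map_zero, LinearMap.zero_apply, smul_eq_mul, E.matCap_mul H (E.map _ (E.pair x z)), h₃] at h₁ h₂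
  linear_combination h₁ - h₂ +
    E.map (matCap s.cap) (E.pair x w) * E.matCap_symm H y z

/-- The Hurwitz algebra `𝟙 ⊕ X`. -/
noncomputable def hurwitzAlgebra (H : IsEvaluated s τ (-1) d b t)
    (e : fourLegs s τ 1 1 (-2) 1 1 0 = 0) : HurwitzAlgebra (onePlus X) where
  -- Taking `b = d = 1` and traceless `a, c` in the composition law forces `⟨ac, 1⟩ = -⟨a, c⟩`,
  -- hence `κ = -1`.
  toUnitalAlgebra := unitalAlgebra (-1) (matCap s.cap) (matMul τ)
  form := unitalDuality (AdditiveCompletion.matDuality s)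
  form_symm := unitalDuality_isSymmetric H.matDuality_isSymmetric
  one_one := by
    rw [(hasTracelessPart s τ (-1)).trace_eq]
    exact biprod.inl_fst
  composition := Points.hom_ext₂₂ fun E x y z w => by
    simp [unitalDuality, unitalAlgebra, AdditiveCompletion.matDuality, two_smul]
    have h₀ := H.composition_traceless e E (E.map biprod.snd x) (E.map biprod.snd y)
      (E.map biprod.snd z) (E.map biprod.snd w)
    have h₁ := H.matCap_mul_add_swap E (E.map biprod.snd z) (E.map biprod.snd y)
      (E.map biprod.snd w)
    have h₂ := H.matCap_mul_add E (E.map biprod.snd x) (E.map biprod.snd y)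
      (E.map biprod.snd w)
    have h₃ := H.matCap_add_mul E (E.map biprod.snd x) (E.map biprod.snd z)
      (E.map biprod.snd w)
    have h₄ := H.matCap_mul_add E (E.map biprod.snd x) (E.map biprod.snd y)
      (E.map biprod.snd z)
    rw [E.matCap_symm H (E.map biprod.snd w) (E.map biprod.snd z),
      E.matCap_symm H (E.map biprod.snd z) (E.map biprod.snd y),
      E.matCap_symm H (E.map biprod.snd w) (E.map biprod.snd y)]
    -- The terms with one unit component and three traceless ones cancel by antisymmetry; the purely
    -- traceless part is `h₀`.
    linear_combination h₀ + E.map biprod.fst x * h₁ + E.map biprod.fst z * h₂ +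
      E.map biprod.fst y * h₃ + E.map biprod.fst w * h₄

end IsEvaluated

end

end

/-! ### The Jordan and Cayley–Hamilton identities from the relation of `F4`. -/

section

open Limits

section

variable (R : Type v) [CommRing R] [Algebra ℂ R]

/-- In the scalar ring the fractional coefficients are expressed through a single element `w` with
`2w = 3`. -/
theorem algebraMap_nine_halves : algebraMap ℂ R (9 / 2) = algebraMap ℂ R (3 / 2) + 3 := by
  rw [show (9 / 2 : ℂ) = 3 / 2 + 3 by norm_num, map_add, map_ofNat]

theorem two_mul_algebraMap_three_halves : 2 * algebraMap ℂ R (3 / 2) = 3 := by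
  have h := map_mul (algebraMap ℂ R) 2 (3 / 2)
  rwa [show (2 : ℂ) * (3 / 2) = 3 by norm_num, map_ofNat, map_ofNat, eq_comm] at h

theorem two_mul_algebraMap_neg_half : 2 * algebraMap ℂ R (-1 / 2) = -1 := by
  have h := map_mul (algebraMap ℂ R) 2 (-1 / 2)
  rwa [show (2 : ℂ) * (-1 / 2) = -1 by norm_num, map_ofNat, map_neg, map_one, eq_comm] at h

end

section

variable {C : Type u} [Category.{v} C] [Preadditive C] [Linear ℂ C] [MonoidalCategory C]
  [MonoidalPreadditive C] [MonoidalLinear ℂ C] [SymmetricCategory C]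

/-- A morphism out of a tensor product, as a bilinear map on elements. -/
def Points.bilin (E : Points.{v} C) {A B W : C} (f : A ⊗ B ⟶ W) :
    E.obj A →ₗ[E.obj (𝟙_ C)] E.obj B →ₗ[E.obj (𝟙_ C)] E.obj W :=
  LinearMap.mk₂ _ (fun a b => E.map f (E.pair a b)) (by simp) (by simp) (by simp) (by simp)

theorem Points.map_symmetrizer₃ (E : Points.{v} C) {A : C} (a b c : E.obj A) :
    E.map (symmetrizer₃ A) (E.pair (E.pair a b) c) =
      E.pair (E.pair a b) c + E.pair (E.pair b a) c + E.pair (E.pair a c) b +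
        E.pair (E.pair b c) a + E.pair (E.pair c a) b + E.pair (E.pair c b) a := by
  simp [symmetrizer₃]

theorem Points.map_jordanShuffle (E : Points.{v} C) {A : C} (a b c y : E.obj A) :
    E.map (jordanShuffle A) (E.pair (E.pair (E.pair a b) c) y) =
      E.pair (E.pair a y) (E.pair b c) := by
  simp [jordanShuffle]

variable {X : C} {s : SelfDuality X} {τ : X ⊗ X ⟶ X} {d b t : ℂ}

namespace IsEvaluated

theorem mat_cubic (H : IsEvaluated s τ 1 d b t)
    (e : fourLegs s τ (-1 / 2) (-1 / 2) (-1 / 2) 1 1 1 = 0) (E : Points.{v} (Mat_ C))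
    (x y z : E.obj (inMat X)) :
    (2 : E.obj (𝟙_ (Mat_ C))) • (E.map (matMul τ) (E.pair (E.map (matMul τ) (E.pair x y)) z) +
      E.map (matMul τ) (E.pair x (E.map (matMul τ) (E.pair y z))) +
      E.map (matMul τ) (E.pair y (E.map (matMul τ) (E.pair x z)))) =
    E.map (matCap s.cap) (E.pair x y) • z + E.map (matCap s.cap) (E.pair y z) • x +
      E.map (matCap s.cap) (E.pair x z) • y := by
  have h₁ := E.mat_fourLegs H e x y z
  have h₂ : 2 * algebraMap ℂ (E.obj (𝟙_ (Mat_ C))) (-1 / 2) = -1 := two_mul_algebraMap_neg_half _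
  have h₃ := congrArg (fun r => r • (E.map (matCap s.cap) (E.pair x y) • z +
    E.map (matCap s.cap) (E.pair y z) • x + E.map (matCap s.cap) (E.pair x z) • y)) h₂
  simp only [one_smul, ← algebraMap_smul (E.obj (𝟙_ (Mat_ C))) (-1 / 2 : ℂ)] at h₁
  linear_combination (norm := module) (2 : E.obj (𝟙_ (Mat_ C))) • h₁ - h₃

theorem matMul_comm' (H : IsEvaluated s τ 1 d b t) (E : Points.{v} (Mat_ C))
    (x y : E.obj (inMat X)) : E.map (matMul τ) (E.pair x y) = E.map (matMul τ) (E.pair y x) := by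
  rw [E.matMul_comm H, one_smul]

theorem matCap_mul_cycle (H : IsEvaluated s τ 1 d b t) (E : Points.{v} (Mat_ C))
    (x y z : E.obj (inMat X)) : E.map (matCap s.cap) (E.pair y (E.map (matMul τ) (E.pair z x))) =
      E.map (matCap s.cap) (E.pair x (E.map (matMul τ) (E.pair y z))) := by
  rw [← E.matCap_mul H x, H.matMul_comm' E x y, E.matCap_mul H, H.matMul_comm' E x z]

/-- For a commutative product the associators `[x, y, z]` and `[z, y, x]` are opposite. This removes
the contributions of unit components from the Jordan identity. -/
theorem jordan_aux (H : IsEvaluated s τ 1 d b t) (E : Points.{v} (Mat_ C))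
    (x y z : E.obj (inMat X)) :
    (E.map (matCap s.cap) (E.pair x y) • z - E.map (matCap s.cap) (E.pair y z) • x +
      E.map (matMul τ) (E.pair (E.map (matMul τ) (E.pair x y)) z) -
      E.map (matMul τ) (E.pair x (E.map (matMul τ) (E.pair y z)))) +
    (E.map (matCap s.cap) (E.pair z y) • x - E.map (matCap s.cap) (E.pair y x) • z +
      E.map (matMul τ) (E.pair (E.map (matMul τ) (E.pair z y)) x) -
      E.map (matMul τ) (E.pair z (E.map (matMul τ) (E.pair y x)))) = 0 := by
  rw [E.matCap_symm H x y, E.matCap_symm H z y, H.matMul_comm' E (E.map _ (E.pair x y)),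
    H.matMul_comm' E (E.map _ (E.pair z y)), H.matMul_comm' E x y, H.matMul_comm' E z y]
  abel

set_option maxHeartbeats 1000000 in
/-- The tracial Jordan algebra `𝟙 ⊕ X`. -/
noncomputable def jordanAlgebra (H : IsEvaluated s τ 1 d b t)
    (e : fourLegs s τ (-1 / 2) (-1 / 2) (-1 / 2) 1 1 1 = 0) :
    TracialJordanAlgebra (onePlus X) where
  toUnitalAlgebra := unitalAlgebra 1 (matCap s.cap) (matMul τ)
  commutative := H.isCommutative 1
  form := unitalDuality (AdditiveCompletion.matDuality s)
  form_symm := unitalDuality_isSymmetric H.matDuality_isSymmetric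
  form_assoc := Points.hom_ext₃ fun E x y z => by
    have := E.matCap_mul H (E.map biprod.snd x) (E.map biprod.snd y) (E.map biprod.snd z)
    simp [unitalDuality, unitalAlgebra, AdditiveCompletion.matDuality, this]
    ring
  one_one := by
    rw [(hasTracelessPart s τ 1).trace_eq]
    exact biprod.inl_fst
  jordan := Points.hom_ext₄ fun E x₁ x₂ x₃ y => by
    have J := jordan_of_cubic (E.bilin (matCap s.cap)) (E.bilin (matMul τ)) (E.matCap_symm H)
      (H.matMul_comm' E) (E.matCap_mul H) (H.mat_cubic e E) (E.map biprod.snd x₁)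
      (E.map biprod.snd x₂) (E.map biprod.snd x₃) (E.map biprod.snd y)
    simp only [Points.bilin, LinearMap.mk₂_apply] at J
    have J₁₂ := H.jordan_aux E (E.map biprod.snd x₁) (E.map biprod.snd y) (E.map biprod.snd x₂)
    have J₂₃ := H.jordan_aux E (E.map biprod.snd x₂) (E.map biprod.snd y) (E.map biprod.snd x₃)
    have J₃₁ := H.jordan_aux E (E.map biprod.snd x₃) (E.map biprod.snd y) (E.map biprod.snd x₁)
    simp only [unitalAlgebra, Points.map_comp, Points.map_whiskerRight, Points.map_whiskerLeft,
      Points.map_symmetrizer₃, map_add, LinearMap.add_apply, Points.map_jordanShuffle,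
      Points.map_tensorHom, Points.map_associator, unitalMul_assoc H E, Points.map_snd_unitalMul]
    refine E.biprod_ext ?_ ?_
    · simp
    · simp only [map_add, map_sub, Points.map_snd_inr, Points.map_scalar_smul,
        Points.pair_scalar_smul_right,
        H.matMul_comm' E (E.map biprod.snd x₂) (E.map biprod.snd x₁),
        H.matMul_comm' E (E.map biprod.snd x₃) (E.map biprod.snd x₂),
        H.matMul_comm' E (E.map biprod.snd x₁) (E.map biprod.snd x₃)]
      -- By commutativity the six permutations fall into three equal pairs, hence the factor 2. The
      -- traceless part of `bc` is `tr(b) c + tr(c) b + τ(b, c)`: the last term gives `J`, and the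
      -- coefficient of each trace is a sum of two opposite associators.
      linear_combination (norm := module) (2 : E.obj (𝟙_ (Mat_ C))) • J +
        (2 : E.obj (𝟙_ (Mat_ C))) • E.map biprod.fst x₃ • J₁₂ +
        (2 : E.obj (𝟙_ (Mat_ C))) • E.map biprod.fst x₁ • J₂₃ +
        (2 : E.obj (𝟙_ (Mat_ C))) • E.map biprod.fst x₂ • J₃₁

-- For traceless `x` the `F4` relation says that the cube for `τ` is `½⟨x, x⟩ x`; the unit component
-- of `x²` adds `⟨x, x⟩ x`, which gives the coefficient `3/2`. The remaining coefficients are those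
-- obtained by substituting `x - tr(x) 1`. The unit component of the identity holds formally.
set_option maxHeartbeats 1000000 in
theorem jordanAlgebra_isCubicCayleyHamilton (H : IsEvaluated s τ 1 d b t)
    (e : fourLegs s τ (-1 / 2) (-1 / 2) (-1 / 2) 1 1 1 = 0) :
    (H.jordanAlgebra e).IsCubicCayleyHamilton := by
  rw [TracialJordanAlgebra.IsCubicCayleyHamilton]
  have htr : (H.jordanAlgebra e).trace (H.jordanAlgebra e).form = biprod.fst :=
    (hasTracelessPart s τ 1).trace_eq
  have hm : (H.jordanAlgebra e).mul = unitalMul 1 (matCap s.cap) (matMul τ) := rfl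
  have h₁ : (H.jordanAlgebra e).one = biprod.inl := rfl
  simp only [htr, hm, h₁]
  refine Points.hom_ext₃ fun E x₁ x₂ x₃ => E.biprod_ext ?_ ?_
  · simp only [Points.map_symmetrizer₃, Points.map_comp, map_add, map_sub, LinearMap.add_apply,
      LinearMap.sub_apply, LinearMap.map_smul, LinearMap.smul_apply, Points.map_associator,
      Points.map_whiskerLeft, Points.map_whiskerRight, Points.map_tensorHom,
      Points.map_leftUnitor, Points.map_scalar_smul, Points.map_fst_unitalMul,
      Points.map_snd_unitalMul, Points.map_fst_inl, Points.pair_scalar_smul_right, one_smul,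
      LinearMap.zero_apply, map_zero, smul_eq_mul,
      H.matMul_comm' E (E.map biprod.snd x₂) (E.map biprod.snd x₁),
      H.matMul_comm' E (E.map biprod.snd x₃) (E.map biprod.snd x₂),
      H.matMul_comm' E (E.map biprod.snd x₁) (E.map biprod.snd x₃),
      E.matCap_symm H (E.map biprod.snd x₂) (E.map biprod.snd x₁),
      E.matCap_symm H (E.map biprod.snd x₃) (E.map biprod.snd x₂),
      E.matCap_symm H (E.map biprod.snd x₁) (E.map biprod.snd x₃),
      H.matCap_mul_cycle E (E.map biprod.snd x₁) (E.map biprod.snd x₂),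
      H.matCap_mul_cycle E (E.map biprod.snd x₂) (E.map biprod.snd x₃)]
    have hu : algebraMap ℂ (E.obj (𝟙_ (Mat_ C))) (9 / 2) = algebraMap ℂ _ (3 / 2) + 3 :=
      algebraMap_nine_halves _
    simp only [Algebra.smul_def, hu, map_ofNat]
    ring
  · have hu : algebraMap ℂ (E.obj (𝟙_ (Mat_ C))) (9 / 2) = algebraMap ℂ _ (3 / 2) + 3 :=
      algebraMap_nine_halves _
    have hw : 2 * algebraMap ℂ (E.obj (𝟙_ (Mat_ C))) (3 / 2) = 3 :=
      two_mul_algebraMap_three_halves _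
    have h₁ := H.mat_cubic e E (E.map biprod.snd x₁) (E.map biprod.snd x₂) (E.map biprod.snd x₃)
    rw [H.matMul_comm' E (E.map (matMul τ) _) (E.map biprod.snd x₃),
        H.matMul_comm' E (E.map biprod.snd x₁) (E.map biprod.snd x₃),
        E.matCap_symm H (E.map biprod.snd x₁) (E.map biprod.snd x₃)] at h₁
    have h₂ := congrArg (fun r => r •
      (E.map (matCap s.cap) (E.pair (E.map biprod.snd x₁) (E.map biprod.snd x₂)) •
        E.map biprod.snd x₃ +
      E.map (matCap s.cap) (E.pair (E.map biprod.snd x₂) (E.map biprod.snd x₃)) •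
        E.map biprod.snd x₁ +
      E.map (matCap s.cap) (E.pair (E.map biprod.snd x₃) (E.map biprod.snd x₁)) •
        E.map biprod.snd x₂)) hw
    simp only [Points.map_symmetrizer₃, Points.map_comp, map_add, map_sub, LinearMap.add_apply,
      LinearMap.sub_apply, LinearMap.map_smul, LinearMap.smul_apply, Points.map_associator,
      Points.map_whiskerLeft, Points.map_whiskerRight, Points.map_tensorHom,
      Points.map_leftUnitor, Points.map_scalar_smul, Points.map_fst_unitalMul,
      Points.map_snd_unitalMul, Points.map_snd_inl, Points.pair_scalar_smul_right, one_smul,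
      LinearMap.zero_apply, map_zero,
      H.matMul_comm' E (E.map biprod.snd x₂) (E.map biprod.snd x₁),
      H.matMul_comm' E (E.map biprod.snd x₃) (E.map biprod.snd x₂),
      H.matMul_comm' E (E.map biprod.snd x₁) (E.map biprod.snd x₃),
      E.matCap_symm H (E.map biprod.snd x₂) (E.map biprod.snd x₁),
      E.matCap_symm H (E.map biprod.snd x₃) (E.map biprod.snd x₂),
      E.matCap_symm H (E.map biprod.snd x₁) (E.map biprod.snd x₃)]
    simp only [← algebraMap_smul (E.obj (𝟙_ (Mat_ C))) (9 / 2 : ℂ),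
      ← algebraMap_smul (E.obj (𝟙_ (Mat_ C))) (3 / 2 : ℂ),
      ← algebraMap_smul (E.obj (𝟙_ (Mat_ C))) (3 : ℂ), hu, map_ofNat]
    linear_combination (norm := module) h₁ - h₂

end IsEvaluated

end

end

theorem proposition6p38 {C : Type u} [Category.{v} C] [Preadditive C] [Linear ℂ C]
    [MonoidalCategory C] [MonoidalPreadditive C] [MonoidalLinear ℂ C] [SymmetricCategory C]
    [RightRigidCategory C] [RibbonCategory C] {X : C} (s : SelfDuality X) (τ : X ⊗ X ⟶ X)
    (h : Trivalent.IsTrivalentRibbon s τ) (d : ℂ)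
    (hd : Trivalent.circleValue s = d • 𝟙 (𝟙_ C))
    (h4 : Module.rank ℂ (((X ⊗ X) ⊗ X) ⊗ X ⟶ 𝟙_ C) ≤ 5) :
    ∃ s' : SelfDuality X, s'.IsRescalingOf s ∧ s'.IsSymmetric ∧
      ((Trivalent.IsAlgebraObject (Trivalent.symTheory d) s' τ ∧
          ∃ A : FrobeniusAlgebra (onePlus X), A.IsNormalized ∧
            HasTracelessPart A.toUnitalAlgebra A.form s' τ) ∨
        (Trivalent.IsAlgebraObject (Trivalent.g2Theory d) s' τ ∧
          ∃ A : HurwitzAlgebra (onePlus X),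
            HasTracelessPart A.toUnitalAlgebra A.form s' τ) ∨
        (Trivalent.IsAlgebraObject (Trivalent.f4Theory d) s' τ ∧
          ∃ A : TracialJordanAlgebra (onePlus X), A.IsCubicCayleyHamilton ∧
            HasTracelessPart A.toUnitalAlgebra A.form s' τ) ∨
        (IsLieBracket τ ∧ d + 2 ≠ 0 ∧ ∃ b : ℂ, b ≠ 0 ∧
          Trivalent.IsAlgebraObject (Trivalent.excTheory d b) s' τ)) := by

  obtain ⟨s', hs, h'⟩ := h.classification hd h4
  refine ⟨s', hs, ?_⟩
  rcases h' with ⟨H, e⟩ | ⟨H, e⟩ | ⟨H, e⟩ | ⟨hd2, b, hb, H, e, hQ⟩ <;> refine ⟨H.symm, ?_⟩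
  · exact Or.inl ⟨(Trivalent.isModel_symTheory H e).isAlgebraObject h.twist_eq_id,
      H.frobeniusAlgebra e, Limits.biprod.inl_fst, IsEvaluated.hasTracelessPart s' τ 1⟩
  · exact Or.inr (Or.inl ⟨(Trivalent.isModel_g2Theory H e).isAlgebraObject h.twist_eq_id,
      H.hurwitzAlgebra e, IsEvaluated.hasTracelessPart s' τ (-1)⟩)
  · exact Or.inr (Or.inr (Or.inl
      ⟨(Trivalent.isModel_f4Theory H e).isAlgebraObject h.twist_eq_id, H.jordanAlgebra e,
        H.jordanAlgebra_isCubicCayleyHamilton e, IsEvaluated.hasTracelessPart s' τ 1⟩))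
  · exact Or.inr (Or.inr (Or.inr ⟨H.isLieBracket e, hd2, b, hb,
      (Trivalent.isModel_excTheory H e hQ).isAlgebraObject h.twist_eq_id⟩))
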